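/- Let $r\ge 1$, let $A\in\mathbb{C}^{r\times r}$ be nonsingular and $B\in\mathbb{C}^{r\times r}$ Hermitian. *Chebyshev polynomials and their measures.* The matrix Chebyshev polynomials of the second kind are defined by $P_{-1}\equiv 0$, $P_0\equiv I$ and $xP_n=A_{n+1}P_{n+1}+BP_n+A_n^*P_{n-1}$ $(n\ge 0)$ with $A_n=A^*$ for all $n\geq 1$; those of the first kind by the same recurrence with $A_1=\sqrt2A^*$ and $A_n=A^*$ for $n\ge 2$. Let $W$ and $X$ be spectral measures of the polynomials of the second and of the first kind respectively, i.e. positive semidefinite $r\times r$ matrix-valued measures on $\mathbb{R}$ with finite moments for which $\int P_n\,dM\,P_m^*=\delta_{nm}I$ for all $n,m\ge 0$ (in particular $\int dW=\int dX=I$). Put $F_W(x)=\int\frac{dW(t)}{x-t}$ and $F_X(x)=\int\frac{dX(t)}{x-t}$. *Roots and vectors.* For $x\in\mathbb{C}$ let $z_1(x),\dots,z_{2r}(x)$ be the roots $z$, counted with multiplicity, of $f(z,x)=\det(zA^*+B+z^{-1}A-xI)=0$, ordered so that $0<|z_1(x)|\le\dots\le|z_{2r}(x)|$, and let $\Gamma_0=\{x\in\mathbb{C}: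 |z_r(x)|=|z_{r+1}(x)|\}$. Call unit vectors $\mathbf v_1(x),\dots,\mathbf v_{2r}(x)\in\mathbb{C}^r$ admissible at $x$ (for the chosen ordering of the roots) if $(z_kA^*+B+z_k^{-1}A-xI)\mathbf v_k=0$ for all $k$ and if, for every $k$, the span of $\{\mathbf v_l: z_l=z_k\}$ has dimension equal both to $\dim\ker(z_kA^*+B+z_k^{-1}A-xI)$ and to the multiplicity of $z_k$ as a root of $z^rf(z,x)$. Let $D(x)=\mathrm{diag}(z_1(x),\dots,z_r(x))$ and let $V(x)$ be the matrix with columns $\mathbf v_1(x),\dots,\mathbf v_r(x)$. *Claim.* For all but finitely many $x\in\mathbb{C}\setminus\Gamma_0$: the integrals defining $F_W(x)$ and $F_X(x)$ converge, admissible vectors exist, and for every ordering of the roots by increasing modulus and every admissible choice of vectors, the matrices inverted below are invertible and $$F_W(x)=V(x)D(x)V(x)^{-1}A^{-1},$$ $$F_X(x)=\bigl[xI-B-2A^*F_W(x)A\bigr]^{-1}=V(x)\bigl[AV(x)D(x)^{-1}-A^*V(x)D(x)\bigr]^{-1}.$$ Moreover, both $W$ and $X$ are supported on $\Gamma_0$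 together with a finite, possibly empty, set of mass points on $\mathbb{R}$. -/

import Mathlib

open MeasureTheory Matrix
open scoped ComplexOrder

noncomputable section

namespace MatrixChebyshev

/-- The values `P n x`, `n = 0, 1, 2, …`, of the matrix polynomials with recurrence coefficients
`a 1, a 2, …` (nonsingular) and `b 0, b 1, …` (Hermitian):
`x P n = a (n + 1) * P (n + 1) + b n * P n + (a n)ᴴ * P (n - 1)`, with `P (-1) = 0`, `P 0 = 1`.
The entry `a 0` is never used. -/
def orthPoly {r : ℕ} (a b : ℕ → Matrix (Fin r) (Fin r) ℂ) :
    ℕ → ℂ → Matrix (Fin r) (Fin r) ℂ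
  | 0, _ => 1
  | 1, x => (a 1)⁻¹ * (x • (1 : Matrix (Fin r) (Fin r) ℂ) - b 0)
  | n + 2, x => (a (n + 2))⁻¹ *
      ((x • (1 : Matrix (Fin r) (Fin r) ℂ) - b (n + 1)) * orthPoly a b (n + 1) x
        - (a (n + 1))ᴴ * orthPoly a b n x)

/-- The three term recurrence for `n ≥ 1`. -/
theorem orthPoly_recurrence {r : ℕ} (a b : ℕ → Matrix (Fin r) (Fin r) ℂ)
    (ha : ∀ n, IsUnit (a n).det) (n : ℕ) (x : ℂ) :
    x • orthPoly a b (n + 1) x = a (n + 2) * orthPoly a b (n + 2) x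
      + b (n + 1) * orthPoly a b (n + 1) x + (a (n + 1))ᴴ * orthPoly a b n x := by
  rw [orthPoly, Matrix.mul_nonsing_inv_cancel_left _ _ (ha _)]
  rw [sub_mul, Matrix.smul_mul, one_mul]
  abel

/-- The three term recurrence for `n = 0`. -/
theorem orthPoly_recurrence_zero {r : ℕ} (a b : ℕ → Matrix (Fin r) (Fin r) ℂ)
    (ha : ∀ n, IsUnit (a n).det) (x : ℂ) :
    x • orthPoly a b 0 x = a 1 * orthPoly a b 1 x + b 0 * orthPoly a b 0 x := by
  simp only [orthPoly]
  rw [Matrix.mul_nonsing_inv_cancel_left _ _ (ha _)]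
  simp

/-- Off-diagonal recurrence coefficients of the matrix Chebyshev polynomials of the second kind. -/
def secondKindCoeff {r : ℕ} (A : Matrix (Fin r) (Fin r) ℂ) (_n : ℕ) :
    Matrix (Fin r) (Fin r) ℂ := A

/-- Off-diagonal recurrence coefficients of the matrix Chebyshev polynomials of the first kind. -/
def firstKindCoeff {r : ℕ} (A : Matrix (Fin r) (Fin r) ℂ) (n : ℕ) :
    Matrix (Fin r) (Fin r) ℂ := if n = 1 then ((Real.sqrt 2 : ℝ) : ℂ) • A else A

/-- A (finite) positive semidefinite matrix-valued Borel measure on the real line, given by its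
entries, which are complex measures. -/
structure MatrixMeasure (r : ℕ) where
  entry : Fin r → Fin r → ComplexMeasure ℝ
  posSemidef : ∀ s : Set ℝ, MeasurableSet s →
    (Matrix.of fun i j => entry i j s).PosSemidef

namespace MatrixMeasure

variable {r : ℕ}

/-- The integral `∫ F(t) dM(t) G(t)ᴴ` of two matrix functions against a matrix measure. -/
def sesqIntegral (M : MatrixMeasure r) (F G : ℝ → Matrix (Fin r) (Fin r) ℂ) :
    Matrix (Fin r) (Fin r) ℂ :=
  Matrix.of fun i j => ∑ k, ∑ l,
    (M.entry k l).integral (fun t => F t i k * star (G t j l)) (ContinuousLinearMap.mul ℝ ℂ)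

/-- `M` is the spectral measure of the matrix polynomials with recurrence coefficients `a`, `b`:
all moments of `M` are finite and the polynomials are orthonormal, `∫ P_n dM P_mᴴ = δ_{nm} I`.
The case `n = m = 0` is the normalization `∫ dM = I`. -/
structure IsSpectralMeasure (M : MatrixMeasure r) (a b : ℕ → Matrix (Fin r) (Fin r) ℂ) :
    Prop where
  integrable_pow : ∀ (n : ℕ) (i j : Fin r),
    (M.entry i j).Integrable (fun t : ℝ => (t : ℂ) ^ n)
  orthonormal : ∀ n m : ℕ,
    M.sesqIntegral (fun t => orthPoly a b n (t : ℂ)) (fun t => orthPoly a b m (t : ℂ))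
      = if n = m then 1 else 0

/-- The integral defining the Stieltjes transform at `x` converges, entrywise. -/
def StieltjesConverges (M : MatrixMeasure r) (x : ℂ) : Prop :=
  ∀ i j, (∀ᵐ t : ℝ ∂(M.entry i j).variation, x ≠ (t : ℂ)) ∧
    (M.entry i j).Integrable (fun t : ℝ => (x - (t : ℂ))⁻¹)

/-- The Stieltjes transform `∫ dM(t) / (x - t)`, taken entrywise. -/
def stieltjes (M : MatrixMeasure r) (x : ℂ) : Matrix (Fin r) (Fin r) ℂ :=
  Matrix.of fun i j =>
    (M.entry i j).integral (fun t : ℝ => (x - (t : ℂ))⁻¹) (ContinuousLinearMap.mul ℝ ℂ)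

/-- `M` is supported on `Γ` (more precisely on its real points) together with a finite, possibly
empty, set of mass points on the real line. -/
def SupportedOnWithMassPoints (M : MatrixMeasure r) (Γ : Set ℂ) : Prop :=
  ∃ E : Set ℝ, E.Finite ∧ (∀ t ∈ E, ∃ i j, M.entry i j {t} ≠ 0) ∧
    ∀ s : Set ℝ, MeasurableSet s → (∀ t ∈ s, (t : ℂ) ∉ Γ ∧ t ∉ E) →
      ∀ i j, M.entry i j s = 0

end MatrixMeasure

/-- The matrix `z Aᴴ + B + z⁻¹ A - x I`. -/
def pencil {r : ℕ} (A B : Matrix (Fin r) (Fin r) ℂ) (z x : ℂ) : Matrix (Fin r) (Fin r) ℂ :=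
  z • Aᴴ + B + z⁻¹ • A - x • (1 : Matrix (Fin r) (Fin r) ℂ)

/-- The algebraic function `f(z, x) = det (z Aᴴ + B + z⁻¹ A - x I)`. -/
def algFun {r : ℕ} (A B : Matrix (Fin r) (Fin r) ℂ) (z x : ℂ) : ℂ := (pencil A B z x).det

/-- The polynomial `Z ^ r * f(Z, x)` in the variable `Z`, for fixed `x`. -/
def algPoly {r : ℕ} (A B : Matrix (Fin r) (Fin r) ℂ) (x : ℂ) : Polynomial ℂ :=
  ((Polynomial.X : Polynomial ℂ) ^ 2 • Aᴴ.map Polynomial.C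
    + (Polynomial.X : Polynomial ℂ) •
        (B - x • (1 : Matrix (Fin r) (Fin r) ℂ)).map Polynomial.C
    + A.map Polynomial.C).det

theorem eval_algPoly {r : ℕ} (A B : Matrix (Fin r) (Fin r) ℂ) {z : ℂ} (hz : z ≠ 0) (x : ℂ) :
    (algPoly A B x).eval z = z ^ r * algFun A B z x := by
  have h : z ^ r * algFun A B z x = (z • pencil A B z x).det := by
    simp [algFun]
  rw [h, algPoly, ← Polynomial.coe_evalRingHom, RingHom.map_det]
  congr 1
  ext i j
  simp [pencil]
  field_simp
  ring

/-- `z 0, …, z (2 r - 1)` are the `2 r` roots `z` of `f(z, x) = 0`, counted with multiplicity and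
ordered by increasing modulus. -/
def IsRootOrdering {r : ℕ} (A B : Matrix (Fin r) (Fin r) ℂ) (x : ℂ) (z : Fin (2 * r) → ℂ) :
    Prop :=
  Multiset.map z Finset.univ.val = (algPoly A B x).roots ∧ Monotone fun k => ‖z k‖

/-- The set `Γ₀` of all `x` for which the `r`-th and the `(r + 1)`-th root (counted from `1`)
have the same modulus. This does not depend on the ordering chosen. -/
def gammaZero {r : ℕ} (A B : Matrix (Fin r) (Fin r) ℂ) : Set ℂ :=
  {x | ∃ z : Fin (2 * r) → ℂ, IsRootOrdering A B x z ∧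
    ∃ k l : Fin (2 * r), (k : ℕ) + 1 = r ∧ (l : ℕ) = r ∧ ‖z k‖ = ‖z l‖}

/-- The geometric multiplicity `d(z, x)`. -/
def geomMult {r : ℕ} (A B : Matrix (Fin r) (Fin r) ℂ) (z x : ℂ) : ℕ :=
  Module.finrank ℂ (LinearMap.ker (Matrix.toEuclideanLin (pencil A B z x)))

/-- `z` lists the roots in increasing modulus, and `v` are corresponding unit null vectors that
span, for each root, a space whose dimension is both the geometric multiplicity of the root and
its algebraic multiplicity. -/
structure IsRootVectorChoice {r : ℕ} (A B : Matrix (Fin r) (Fin r) ℂ) (x : ℂ)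
    (z : Fin (2 * r) → ℂ) (v : Fin (2 * r) → EuclideanSpace ℂ (Fin r)) : Prop where
  ordering : IsRootOrdering A B x z
  norm_eq_one : ∀ k, ‖v k‖ = 1
  null : ∀ k, Matrix.toEuclideanLin (pencil A B (z k) x) (v k) = 0
  span_eq_geom : ∀ k,
    Module.finrank ℂ (Submodule.span ℂ {w | ∃ l, z l = z k ∧ w = v l}) = geomMult A B (z k) x
  geom_eq_alg : ∀ k, geomMult A B (z k) x = (algPoly A B x).rootMultiplicity (z k)

/-- The diagonal matrix `D` of the `r` roots of smallest modulus. -/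
def smallRoots {r : ℕ} (z : Fin (2 * r) → ℂ) : Matrix (Fin r) (Fin r) ℂ :=
  Matrix.diagonal fun k => z (Fin.castLE (by omega) k)

/-- The matrix `V` with columns the first `r` of the given vectors. -/
def smallVectors {r : ℕ} (v : Fin (2 * r) → EuclideanSpace ℂ (Fin r)) :
    Matrix (Fin r) (Fin r) ℂ :=
  Matrix.of fun i k => v (Fin.castLE (by omega) k) i

end MatrixChebyshev

end

/-! Let `J_c` be the bounded self-adjoint block Jacobi operator on square summable sequences in
`ℂ^r` with diagonal blocks `B` and upper blocks `c Aᴴ, Aᴴ, Aᴴ, …`. The value `c = 1` belongs to `W`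
and `c = √2` to `X`. Multiplication by `t` acts on expansions in the `P_n` as `J_c`, so
orthonormality forces `∫ t^m dM = (⟨e_i, J_c^m e_j⟩)` (`IsSpectralMeasure.hasMoments`). Hence the
measure lives on the spectrum of `J_c`, and its Stieltjes transform is the upper left block of the
resolvent (`HasMoments.exists_resolvent`).

Deleting the first block row and column of `J_c` leaves `J_1`, so with `F = F_W` and `K = x - B - Aᴴ
F A` one gets `K F = 1` and `(x - B - 2 Aᴴ F A) F_X = 1` (`cornerBlock_resolvent`). The first
identity factors the quadratic pencil: `z² Aᴴ + z (B - x) + A = (z Aᴴ - K)(z - F A)`. The resolvent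
column has blocks `F (A F)^n v`, which tend to zero, so the eigenvalues of `F A` lie in the open
unit disc; the same argument for the adjoint resolvent makes `z Aᴴ - K` nonsingular on the closed
disc. The `r` smallest roots are therefore the eigenvalues of `F A`, their null vectors are
eigenvectors, and `F A V = V D` yields both formulas.

For the support, `bandSet` is the set of real eigenvalues of the symbol `z Aᴴ + B + z⁻¹ A` over `|z|
= 1`. For real `x` the roots are symmetric under `z ↦ 1 / conj z`, so a root on the circle forces
`|z_r| = |z_{r+1}| = 1`: bands lie in `Γ₀`. Off the bands, a Fourier estimate bounds `J_c - t` from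
below on sequences with two vanishing initial blocks. This allows at most `2r` spectral points per
gap, and an eigenvalue count allows at most `r + 1` gaps (`finite_spectrum_diff_bandSet`).

Admissible vectors exist generically because the symbol is Hermitian, hence diagonalizable, on the
circle. The radical of the bivariate polynomial annihilates it there and, by the identity theorem,
for every `z ≠ 0`; at generic `x` this radical has simple zeros, so geometric and algebraic
multiplicities coincide. -/

namespace MatrixChebyshev
-- Matrix measures are dominated by their diagonal entries
namespace MatrixMeasure

variable {r : ℕ} (M : MatrixMeasure r)

/-- The real part of a diagonal entry, a nonnegative signed measure. -/
theorem zero_le_re_entry (i : Fin r) :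
    0 ≤[Set.univ] ComplexMeasure.re (M.entry i i) := by
  refine (VectorMeasure.le_restrict_univ_iff_le _ _).2 ?_
  intro s hs
  have h := (M.posSemidef s hs).diag_nonneg (i := i)
  exact (Complex.nonneg_iff.1 h).1

/-- The positive measure given by a diagonal entry of a matrix measure. -/
noncomputable def diagMeasure (i : Fin r) : Measure ℝ :=
  SignedMeasure.toMeasureOfZeroLE (ComplexMeasure.re (M.entry i i)) Set.univ MeasurableSet.univ
    (M.zero_le_re_entry i)

instance (i : Fin r) : IsFiniteMeasure (M.diagMeasure i) := by
  unfold diagMeasure; infer_instance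

theorem entry_self_apply (i : Fin r) {s : Set ℝ} (hs : MeasurableSet s) :
    M.entry i i s = ((M.diagMeasure i).real s : ℂ) := by
  have h := (M.posSemidef s hs).diag_nonneg (i := i)
  have h1 : (M.diagMeasure i).real s = (M.entry i i s).re := by
    rw [diagMeasure, SignedMeasure.toMeasureOfZeroLE_real_apply _ _ _ hs]
    simp only [Set.univ_inter]
    rfl
  rw [h1]
  apply Complex.ext
  · simp
  · simpa using ((Complex.nonneg_iff.1 h).2).symm

/-- Evaluate the positive semidefinite form at `e_i + c e_j`, where the unimodular `c` rotates the
off-diagonal entry `a` to `-‖a‖`. Thus questions of null sets and integrability for every entry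
reduce to the positive diagonal measures. -/
theorem norm_entry_le (i j : Fin r) {s : Set ℝ} (hs : MeasurableSet s) :
    ‖M.entry i j s‖ ≤ (M.diagMeasure i).real s + (M.diagMeasure j).real s := by
  have h := M.posSemidef s hs
  set N := Matrix.of fun i j => M.entry i j s with hN
  rcases eq_or_ne i j with rfl | hij
  · rw [M.entry_self_apply i hs]
    have := measureReal_nonneg (μ := M.diagMeasure i) (s := s)
    simp only [Complex.norm_real, Real.norm_eq_abs, abs_of_nonneg this]
    linarith
  set a := M.entry i j s with ha
  have hji : M.entry j i s = star a := by
    have := h.1.apply i j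
    simpa [N] using (congrArg star this)
  obtain ⟨c, hc, hca⟩ : ∃ c : ℂ, ‖c‖ = 1 ∧ c * a = -(‖a‖ : ℂ) := by
    by_cases h0 : a = 0
    · exact ⟨1, by simp, by simp [h0]⟩
    · refine ⟨-(star a / ‖a‖), by simp [h0], ?_⟩
      have h2 : (‖a‖ : ℂ) ≠ 0 := by simpa using h0
      field_simp
      have := Complex.conj_mul' a
      simp only [Complex.star_def]
      linear_combination -this
  have hq := h.dotProduct_mulVec_nonneg (Pi.single i 1 + Pi.single j c)
  simp only [star_add, Pi.star_single, add_dotProduct, mulVec_add, dotProduct_add,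
    single_dotProduct, mulVec_single, Pi.smul_apply, MulOpposite.smul_eq_mul_unop] at hq
  simp [N, hji, ← ha, M.entry_self_apply _ hs] at hq
  have hcc : (starRingEnd ℂ) c * c = 1 := by rw [Complex.conj_mul', hc]; simp
  have hca' : (starRingEnd ℂ) c * (starRingEnd ℂ) a = -(‖a‖ : ℂ) := by
    rw [← map_mul, hca]; simp
  have hq2 := (Complex.nonneg_iff.1 hq).1
  have : ((M.diagMeasure i).real s + (starRingEnd ℂ) c * (starRingEnd ℂ) a + (a * c
     + (starRingEnd ℂ) c * ((M.diagMeasure j).real s * c)) : ℂ) =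
      (((M.diagMeasure i).real s + (M.diagMeasure j).real s - 2 * ‖a‖ : ℝ) : ℂ) := by
    push_cast
    linear_combination hca' + hca + ((M.diagMeasure j).real s : ℂ) * hcc
  rw [this] at hq
  have := Complex.zero_le_real.1 hq
  linarith [norm_nonneg a]

theorem variation_entry_le (i j : Fin r) :
    (M.entry i j).variation ≤ M.diagMeasure i + M.diagMeasure j := by
  refine VectorMeasure.variation_le_of_forall_enorm_le fun s hs => ?_
  rw [← ofReal_norm]
  refine (ENNReal.ofReal_le_ofReal (M.norm_entry_le i j hs)).trans ?_
  rw [ENNReal.ofReal_add measureReal_nonneg measureReal_nonneg]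
  simp

instance (i j : Fin r) : IsFiniteMeasure (M.entry i j).variation :=
  isFiniteMeasure_of_le _ (M.variation_entry_le i j)

theorem variation_entry_self (i : Fin r) : (M.entry i i).variation = M.diagMeasure i := by
  refine le_antisymm ?_ ?_
  · refine VectorMeasure.variation_le_of_forall_enorm_le fun s hs => ?_
    rw [M.entry_self_apply i hs, ← ofReal_norm, Complex.norm_real, Real.norm_eq_abs,
      abs_of_nonneg measureReal_nonneg]
    simp
  · refine Measure.le_iff.2 fun s hs => ?_
    refine le_trans ?_ (VectorMeasure.enorm_measure_le_variation _ _)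
    rw [M.entry_self_apply i hs, ← ofReal_norm, Complex.norm_real, Real.norm_eq_abs,
      abs_of_nonneg measureReal_nonneg]
    simp

theorem integral_entry_self (i : Fin r) (f : ℝ → ℂ) :
    (M.entry i i).integral f (ContinuousLinearMap.mul ℝ ℂ) = ∫ t, f t ∂(M.diagMeasure i) := by
  rw [VectorMeasure.integral_eq_setToFun, MeasureTheory.integral_eq_setToFun]
  simp only [M.variation_entry_self i]
  apply setToFun_congr_left' _ _ (fun s hs h's ↦ ?_)
  ext x
  · simp [VectorMeasure.transpose, weightedSMul, M.entry_self_apply i hs]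

theorem integral_entry_smul (i j : Fin r) (c : ℂ) (f : ℝ → ℂ) :
    (M.entry i j).integral (fun t => c * f t) (ContinuousLinearMap.mul ℝ ℂ) =
      c * (M.entry i j).integral f (ContinuousLinearMap.mul ℝ ℂ) := by
  rw [VectorMeasure.integral_eq_setToFun, VectorMeasure.integral_eq_setToFun]
  refine setToFun_smul (𝕜 := ℂ) _ (fun c s x => ?_) c f
  simp [VectorMeasure.transpose, mul_left_comm]

/-- A set that is null for all diagonal entries is null for the variation of every entry. -/
theorem variation_entry_eq_zero {s : Set ℝ} (h : ∀ i, M.diagMeasure i s = 0) (i j : Fin r) :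
    (M.entry i j).variation s = 0 := by
  have := M.variation_entry_le i j s
  simpa [h] using this

theorem entry_eq_zero {s : Set ℝ} (h : ∀ i, M.diagMeasure i s = 0) (i j : Fin r) :
    M.entry i j s = 0 := by
  have := VectorMeasure.enorm_measure_le_variation (M.entry i j) s
  rw [M.variation_entry_eq_zero h] at this
  simpa using this

end MatrixMeasure
end MatrixChebyshev

/-! ### The block Jacobi operator on square summable sequences -/

namespace MatrixChebyshev

/-- The Hilbert space of square summable sequences of vectors. -/
abbrev SeqSpace (r : ℕ) : Type := lp (fun _ : ℕ => EuclideanSpace ℂ (Fin r)) 2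

/-- The sequence with `v` at place `n` and zeros elsewhere. -/
noncomputable abbrev seqSingle {r : ℕ} (n : ℕ) (v : EuclideanSpace ℂ (Fin r)) : SeqSpace r :=
  lp.single 2 n v

theorem norm_sq_eq_tsum {E : Type*} [NormedAddCommGroup E] (u : lp (fun _ : ℕ => E) 2) :
    ‖u‖ ^ 2 = ∑' n, ‖u n‖ ^ 2 := by
  have := lp.norm_rpow_eq_tsum (p := 2) (by norm_num) u
  simpa using this

theorem summable_norm_sq {E : Type*} [NormedAddCommGroup E] (u : lp (fun _ : ℕ => E) 2) :
    Summable fun n => ‖u n‖ ^ 2 := by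
  have := (lp.memℓp u).summable (by norm_num)
  simpa using this

section WeightedComp

variable {E : Type*} [NormedAddCommGroup E] [InnerProductSpace ℂ E]

theorem memℓp_weightedComp {φ : ℕ → E →L[ℂ] E} {σ : ℕ → ℕ} {C : ℝ} (hφ : ∀ n, ‖φ n‖ ≤ C)
    (hσ : Function.Injective σ) (u : lp (fun _ : ℕ => E) 2) :
    Memℓp (fun n => φ n (u (σ n))) 2 := by
  have hC : 0 ≤ C := (norm_nonneg _).trans (hφ 0)
  have hu : Summable fun n => ‖u n‖ ^ (2 : ℝ) := by
    simpa using (lp.memℓp u).summable (by norm_num)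
  refine memℓp_gen ?_
  have h2 := (hu.comp_injective hσ).mul_left (C ^ (2 : ℝ))
  refine Summable.of_nonneg_of_le (fun n => by positivity) (fun n => ?_) h2
  simp only [ENNReal.toReal_ofNat, Function.comp]
  rw [← Real.mul_rpow hC (norm_nonneg _)]
  refine Real.rpow_le_rpow (norm_nonneg _) ?_ (by norm_num)
  exact ((φ n).le_opNorm _).trans (mul_le_mul_of_nonneg_right (hφ n) (norm_nonneg _))

/-- The operator `(K u) n = φ n (u (σ n))` on square summable sequences. -/
noncomputable def weightedComp (φ : ℕ → E →L[ℂ] E) (σ : ℕ → ℕ) (C : ℝ) (hφ : ∀ n, ‖φ n‖ ≤ C)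
    (hσ : Function.Injective σ) : lp (fun _ : ℕ => E) 2 →L[ℂ] lp (fun _ : ℕ => E) 2 :=
  LinearMap.mkContinuous
    { toFun := fun u => ⟨fun n => φ n (u (σ n)), memℓp_weightedComp hφ hσ u⟩
      map_add' := fun u v => by ext n; simp; rfl
      map_smul' := fun c u => by ext n; simp } C (fun u => by
    have hC : 0 ≤ C := (norm_nonneg _).trans (hφ 0)
    refine (sq_le_sq₀ (norm_nonneg _) (mul_nonneg hC (norm_nonneg _))).1 ?_
    rw [mul_pow, norm_sq_eq_tsum, norm_sq_eq_tsum, ← tsum_mul_left]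
    have hs := (summable_norm_sq u).mul_left (C ^ 2)
    have hs' := hs.comp_injective hσ
    refine (Summable.tsum_le_tsum (fun n => ?_) (summable_norm_sq _) hs').trans
      (tsum_comp_le_tsum_of_inj hs (fun _ => by positivity) hσ)
    simp only [Function.comp, ← mul_pow]
    refine pow_le_pow_left₀ (norm_nonneg _) ?_ 2
    exact ((φ n).le_opNorm _).trans (mul_le_mul_of_nonneg_right (hφ n) (norm_nonneg _)))

theorem weightedComp_apply (φ : ℕ → E →L[ℂ] E) (σ : ℕ → ℕ) (C : ℝ) (hφ : ∀ n, ‖φ n‖ ≤ C)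
    (hσ : Function.Injective σ) (u : lp (fun _ : ℕ => E) 2) (n : ℕ) :
    weightedComp φ σ C hφ hσ u n = φ n (u (σ n)) := rfl

end WeightedComp

variable {r : ℕ}

/-- The operator on `ℂ ^ r` given by a matrix. -/
noncomputable abbrev euclOp (A : Matrix (Fin r) (Fin r) ℂ) :
    EuclideanSpace ℂ (Fin r) →L[ℂ] EuclideanSpace ℂ (Fin r) :=
  Matrix.toEuclideanCLM (𝕜 := ℂ) A

/-- The sequences of recurrence coefficients considered: after the first they are constant. -/
noncomputable def scaledCoeff (c : ℂ) (A : Matrix (Fin r) (Fin r) ℂ) (n : ℕ) :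
    Matrix (Fin r) (Fin r) ℂ := if n = 0 then c • Aᴴ else Aᴴ

theorem norm_scaledCoeff_le (c : ℂ) (A : Matrix (Fin r) (Fin r) ℂ) (n : ℕ) :
    ‖euclOp (scaledCoeff c A n)‖ ≤ (‖c‖ + 1) * ‖euclOp Aᴴ‖ := by
  unfold scaledCoeff
  split_ifs
  · rw [euclOp, map_smul, norm_smul]
    nlinarith [norm_nonneg (euclOp Aᴴ)]
  · nlinarith [norm_nonneg (euclOp Aᴴ), mul_nonneg (norm_nonneg c) (norm_nonneg (euclOp Aᴴ))]

/-- The upper diagonal part of the block Jacobi operator. -/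
noncomputable def jacobiUpper (c : ℂ) (A : Matrix (Fin r) (Fin r) ℂ) :
    SeqSpace r →L[ℂ] SeqSpace r :=
  weightedComp (fun n => euclOp (scaledCoeff c A n)) Nat.succ _ (norm_scaledCoeff_le c A)
    Nat.succ_injective

/-- The diagonal part of the block Jacobi operator. -/
noncomputable def jacobiDiag (B : Matrix (Fin r) (Fin r) ℂ) : SeqSpace r →L[ℂ] SeqSpace r :=
  weightedComp (fun _ => euclOp B) id _ (fun _ => le_refl ‖euclOp B‖) Function.injective_id

/-- The block Jacobi operator with diagonal blocks `B`, first off-diagonal block `c • Aᴴ` and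
further off-diagonal blocks `Aᴴ`. -/
noncomputable def jacobiOp (c : ℂ) (A B : Matrix (Fin r) (Fin r) ℂ) :
    SeqSpace r →L[ℂ] SeqSpace r :=
  jacobiDiag B + jacobiUpper c A + star (jacobiUpper c A)

theorem inner_seqSingle (n : ℕ) (v : EuclideanSpace ℂ (Fin r)) (u : SeqSpace r) :
    inner ℂ (seqSingle n v) u = inner ℂ v (u n) :=
  lp.inner_single_left n v u

theorem euclOp_conjTranspose (A : Matrix (Fin r) (Fin r) ℂ) :
    euclOp Aᴴ = star (euclOp A) := by
  rw [← star_eq_conjTranspose, euclOp, map_star]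

theorem inner_euclOp_left (A : Matrix (Fin r) (Fin r) ℂ) (v w : EuclideanSpace ℂ (Fin r)) :
    inner ℂ (euclOp A v) w = inner ℂ v (euclOp Aᴴ w) := by
  rw [euclOp_conjTranspose, ContinuousLinearMap.star_eq_adjoint,
    ContinuousLinearMap.adjoint_inner_right]

theorem jacobiUpper_single_succ (c : ℂ) (A : Matrix (Fin r) (Fin r) ℂ) (n : ℕ)
    (v : EuclideanSpace ℂ (Fin r)) :
    jacobiUpper c A (seqSingle (n + 1) v) = seqSingle n (euclOp (scaledCoeff c A n) v) := by
  ext m : 2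
  rw [jacobiUpper, weightedComp_apply]
  rcases eq_or_ne m n with rfl | h
  · simp [seqSingle, lp.single_apply]
  · simp [seqSingle, lp.single_apply, h]

theorem jacobiUpper_single_zero (c : ℂ) (A : Matrix (Fin r) (Fin r) ℂ)
    (v : EuclideanSpace ℂ (Fin r)) : jacobiUpper c A (seqSingle 0 v) = 0 := by
  ext m : 2
  rw [jacobiUpper, weightedComp_apply]
  simp [seqSingle, lp.single_apply]

/-- The adjoint is known only through inner products; pairing with `seqSingle` recovers its
coordinates. -/
theorem star_jacobiUpper_zero (c : ℂ) (A : Matrix (Fin r) (Fin r) ℂ) (u : SeqSpace r) :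
    star (jacobiUpper c A) u 0 = 0 := by
  refine ext_inner_left ℂ fun v => ?_
  rw [← inner_seqSingle, ContinuousLinearMap.star_eq_adjoint,
    ContinuousLinearMap.adjoint_inner_right, jacobiUpper_single_zero]
  simp

theorem star_jacobiUpper_succ (c : ℂ) (A : Matrix (Fin r) (Fin r) ℂ) (u : SeqSpace r) (n : ℕ) :
    star (jacobiUpper c A) u (n + 1) = euclOp (scaledCoeff c A n)ᴴ (u n) := by
  refine ext_inner_left ℂ fun v => ?_
  rw [← inner_seqSingle, ContinuousLinearMap.star_eq_adjoint,
    ContinuousLinearMap.adjoint_inner_right, jacobiUpper_single_succ, inner_seqSingle,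
    inner_euclOp_left]

theorem jacobiOp_zero (c : ℂ) (A B : Matrix (Fin r) (Fin r) ℂ) (u : SeqSpace r) :
    jacobiOp c A B u 0 = euclOp B (u 0) + euclOp (scaledCoeff c A 0) (u 1) := by
  have : jacobiOp c A B u 0 =
    jacobiDiag B u 0 + jacobiUpper c A u 0 + star (jacobiUpper c A) u 0 := rfl
  rw [this, star_jacobiUpper_zero, add_zero]
  rfl

theorem jacobiOp_succ (c : ℂ) (A B : Matrix (Fin r) (Fin r) ℂ) (u : SeqSpace r) (n : ℕ) :
    jacobiOp c A B u (n + 1) = euclOp B (u (n + 1)) + euclOp (scaledCoeff c A (n + 1)) (u (n + 2))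
      + euclOp (scaledCoeff c A n)ᴴ (u n) := by
  have : jacobiOp c A B u (n + 1) = jacobiDiag B u (n + 1) + jacobiUpper c A u (n + 1)
    + star (jacobiUpper c A) u (n + 1) := rfl
  rw [this, star_jacobiUpper_succ]
  rfl

theorem isSelfAdjoint_jacobiOp (c : ℂ) (A : Matrix (Fin r) (Fin r) ℂ)
    {B : Matrix (Fin r) (Fin r) ℂ} (hB : B.IsHermitian) : IsSelfAdjoint (jacobiOp c A B) := by
  have hD : IsSelfAdjoint (jacobiDiag B) := by
    rw [ContinuousLinearMap.isSelfAdjoint_iff_isSymmetric]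
    intro u v
    simp only [ContinuousLinearMap.coe_coe, lp.inner_eq_tsum]
    refine tsum_congr fun n => ?_
    simp only [jacobiDiag, weightedComp_apply, id]
    rw [inner_euclOp_left, hB.eq]
  rw [jacobiOp, add_assoc]
  exact hD.add (IsSelfAdjoint.add_star_self _)

end MatrixChebyshev

/-! ### Measures with operator moments: support and Stieltjes transform -/

namespace MatrixChebyshev
namespace MatrixMeasure

section Moments

variable {r : ℕ} (M : MatrixMeasure r) {H : Type*} [NormedAddCommGroup H] [InnerProductSpace ℂ H]
  (J : H →L[ℂ] H) (e : Fin r → H)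

/-- The moments of `M` are those of the operator `J` with respect to the vectors `e`. -/
structure HasMoments : Prop where
  integrable_pow : ∀ (n : ℕ) (i j : Fin r), (M.entry i j).Integrable (fun t : ℝ => (t : ℂ) ^ n)
  integral_pow : ∀ (n : ℕ) (i j : Fin r),
    (M.entry i j).integral (fun t : ℝ => (t : ℂ) ^ n) (ContinuousLinearMap.mul ℝ ℂ) =
      inner ℂ (e i) ((J ^ n) (e j))

variable {M J e}

/-- Markov's inequality for `t ^ (2 * n)`, whose integral is at most `‖e i‖² ‖J‖^(2n)`. As `n → ∞`
the mass beyond any `R > ‖J‖` vanishes, so finite moments already give compact support. -/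
theorem HasMoments.diagMeasure_real_le (h : M.HasMoments J e) (i : Fin r) {R : ℝ} (hR : 0 < R)
    (n : ℕ) :
    (M.diagMeasure i).real {t : ℝ | R ≤ |t|} ≤ ‖e i‖ ^ 2 * ((‖J‖ / R) ^ 2) ^ n := by
  have hi : Integrable (fun t : ℝ => (t : ℂ) ^ (2 * n)) (M.diagMeasure i) := by
    have := h.integrable_pow (2 * n) i i
    rwa [VectorMeasure.Integrable, M.variation_entry_self] at this
  have hre : Integrable (fun t : ℝ => t ^ (2 * n)) (M.diagMeasure i) := by
    have := hi.re
    simpa [← Complex.ofReal_pow] using this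
  have h1 : ∫ t, t ^ (2 * n) ∂(M.diagMeasure i) ≤ ‖e i‖ ^ 2 * (‖J‖ ^ 2) ^ n := by
    have h2 : ((∫ t, t ^ (2 * n) ∂(M.diagMeasure i) : ℝ) : ℂ) =
        inner ℂ (e i) ((J ^ (2 * n)) (e i)) := by
      rw [← h.integral_pow, M.integral_entry_self, ← integral_complex_ofReal]
      simp
    have h3 : ‖((∫ t, t ^ (2 * n) ∂(M.diagMeasure i) : ℝ) : ℂ)‖ ≤ ‖e i‖ ^ 2 * (‖J‖ ^ 2) ^ n := by
      rw [h2]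
      refine (norm_inner_le_norm _ _).trans ?_
      have h4 : ‖J ^ (2 * n)‖ ≤ ‖J‖ ^ (2 * n) := by
        -- Exponent zero is separate: `H` may be trivial, in which case `‖1‖ = 0`, so only `‖1‖ ≤ 1`
        -- is available.
        rcases Nat.eq_zero_or_pos n with rfl | hn
        · simpa [ContinuousLinearMap.one_def] using ContinuousLinearMap.norm_id_le (𝕜 := ℂ) (E := H)
        · exact norm_pow_le' _ (by omega)
      have h5 := ((J ^ (2 * n)).le_opNorm (e i)).trans
        (mul_le_mul_of_nonneg_right h4 (norm_nonneg _))
      rw [← pow_mul, pow_two, mul_assoc, mul_comm ‖e i‖ (‖J‖ ^ (2 * n))]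
      exact mul_le_mul_of_nonneg_left h5 (norm_nonneg _)
    rw [Complex.norm_real] at h3
    exact (le_abs_self _).trans h3
  have h6 := mul_meas_ge_le_integral_of_nonneg (μ := M.diagMeasure i) (f := fun t : ℝ => t ^ (2 * n))
    (Filter.Eventually.of_forall fun t => (even_two_mul n).pow_nonneg t) hre (R ^ (2 * n))
  have h7 : (M.diagMeasure i).real {t : ℝ | R ≤ |t|} ≤
      (M.diagMeasure i).real {t : ℝ | R ^ (2 * n) ≤ t ^ (2 * n)} := by
    refine measureReal_mono fun t ht => ?_
    simp only [Set.mem_ofPred_eq] at ht ⊢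
    rw [← (even_two_mul n).pow_abs t]
    exact pow_le_pow_left₀ hR.le ht _
  have hRn : 0 < R ^ (2 * n) := by positivity
  rw [div_pow, div_pow, ← mul_div_assoc, le_div_iff₀ (by positivity), ← pow_mul R, mul_comm]
  calc _ ≤ R ^ (2 * n) * (M.diagMeasure i).real {t : ℝ | R ^ (2 * n) ≤ t ^ (2 * n)} :=
        mul_le_mul_of_nonneg_left h7 hRn.le
    _ ≤ _ := h6.trans h1

theorem HasMoments.diagMeasure_norm_lt (h : M.HasMoments J e) (i : Fin r) :
    M.diagMeasure i {t : ℝ | ‖J‖ < |t|} = 0 := by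
  have h1 : ∀ R : ℝ, ‖J‖ < R → M.diagMeasure i {t : ℝ | R ≤ |t|} = 0 := by
    intro R hR
    have hR0 : 0 < R := (norm_nonneg _).trans_lt hR
    have h2 : (M.diagMeasure i).real {t : ℝ | R ≤ |t|} ≤ 0 := by
      have hq : (‖J‖ / R) ^ 2 < 1 := by
        rw [sq_lt_one_iff₀ (by positivity), div_lt_one hR0]; exact hR
      have h3 := (tendsto_pow_atTop_nhds_zero_of_lt_one (by positivity) hq).const_mul (‖e i‖ ^ 2)
      rw [mul_zero] at h3
      exact ge_of_tendsto' h3 fun n => h.diagMeasure_real_le i hR0 n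
    have h4 := le_antisymm h2 measureReal_nonneg
    rwa [measureReal_eq_zero_iff] at h4
  have h5 : {t : ℝ | ‖J‖ < |t|} ⊆ ⋃ n : ℕ, {t : ℝ | ‖J‖ + 1 / ((n : ℝ) + 1) ≤ |t|} := by
    intro t ht
    have ht' : ‖J‖ < |t| := ht
    obtain ⟨n, hn⟩ := exists_nat_one_div_lt (sub_pos.2 ht')
    exact Set.mem_iUnion.2 ⟨n, by simp only [Set.mem_ofPred_eq]; linarith⟩
  refine measure_mono_null h5 (measure_iUnion_null fun n => h1 _ ?_)
  have : (0 : ℝ) < 1 / ((n : ℝ) + 1) := by positivity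
  linarith

theorem HasMoments.ae_abs_le (h : M.HasMoments J e) (i j : Fin r) :
    ∀ᵐ t ∂(M.entry i j).variation, |t| ≤ ‖J‖ := by
  have := M.variation_entry_eq_zero h.diagMeasure_norm_lt i j
  rw [ae_iff]
  simpa using this

theorem HasMoments.integrable (h : M.HasMoments J e) {f : ℝ → ℂ} (hf : Continuous f)
    (i j : Fin r) : (M.entry i j).Integrable f := by
  obtain ⟨C, hC⟩ := (isCompact_Icc (a := -‖J‖) (b := ‖J‖)).exists_bound_of_continuousOn
    hf.continuousOn
  refine Integrable.of_bound hf.aestronglyMeasurable C ?_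
  filter_upwards [h.ae_abs_le i j] with t ht using hC t (abs_le.1 ht)

theorem HasMoments.integral_polynomial (h : M.HasMoments J e) (q : Polynomial ℝ) (i j : Fin r) :
    (M.entry i j).integral (fun t => ((q.eval t : ℝ) : ℂ)) (ContinuousLinearMap.mul ℝ ℂ) =
      inner ℂ (e i) (Polynomial.aeval J q (e j)) := by
  have h1 : (fun t : ℝ => ((q.eval t : ℝ) : ℂ)) =
      fun t : ℝ => ∑ n ∈ Finset.range (q.natDegree + 1), (q.coeff n : ℂ) * (t : ℂ) ^ n := by
    ext t
    rw [Polynomial.eval_eq_sum_range]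
    simp
  rw [h1, VectorMeasure.integral_finsetSum, Polynomial.aeval_eq_sum_range]
  · simp only [_root_.sum_apply, inner_sum]
    refine Finset.sum_congr rfl fun n _ => ?_
    rw [integral_entry_smul, h.integral_pow]
    rw [_root_.smul_apply, ← Complex.coe_smul, inner_smul_right]
  · intro n _
    exact (h.integrable_pow n i j).const_mul _

variable [CompleteSpace H]

/-- The polynomial identity extends by Weierstrass approximation on `[-‖J‖, ‖J‖]`, which contains
the spectrum and carries the measure. -/
theorem HasMoments.integral_cfc (h : M.HasMoments J e) (hJ : IsSelfAdjoint J) {f : ℝ → ℝ}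
    (hf : Continuous f) (i j : Fin r) :
    (M.entry i j).integral (fun t => (f t : ℂ)) (ContinuousLinearMap.mul ℝ ℂ) =
      inner ℂ (e i) (cfc f J (e j)) := by
  set V := (M.entry i j).variation.real Set.univ
  have hV : 0 ≤ V := measureReal_nonneg
  refine eq_of_forall_dist_le fun ε hε => ?_
  -- `C` collects the factors of the two approximation errors, on the measure side and on the
  -- operator side; the summand `1` keeps it positive.
  set C := ‖(ContinuousLinearMap.mul ℝ ℂ)‖ * V + ‖e i‖ * ‖e j‖ + 1
  have hC : 0 < C := by positivity
  obtain ⟨q, hq⟩ := exists_polynomial_near_of_continuousOn (-‖J‖) ‖J‖ f hf.continuousOn (ε / C)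
    (by positivity)
  have hη : 0 < ε / C := by positivity
  have h1 : dist ((M.entry i j).integral (fun t => (f t : ℂ)) (ContinuousLinearMap.mul ℝ ℂ))
      ((M.entry i j).integral (fun t => ((q.eval t : ℝ) : ℂ)) (ContinuousLinearMap.mul ℝ ℂ)) ≤
      ε / C * ‖(ContinuousLinearMap.mul ℝ ℂ)‖ * V := by
    rw [dist_eq_norm, ← VectorMeasure.integral_sub]
    · refine VectorMeasure.norm_integral_le_of_norm_le_const ?_
      filter_upwards [h.ae_abs_le i j] with t ht
      have := (hq t (abs_le.1 ht)).le
      rw [Pi.sub_apply, ← Complex.ofReal_sub, Complex.norm_real, Real.norm_eq_abs, abs_sub_comm]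
      exact this
    · exact h.integrable (Complex.continuous_ofReal.comp hf) i j
    · exact h.integrable (Complex.continuous_ofReal.comp q.continuous) i j
  have h2 : dist (inner ℂ (e i) (Polynomial.aeval J q (e j)) : ℂ) (inner ℂ (e i) (cfc f J (e j)))
      ≤ ε / C * (‖e i‖ * ‖e j‖) := by
    have h3 : ‖cfc (fun x => q.eval x - f x) J‖ ≤ ε / C := by
      refine norm_cfc_le hη.le fun x hx => ?_
      have hx' : |x| ≤ ‖J‖ := IsometricContinuousFunctionalCalculus.norm_spectrum_le J hx
      exact (hq x (abs_le.1 hx')).le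
    rw [cfc_sub (fun x => q.eval x) f J q.continuous.continuousOn hf.continuousOn,
      cfc_polynomial q J] at h3
    rw [dist_eq_norm, ← inner_sub_right, ← _root_.sub_apply]
    refine (norm_inner_le_norm _ _).trans ?_
    have h4 := ((Polynomial.aeval J q - cfc f J).le_opNorm (e j)).trans
      (mul_le_mul_of_nonneg_right h3 (norm_nonneg _))
    calc _ ≤ ‖e i‖ * (ε / C * ‖e j‖) := mul_le_mul_of_nonneg_left h4 (norm_nonneg _)
      _ = _ := by ring
  rw [h.integral_polynomial] at h1
  refine (dist_triangle _ _ _).trans ((add_le_add h1 h2).trans ?_)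
  have : ε = ε / C * C := by field_simp
  nth_rewrite 3 [this]
  simp only [C]
  nlinarith

theorem exists_continuous_eq_zero_iff {S : Set ℝ} (hS : IsClosed S) :
    ∃ f : ℝ → ℝ, Continuous f ∧ (∀ t, 0 ≤ f t) ∧ ∀ t, f t = 0 ↔ t ∈ S := by
  rcases S.eq_empty_or_nonempty with rfl | hne
  -- The distance to the empty set is zero by convention, so this case needs its own function.
  · exact ⟨fun _ => 1, continuous_const, by simp, by simp⟩
  · refine ⟨fun t => Metric.infDist t S, Metric.continuous_infDist_pt S,
      fun t => Metric.infDist_nonneg, fun t => ?_⟩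
    exact (hS.mem_iff_infDist_zero hne).symm

/-- A nonnegative continuous `f` vanishing exactly on the spectrum has `f(J) = 0`, hence zero
integral, hence vanishes almost everywhere. -/
theorem HasMoments.diagMeasure_compl_spectrum (h : M.HasMoments J e) (hJ : IsSelfAdjoint J)
    (i : Fin r) : M.diagMeasure i (spectrum ℝ J)ᶜ = 0 := by
  obtain ⟨f, hfc, hf0, hf⟩ := exists_continuous_eq_zero_iff (spectrum.isClosed (𝕜 := ℝ) J)
  have h1 := h.integral_cfc hJ hfc i i
  have h2 : cfc f J = 0 := by
    rw [cfc_congr (g := fun _ => (0 : ℝ)) (fun t ht => (hf t).2 ht), cfc_const_zero]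
  have h3 : ∫ t, f t ∂(M.diagMeasure i) = 0 := by
    rw [M.integral_entry_self, h2, integral_complex_ofReal] at h1
    simpa using h1
  have h4 : Integrable f (M.diagMeasure i) := by
    have := h.integrable (Complex.continuous_ofReal.comp hfc) i i
    rw [VectorMeasure.Integrable, M.variation_entry_self] at this
    simpa using this.re
  rw [integral_eq_zero_iff_of_nonneg hf0 h4] at h3
  have h5 := ae_iff.1 h3
  convert h5 using 2
  ext t
  simp [hf]

/-- The functional calculus in use is real, so the kernel is split as `1 / (x - t) = (conj x - t) /
|x - t|²`, with the real functions `1 / |x - t|²` and `t / |x - t|²`. Real `x` off the spectrum is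
allowed. -/
theorem HasMoments.exists_resolvent (h : M.HasMoments J e) (hJ : IsSelfAdjoint J) {x : ℂ}
    (hx : ∀ t ∈ spectrum ℝ J, x ≠ (t : ℂ)) :
    ∃ G : H →L[ℂ] H, (x • 1 - J) * G = 1 ∧ G * (x • 1 - J) = 1 ∧ M.StieltjesConverges x ∧
      ∀ i j, M.stieltjes x i j = inner ℂ (e i) (G (e j)) := by
  obtain ⟨δ, hδ, hδx⟩ : ∃ δ > 0, ∀ t ∈ spectrum ℝ J, δ ≤ ‖x - (t : ℂ)‖ := by
    have hc : IsClosed ((fun t : ℝ => (t : ℂ)) '' spectrum ℝ J) :=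
      (Complex.isometry_ofReal.isClosedEmbedding.isClosedMap) _ (spectrum.isClosed J)
    have hx' : x ∈ ((fun t : ℝ => (t : ℂ)) '' spectrum ℝ J)ᶜ := by
      rintro ⟨t, ht, rfl⟩
      exact hx t ht rfl
    obtain ⟨δ, hδ, hb⟩ := Metric.isOpen_iff.1 hc.isOpen_compl x hx'
    refine ⟨δ, hδ, fun t ht => ?_⟩
    by_contra hlt
    refine hb (Metric.mem_ball.2 ?_) ⟨t, ht, rfl⟩
    rw [dist_comm, dist_eq_norm]
    exact not_le.1 hlt
  -- Truncating at `δ²`, with `δ` a lower bound for `|x - t|` on the spectrum, makes `ρ` continuous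
  -- on all of `ℝ` without changing it on the spectrum.
  set ρ : ℝ → ℝ := fun t => (max (‖x - (t : ℂ)‖ ^ 2) (δ ^ 2))⁻¹ with hρ
  have hmax : ∀ t : ℝ, 0 < max (‖x - (t : ℂ)‖ ^ 2) (δ ^ 2) := fun t =>
    lt_max_of_lt_right (by positivity)
  have hρc : Continuous ρ := by
    refine Continuous.inv₀ (by fun_prop) fun t => (hmax t).ne'
  have hρs : ∀ t ∈ spectrum ℝ J, ρ t = (‖x - (t : ℂ)‖ ^ 2)⁻¹ := by
    intro t ht
    simp only [hρ]
    rw [max_eq_left (pow_le_pow_left₀ hδ.le (hδx t ht) 2)]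
  have hσc : Continuous fun t : ℝ => t * ρ t := continuous_id.mul hρc
  set G : H →L[ℂ] H := star x • cfc ρ J - cfc (fun t => t * ρ t) J with hG
  have hJρ : cfc (fun t => t * ρ t) J = J * cfc ρ J := by
    rw [cfc_mul (fun t => t) ρ J continuous_id.continuousOn hρc.continuousOn, cfc_id' ℝ J]
  have hcomm : cfc ρ J * J = J * cfc ρ J := by
    have := (cfc_commute_cfc ρ id J).eq
    rwa [cfc_id ℝ J] at this
  -- The operator form of `|x - t|² ρ(t) = 1`.
  have hone : (star x * x) • cfc ρ J - (x + star x) • (J * cfc ρ J) + J * (J * cfc ρ J) = 1 := by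
    have h1 : cfc (fun t : ℝ => (‖x‖ ^ 2 - 2 * x.re * t + t * t) * ρ t) J = 1 := by
      rw [cfc_congr (g := fun _ => (1 : ℝ)), cfc_const_one ℝ J]
      intro t ht
      have hpos : 0 < ‖x - (t : ℂ)‖ ^ 2 := by
        have := hδ.trans_le (hδx t ht); positivity
      have h2 : ‖x‖ ^ 2 - 2 * x.re * t + t * t = ‖x - (t : ℂ)‖ ^ 2 := by
        rw [← Complex.normSq_eq_norm_sq, ← Complex.normSq_eq_norm_sq, Complex.normSq_apply,
          Complex.normSq_apply]
        simp
        ring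
      simp only [hρs t ht, h2]
      exact mul_inv_cancel₀ hpos.ne'
    rw [cfc_mul (fun t : ℝ => ‖x‖ ^ 2 - 2 * x.re * t + t * t) ρ J (by fun_prop)
      hρc.continuousOn] at h1
    have h2 : cfc (fun t : ℝ => ‖x‖ ^ 2 - 2 * x.re * t + t * t) J =
        (‖x‖ ^ 2) • (1 : H →L[ℂ] H) - (2 * x.re) • J + J * J := by
      generalize 2 * x.re = b
      have h3 := cfc_polynomial (R := ℝ) (Polynomial.C (‖x‖ ^ 2) -
        Polynomial.C b * Polynomial.X + Polynomial.X * Polynomial.X) J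
      rw [map_add, map_sub, map_mul, map_mul, Polynomial.aeval_X, Polynomial.aeval_C,
        Polynomial.aeval_C] at h3
      rw [Algebra.algebraMap_eq_smul_one, Algebra.algebraMap_eq_smul_one,
        smul_mul_assoc, one_mul] at h3
      rw [← h3]
      congr 1
      ext t
      simp
    rw [h2] at h1
    rw [← h1]
    have h4 : star x * x = ((‖x‖ ^ 2 : ℝ) : ℂ) := by
      have := Complex.conj_mul' x
      simpa using this
    have h5 : x + star x = ((2 * x.re : ℝ) : ℂ) := Complex.add_conj x
    rw [h4, h5, Complex.coe_smul, Complex.coe_smul, add_mul, sub_mul, smul_mul_assoc,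
      smul_mul_assoc, one_mul, mul_assoc]
  have hright : (x • 1 - J) * G = 1 := by
    refine Eq.trans ?_ hone
    rw [hG, hJρ]
    simp only [sub_mul, mul_sub, smul_mul_assoc, mul_smul_comm, one_mul]
    module
  have hleft : G * (x • 1 - J) = 1 := by
    refine Eq.trans ?_ hone
    rw [hG, hJρ]
    simp only [sub_mul, mul_sub, smul_mul_assoc, mul_smul_comm, mul_one, mul_assoc, hcomm]
    module
  have hae : ∀ i j, ∀ᵐ t ∂(M.entry i j).variation, t ∈ spectrum ℝ J := fun i j => by
    have := M.variation_entry_eq_zero (h.diagMeasure_compl_spectrum hJ) i j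
    rw [ae_iff]
    exact this
  have hae' : ∀ i j, (fun t : ℝ => (x - (t : ℂ))⁻¹) =ᵐ[(M.entry i j).variation]
      fun t => star x * (ρ t : ℂ) - ((t * ρ t : ℝ) : ℂ) := fun i j => by
    filter_upwards [hae i j] with t ht
    have hne : x - (t : ℂ) ≠ 0 := sub_ne_zero.2 (hx t ht)
    have h4 : ((‖x - (t : ℂ)‖ ^ 2 : ℝ) : ℂ) = star (x - (t : ℂ)) * (x - (t : ℂ)) := by
      have := Complex.conj_mul' (x - (t : ℂ))
      simpa using this.symm
    have h5 : star (x - (t : ℂ)) ≠ 0 := star_ne_zero.2 hne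
    rw [hρs t ht, Complex.ofReal_mul, Complex.ofReal_inv, h4, ← sub_mul]
    have h6 : star x - (t : ℂ) = star (x - (t : ℂ)) := by simp
    rw [h6]
    field_simp
  have hc1 : Continuous fun t : ℝ => star x * (ρ t : ℂ) :=
    continuous_const.mul (Complex.continuous_ofReal.comp hρc)
  have hc2 : Continuous fun t : ℝ => ((t * ρ t : ℝ) : ℂ) := Complex.continuous_ofReal.comp hσc
  refine ⟨G, hright, hleft, fun i j => ⟨?_, ?_⟩, fun i j => ?_⟩
  · filter_upwards [hae i j] with t ht using hx t ht
  · exact (h.integrable (hc1.sub hc2) i j).congr (hae' i j).symm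
  · rw [stieltjes, of_apply, VectorMeasure.integral_congr_ae (hae' i j),
      VectorMeasure.integral_fun_sub (h.integrable hc1 i j) (h.integrable hc2 i j),
      integral_entry_smul, h.integral_cfc hJ hρc, h.integral_cfc hJ hσc, hG,
      _root_.sub_apply, _root_.smul_apply, inner_sub_right,
      inner_smul_right]

end Moments

end MatrixMeasure
end MatrixChebyshev

/-! ### From orthonormality to moments of the Jacobi operator -/

namespace MatrixChebyshev

variable {r : ℕ}

theorem exists_polynomial_orthPoly (a b : ℕ → Matrix (Fin r) (Fin r) ℂ) (n : ℕ) :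
    ∀ i j, ∃ q : Polynomial ℂ, ∀ x, orthPoly a b n x i j = q.eval x := by
  have hmul : ∀ (N : Matrix (Fin r) (Fin r) ℂ) (F : ℂ → Matrix (Fin r) (Fin r) ℂ),
      (∀ i j, ∃ q : Polynomial ℂ, ∀ x, F x i j = q.eval x) →
      ∀ i j, ∃ q : Polynomial ℂ, ∀ x, (N * F x) i j = q.eval x := by
    intro N F hF i j
    choose q hq using hF
    exact ⟨∑ k, Polynomial.C (N i k) * q k j, fun x => by
      simp [Matrix.mul_apply, hq, Polynomial.eval_finsetSum]⟩
  have hsub : ∀ (F G : ℂ → Matrix (Fin r) (Fin r) ℂ),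
      (∀ i j, ∃ q : Polynomial ℂ, ∀ x, F x i j = q.eval x) →
      (∀ i j, ∃ q : Polynomial ℂ, ∀ x, G x i j = q.eval x) →
      ∀ i j, ∃ q : Polynomial ℂ, ∀ x, (F x - G x) i j = q.eval x := by
    intro F G hF hG i j
    obtain ⟨p, hp⟩ := hF i j
    obtain ⟨q, hq⟩ := hG i j
    exact ⟨p - q, fun x => by simp [hp, hq]⟩
  have hX : ∀ (F : ℂ → Matrix (Fin r) (Fin r) ℂ),
      (∀ i j, ∃ q : Polynomial ℂ, ∀ x, F x i j = q.eval x) →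
      ∀ i j, ∃ q : Polynomial ℂ, ∀ x, (x • F x) i j = q.eval x := by
    intro F hF i j
    obtain ⟨p, hp⟩ := hF i j
    exact ⟨Polynomial.X * p, fun x => by simp [hp]⟩
  have hC : ∀ N : Matrix (Fin r) (Fin r) ℂ, ∀ i j, ∃ q : Polynomial ℂ, ∀ x : ℂ,
      N i j = q.eval x := fun N i j => ⟨Polynomial.C (N i j), by simp⟩
  induction n using Nat.twoStepInduction with
  | zero => exact hC 1
  | one => exact hmul _ _ (hsub _ _ (hX _ (hC 1)) (hC _))
  | more n h0 h1 =>
    simp only [orthPoly, sub_mul, smul_mul_assoc, one_mul]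
    exact hmul _ _ (hsub _ _ (hsub _ _ (hX _ h1) (hmul _ _ h1)) (hmul _ _ h0))

/-- Multiplication by the variable acts on expansions in orthogonal polynomials as the block Jacobi
operator. -/
theorem smul_sum_vecMul_orthPoly {c : ℂ} {A B : Matrix (Fin r) (Fin r) ℂ}
    (hB : B.IsHermitian) {a : ℕ → Matrix (Fin r) (Fin r) ℂ} (ha : ∀ n, IsUnit (a n).det)
    (hac : ∀ n, a (n + 1) = scaledCoeff c A n) (u : SeqSpace r) (N : ℕ)
    (hu : ∀ n, N < n → u n = 0) (x : ℂ) :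
    x • ∑ n ∈ Finset.range (N + 1), star (u n).ofLp ᵥ* orthPoly a (fun _ => B) n x =
      ∑ n ∈ Finset.range (N + 2),
        star (jacobiOp c A B u n).ofLp ᵥ* orthPoly a (fun _ => B) n x := by
  set P : ℕ → Matrix (Fin r) (Fin r) ℂ := fun n => orthPoly a (fun _ => B) n x with hP
  have hP0 : x • P 0 = a 1 * P 1 + B * P 0 := orthPoly_recurrence_zero a (fun _ => B) ha x
  have hPs : ∀ n, x • P (n + 1) = a (n + 2) * P (n + 2) + B * P (n + 1) + (a (n + 1))ᴴ * P n :=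
    fun n => orthPoly_recurrence a (fun _ => B) ha n x
  set α : ℕ → Fin r → ℂ := fun n => star (u n).ofLp ᵥ* (a (n + 1) * P (n + 1)) with hα
  set β : ℕ → Fin r → ℂ := fun n => star (u n).ofLp ᵥ* (B * P n) with hβ
  set γ : ℕ → Fin r → ℂ := fun n => star (u (n + 1)).ofLp ᵥ* ((a (n + 1))ᴴ * P n) with hγ
  have hL0 : x • (star (u 0).ofLp ᵥ* P 0) = α 0 + β 0 := by
    rw [← vecMul_smul, hP0, vecMul_add]
  have hLs : ∀ n, x • (star (u (n + 1)).ofLp ᵥ* P (n + 1)) = α (n + 1) + β (n + 1) + γ n := by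
    intro n
    rw [← vecMul_smul, hPs, vecMul_add, vecMul_add]
  have hmat : ∀ (N : Matrix (Fin r) (Fin r) ℂ) (v : EuclideanSpace ℂ (Fin r))
      (Q : Matrix (Fin r) (Fin r) ℂ),
      star (euclOp N v).ofLp ᵥ* Q = star v.ofLp ᵥ* (Nᴴ * Q) := by
    intro N v Q
    rw [← vecMul_vecMul, ← star_mulVec]
    rfl
  have hR0 : star (jacobiOp c A B u 0).ofLp ᵥ* P 0 = β 0 + γ 0 := by
    rw [jacobiOp_zero, WithLp.ofLp_add, star_add, add_vecMul, hmat, hmat, hB.eq, ← hac]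
  have hRs : ∀ n, star (jacobiOp c A B u (n + 1)).ofLp ᵥ* P (n + 1) =
      α n + β (n + 1) + γ (n + 1) := by
    intro n
    rw [jacobiOp_succ, WithLp.ofLp_add, WithLp.ofLp_add, star_add, star_add, add_vecMul,
      add_vecMul, hmat, hmat, hmat, hB.eq, ← hac, ← hac, conjTranspose_conjTranspose]
    abel
  have hβN : β (N + 1) = 0 := by simp [hβ, hu (N + 1) (by omega)]
  have hγN : γ N = 0 := by simp [hγ, hu (N + 1) (by omega)]
  have hγN' : γ (N + 1) = 0 := by simp [hγ, hu (N + 2) (by omega)]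
  change x • ∑ n ∈ Finset.range (N + 1), star (u n).ofLp ᵥ* P n =
    ∑ n ∈ Finset.range (N + 2), star (jacobiOp c A B u n).ofLp ᵥ* P n
  rw [Finset.smul_sum, Finset.sum_range_succ', Finset.sum_range_succ' _ (N + 1)]
  simp only [hL0, hLs, hR0, hRs, Finset.sum_add_distrib]
  rw [Finset.sum_range_succ α N, Finset.sum_range_succ (fun n => β (n + 1)) N,
    Finset.sum_range_succ (fun n => γ (n + 1)) N, hβN, hγN']
  have h1 : ∑ n ∈ Finset.range N, α n + α N = ∑ n ∈ Finset.range N, α (n + 1) + α 0 := by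
    rw [← Finset.sum_range_succ, ← Finset.sum_range_succ']
  have h2 : ∑ n ∈ Finset.range N, γ n = ∑ n ∈ Finset.range N, γ (n + 1) + γ 0 := by
    rw [← Finset.sum_range_succ', Finset.sum_range_succ, hγN, add_zero]
  rw [h1, h2]
  abel

theorem jacobiOp_eq_zero (c : ℂ) (A B : Matrix (Fin r) (Fin r) ℂ) (u : SeqSpace r) (N : ℕ)
    (hu : ∀ n, N < n → u n = 0) : ∀ n, N + 1 < n → jacobiOp c A B u n = 0 := by
  intro n hn
  obtain ⟨m, rfl⟩ : ∃ m, n = m + 1 := ⟨n - 1, by omega⟩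
  rw [jacobiOp_succ, hu (m + 1) (by omega), hu (m + 2) (by omega), hu m (by omega)]
  simp

/-- Starting from `P_0 = 1`, each multiplication by `x` applies the Jacobi operator to the
coefficients and enlarges their support by one block, so all sums stay finite. -/
theorem jacobiOp_pow_single {c : ℂ} {A B : Matrix (Fin r) (Fin r) ℂ}
    (hB : B.IsHermitian) {a : ℕ → Matrix (Fin r) (Fin r) ℂ} (ha : ∀ n, IsUnit (a n).det)
    (hac : ∀ n, a (n + 1) = scaledCoeff c A n) (v : EuclideanSpace ℂ (Fin r)) (m : ℕ) :
    (∀ n, m < n → (jacobiOp c A B ^ m) (seqSingle 0 v) n = 0) ∧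
    ∀ x : ℂ, x ^ m • star v.ofLp = ∑ n ∈ Finset.range (m + 1),
      star ((jacobiOp c A B ^ m) (seqSingle 0 v) n).ofLp ᵥ* orthPoly a (fun _ => B) n x := by
  induction m with
  | zero =>
    refine ⟨fun n hn => ?_, fun x => ?_⟩
    · simp [seqSingle, lp.single_apply, hn.ne']
    · simp [seqSingle, orthPoly]
  | succ m ih =>
    rw [pow_succ']
    refine ⟨jacobiOp_eq_zero c A B _ m ih.1, fun x => ?_⟩
    rw [pow_succ', mul_smul, ih.2 x, smul_sum_vecMul_orthPoly hB ha hac _ m ih.1]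
    rfl

namespace MatrixMeasure

/-- Expand `t^m e_iᴴ` in the `P_n` and integrate against `dM = dM P_0ᴴ`. Orthonormality leaves only
the coefficient of `P_0`, which is the zeroth block of `J^m e_i`. -/
theorem IsSpectralMeasure.hasMoments {M : MatrixMeasure r} {c : ℂ} {A B : Matrix (Fin r) (Fin r) ℂ}
    (hB : B.IsHermitian) {a : ℕ → Matrix (Fin r) (Fin r) ℂ} (ha : ∀ n, IsUnit (a n).det)
    (hac : ∀ n, a (n + 1) = scaledCoeff c A n) (hM : M.IsSpectralMeasure a (fun _ => B)) :
    M.HasMoments (jacobiOp c A B) (fun i => seqSingle 0 (EuclideanSpace.single i 1)) := by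
  refine ⟨hM.integrable_pow, fun m i j => ?_⟩
  have hint : ∀ n l k, (M.entry k j).Integrable
      (fun t : ℝ => orthPoly a (fun _ => B) n (t : ℂ) l k) := by
    intro n l k
    obtain ⟨q, hq⟩ := exists_polynomial_orthPoly a (fun _ => B) n l k
    simp only [hq, Polynomial.eval_eq_sum_range]
    exact VectorMeasure.Integrable.fun_finsetSum _ fun d _ =>
      (hM.integrable_pow d k j).const_mul _
  have horth : ∀ n l, ∑ k, (M.entry k j).integral
      (fun t : ℝ => orthPoly a (fun _ => B) n (t : ℂ) l k) (ContinuousLinearMap.mul ℝ ℂ) =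
      if n = 0 ∧ l = j then 1 else 0 := by
    intro n l
    have h := congrFun (congrFun (hM.orthonormal n 0) l) j
    rw [sesqIntegral, of_apply] at h
    have h2 : (if n = 0 ∧ l = j then (1 : ℂ) else 0) =
        (if n = 0 then (1 : Matrix (Fin r) (Fin r) ℂ) else 0) l j := by
      by_cases hn : n = 0 <;> simp [hn, Matrix.one_apply]
    rw [h2, ← h]
    refine Finset.sum_congr rfl fun k _ => ?_
    rw [Finset.sum_eq_single j]
    · simp [orthPoly]
    · intro q _ hq
      have : (fun t : ℝ => orthPoly a (fun _ => B) n (t : ℂ) l k *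
          star (orthPoly a (fun _ => B) 0 (t : ℂ) j q)) = fun _ => 0 := by
        ext t
        simp [orthPoly, hq.symm]
      rw [this, VectorMeasure.integral_zero]
    · simp
  obtain ⟨-, hexp⟩ := jacobiOp_pow_single hB ha hac (EuclideanSpace.single i (1 : ℂ)) m
  set u := (jacobiOp c A B ^ m) (seqSingle 0 (EuclideanSpace.single i (1 : ℂ))) with hu
  have h1 : ∀ k (t : ℝ), (t : ℂ) ^ m * (if k = i then 1 else 0) =
      ∑ n ∈ Finset.range (m + 1), ∑ l, star (u n l) * orthPoly a (fun _ => B) n (t : ℂ) l k := by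
    intro k t
    have := congrFun (hexp (t : ℂ)) k
    simp only [Finset.sum_apply, Pi.smul_apply, smul_eq_mul, Pi.star_apply, vecMul,
      dotProduct] at this
    rw [← this]
    simp
  have h2 : (M.entry i j).integral (fun t : ℝ => (t : ℂ) ^ m) (ContinuousLinearMap.mul ℝ ℂ) =
      ∑ k, (M.entry k j).integral (fun t : ℝ => (t : ℂ) ^ m * (if k = i then 1 else 0))
        (ContinuousLinearMap.mul ℝ ℂ) := by
    rw [Finset.sum_eq_single i]
    · simp
    · intro k _ hk
      simp [hk]
    · simp
  rw [h2]
  simp only [h1]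
  have h3 : ∀ k, (M.entry k j).integral (fun t : ℝ => ∑ n ∈ Finset.range (m + 1), ∑ l,
      star (u n l) * orthPoly a (fun _ => B) n (t : ℂ) l k) (ContinuousLinearMap.mul ℝ ℂ) =
      ∑ n ∈ Finset.range (m + 1), ∑ l, star (u n l) * (M.entry k j).integral
        (fun t : ℝ => orthPoly a (fun _ => B) n (t : ℂ) l k) (ContinuousLinearMap.mul ℝ ℂ) := by
    intro k
    rw [VectorMeasure.integral_finsetSum]
    · refine Finset.sum_congr rfl fun n _ => ?_
      rw [VectorMeasure.integral_finsetSum]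
      · exact Finset.sum_congr rfl fun l _ => M.integral_entry_smul _ _ _ _
      · exact fun l _ => (hint n l k).const_mul _
    · exact fun n _ => VectorMeasure.Integrable.fun_finsetSum _ fun l _ =>
        (hint n l k).const_mul _
  simp only [h3]
  rw [Finset.sum_comm]
  simp only [Finset.sum_comm (s := Finset.univ) (t := Finset.univ) (f := fun k l => star (u _ l) * _),
    ← Finset.mul_sum, horth]
  -- Symmetry of `J^m` moves the power to the left vector, where the expansion was made.
  have h4 : inner ℂ (seqSingle 0 (EuclideanSpace.single i (1 : ℂ)))
      ((jacobiOp c A B ^ m) (seqSingle 0 (EuclideanSpace.single j (1 : ℂ)))) = star (u 0 j) := by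
    have hsa := ((isSelfAdjoint_jacobiOp c A hB).pow m)
    rw [ContinuousLinearMap.isSelfAdjoint_iff_isSymmetric] at hsa
    have := hsa (seqSingle 0 (EuclideanSpace.single i (1 : ℂ)))
      (seqSingle 0 (EuclideanSpace.single j (1 : ℂ)))
    simp only [ContinuousLinearMap.coe_coe] at this
    rw [← this, ← hu, lp.inner_single_right]
    simp [EuclideanSpace.inner_single_right]
  rw [h4, Finset.sum_eq_single 0, Finset.sum_eq_single j]
  · simp
  · intro l _ hl
    simp [hl]
  · simp
  · intro n _ hn
    simp [hn]
  · simp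

end MatrixMeasure
end MatrixChebyshev

/-! ### The corner block of the resolvent and its fixed point equation -/

namespace MatrixChebyshev

variable {r : ℕ}

/-- The left shift on sequences. -/
noncomputable def leftShift (r : ℕ) : SeqSpace r →L[ℂ] SeqSpace r :=
  weightedComp (fun _ => 1) Nat.succ 1 (fun _ => ContinuousLinearMap.norm_id_le)
    Nat.succ_injective

theorem leftShift_apply (u : SeqSpace r) (n : ℕ) : leftShift r u n = u (n + 1) := rfl

/-- The upper left block of an operator on sequences. -/
noncomputable def cornerBlock (G : SeqSpace r →L[ℂ] SeqSpace r) : Matrix (Fin r) (Fin r) ℂ :=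
  Matrix.of fun i j => inner ℂ (seqSingle 0 (EuclideanSpace.single i (1 : ℂ)))
    (G (seqSingle 0 (EuclideanSpace.single j (1 : ℂ))))

theorem cornerBlock_apply (G : SeqSpace r →L[ℂ] SeqSpace r) (v : EuclideanSpace ℂ (Fin r)) :
    G (seqSingle 0 v) 0 = euclOp (cornerBlock G) v := by
  have hv : v = ∑ j, v j • EuclideanSpace.single j (1 : ℂ) := by
    ext i
    simp [Pi.single_apply]
  ext i
  have h1 : ∀ j, cornerBlock G i j = G (seqSingle 0 (EuclideanSpace.single j (1 : ℂ))) 0 i := by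
    intro j
    rw [cornerBlock, of_apply, inner_seqSingle]
    simp [EuclideanSpace.inner_single_left]
  have h2 : euclOp (cornerBlock G) v i = ∑ j, cornerBlock G i j * v j := rfl
  rw [h2]
  have h3 : (seqSingle 0 v : SeqSpace r) =
      ∑ j, v j • seqSingle 0 (EuclideanSpace.single j (1 : ℂ)) := by
    have h4 : (seqSingle 0 v : SeqSpace r) =
      lp.singleContinuousLinearMap ℂ (fun _ : ℕ => EuclideanSpace ℂ (Fin r)) 2 0 v := rfl
    nth_rewrite 1 [h4, hv]
    rw [map_sum]
    simp only [map_smul]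
    rfl
  rw [h3, map_sum]
  simp only [map_smul]
  have h5 : ∀ (f : Fin r → SeqSpace r), (∑ j, f j) 0 i = ∑ j, f j 0 i := by
    intro f
    rw [lp.coeFn_sum, Finset.sum_apply]
    simp
  rw [h5]
  refine Finset.sum_congr rfl fun j _ => ?_
  rw [h1, lp.coeFn_smul]
  simp [mul_comm]

theorem cornerBlock_star (G : SeqSpace r →L[ℂ] SeqSpace r) :
    cornerBlock (star G) = (cornerBlock G)ᴴ := by
  ext i j
  rw [conjTranspose_apply, cornerBlock, of_apply, cornerBlock, of_apply,
    ContinuousLinearMap.star_eq_adjoint, ContinuousLinearMap.adjoint_inner_right]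
  exact (inner_conj_symm _ _).symm

variable {c x : ℂ} {A B : Matrix (Fin r) (Fin r) ℂ} {G Gc : SeqSpace r →L[ℂ] SeqSpace r}

/-- Only the first off-diagonal block depends on `c`. The tail of a solution `ψ` of `(x - J_c) ψ =
e_0 v` thus solves the equation for `J_1`, with the coupling `conj c • A ψ_0` to the removed row as
source. -/
theorem leftShift_resolvent (hG : G * (x • 1 - jacobiOp 1 A B) = 1)
    (hGc : (x • 1 - jacobiOp c A B) * Gc = 1) (v : EuclideanSpace ℂ (Fin r)) :
    leftShift r (Gc (seqSingle 0 v)) =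
      G (seqSingle 0 (star c • euclOp A (Gc (seqSingle 0 v) 0))) := by
  set ψ := Gc (seqSingle 0 v) with hψ
  have h1 : x • ψ - jacobiOp c A B ψ = seqSingle 0 v := by
    have := congrArg (fun T : SeqSpace r →L[ℂ] SeqSpace r => T (seqSingle 0 v)) hGc
    simpa using this
  have h2 : ∀ n, x • ψ (n + 1) = jacobiOp c A B ψ (n + 1) := by
    intro n
    have h3 : (x • ψ - jacobiOp c A B ψ) (n + 1) = (seqSingle 0 v : SeqSpace r) (n + 1) := by
      rw [h1]
    rw [lp.coeFn_sub, lp.coeFn_smul, Pi.sub_apply, Pi.smul_apply] at h3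
    rw [← sub_eq_zero, h3]
    simp [seqSingle, lp.single_apply]
  have h4 : x • leftShift r ψ - jacobiOp 1 A B (leftShift r ψ) =
      seqSingle 0 (star c • euclOp A (ψ 0)) := by
    ext n : 2
    rw [lp.coeFn_sub, lp.coeFn_smul, Pi.sub_apply, Pi.smul_apply, leftShift_apply, h2]
    cases n with
    | zero =>
      rw [jacobiOp_zero, jacobiOp_succ]
      simp only [leftShift_apply, scaledCoeff]
      simp [seqSingle, lp.single_apply, euclOp]
    | succ n =>
      rw [jacobiOp_succ, jacobiOp_succ]
      simp only [leftShift_apply, scaledCoeff]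
      rcases Nat.eq_zero_or_pos n with rfl | hn
      · simp [seqSingle, lp.single_apply]
      · simp [seqSingle, lp.single_apply, hn.ne']
  rw [← h4]
  have := congrArg (fun T : SeqSpace r →L[ℂ] SeqSpace r => T (leftShift r ψ)) hG
  simpa using this.symm

theorem euclOp_mul_apply (M N : Matrix (Fin r) (Fin r) ℂ) (v : EuclideanSpace ℂ (Fin r)) :
    euclOp (M * N) v = euclOp M (euclOp N v) := by
  rw [euclOp, map_mul]
  rfl

/-- A Schur complement: the zeroth row of `(x - J_c) ψ = e_0 v` with `ψ_1 = F (conj c • A ψ_0)`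
inserted. For `c = 1` it is a quadratic equation for `F` itself. -/
theorem cornerBlock_resolvent (hG : G * (x • 1 - jacobiOp 1 A B) = 1)
    (hGc : (x • 1 - jacobiOp c A B) * Gc = 1) :
    (x • (1 : Matrix (Fin r) (Fin r) ℂ) - B - (c * star c) • (Aᴴ * cornerBlock G * A)) *
      cornerBlock Gc = 1 := by
  refine (Matrix.toEuclideanCLM (n := Fin r) (𝕜 := ℂ)).injective ?_
  ext v : 1
  change euclOp _ v = euclOp 1 v
  set ψ := Gc (seqSingle 0 v) with hψ
  have h0 : ψ 0 = euclOp (cornerBlock Gc) v := cornerBlock_apply Gc v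
  have h1 : x • ψ - jacobiOp c A B ψ = seqSingle 0 v := by
    have := congrArg (fun T : SeqSpace r →L[ℂ] SeqSpace r => T (seqSingle 0 v)) hGc
    simpa using this
  have h2 : x • ψ 0 - jacobiOp c A B ψ 0 = v := by
    have h3 : (x • ψ - jacobiOp c A B ψ) 0 = (seqSingle 0 v : SeqSpace r) 0 := by
      rw [h1]
    rw [lp.coeFn_sub, lp.coeFn_smul, Pi.sub_apply, Pi.smul_apply] at h3
    rw [h3]
    simp [seqSingle]
  have h4 : ψ 1 = euclOp (cornerBlock G) (star c • euclOp A (ψ 0)) := by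
    rw [← cornerBlock_apply, ← leftShift_resolvent hG hGc v, leftShift_apply]
  rw [jacobiOp_zero, h4, scaledCoeff, if_pos rfl] at h2
  rw [euclOp_mul_apply, ← h0]
  generalize ψ 0 = w at h2 ⊢
  simp only [euclOp, map_sub, map_smul, map_mul, map_one] at h2 ⊢
  refine Eq.trans ?_ h2
  change x • w - toEuclideanCLM (𝕜 := ℂ) B w - (c * star c) • toEuclideanCLM (𝕜 := ℂ) Aᴴ
    (toEuclideanCLM (𝕜 := ℂ) (cornerBlock G) (toEuclideanCLM (𝕜 := ℂ) A w)) =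
    x • w - (toEuclideanCLM (𝕜 := ℂ) B w + star c • c • toEuclideanCLM (𝕜 := ℂ) Aᴴ
    (toEuclideanCLM (𝕜 := ℂ) (cornerBlock G) (toEuclideanCLM (𝕜 := ℂ) A w)))
  module

/-- For `c = 1` the tail of a resolvent column is again a resolvent column, with `v` replaced by `A
F v`; iterate. -/
theorem resolvent_single_apply (hG : G * (x • 1 - jacobiOp 1 A B) = 1)
    (hG' : (x • 1 - jacobiOp 1 A B) * G = 1) (n : ℕ) (v : EuclideanSpace ℂ (Fin r)) :
    G (seqSingle 0 v) n = euclOp (cornerBlock G * (A * cornerBlock G) ^ n) v := by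
  induction n generalizing v with
  | zero => simpa using cornerBlock_apply G v
  | succ n ih =>
    rw [← leftShift_apply, leftShift_resolvent hG hG', ih, cornerBlock_apply, star_one, one_smul,
      ← euclOp_mul_apply, ← euclOp_mul_apply, pow_succ]
    simp only [mul_assoc]

theorem tendsto_lp_two (u : SeqSpace r) : Filter.Tendsto (fun n => u n) Filter.atTop (nhds 0) := by
  have h1 := (summable_norm_sq u).tendsto_atTop_zero
  rw [tendsto_zero_iff_norm_tendsto_zero]
  have h2 := h1.sqrt
  simpa using h2

/-- For `v = K w` with `K = F⁻¹`, block `n` of the resolvent column is `(F A)^n w = z^n w`. Square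
summability makes it tend to zero. -/
theorem norm_lt_one_of_mulVec_eq (hG : G * (x • 1 - jacobiOp 1 A B) = 1)
    (hG' : (x • 1 - jacobiOp 1 A B) * G = 1) {w : Fin r → ℂ} (hw : w ≠ 0) {z : ℂ}
    (hz : (cornerBlock G * A) *ᵥ w = z • w) : ‖z‖ < 1 := by
  set F := cornerBlock G with hF
  have hinv := cornerBlock_resolvent hG hG'
  have hinv' := mul_eq_one_comm.1 hinv
  set K := x • (1 : Matrix (Fin r) (Fin r) ℂ) - B - ((1 : ℂ) * star 1) • (Aᴴ * F * A) with hK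
  set v : EuclideanSpace ℂ (Fin r) := WithLp.toLp 2 (K *ᵥ w) with hv
  have hpow : ∀ n, F * (A * F) ^ n = (F * A) ^ n * F := by
    intro n
    induction n with
    | zero => simp
    | succ n ih => rw [pow_succ, ← mul_assoc, ih, pow_succ]; simp only [mul_assoc]
  have hzn : ∀ n, (F * A) ^ n *ᵥ w = z ^ n • w := by
    intro n
    induction n with
    | zero => simp
    | succ n ih => rw [pow_succ, ← mulVec_mulVec, hz, mulVec_smul, ih, smul_smul, pow_succ']
  have h1 : ∀ n, (G (seqSingle 0 v) n).ofLp = z ^ n • w := by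
    intro n
    rw [resolvent_single_apply hG hG', ← hF, hpow]
    change ((F * A) ^ n * F) *ᵥ (K *ᵥ w) = _
    rw [mulVec_mulVec, mul_assoc, hinv', mul_one, hzn]
  obtain ⟨i, hi⟩ : ∃ i, w i ≠ 0 := by
    by_contra h
    push Not at h
    exact hw (funext h)
  have h2 := tendsto_lp_two (G (seqSingle 0 v))
  have h3 : Filter.Tendsto (fun n => z ^ n * w i) Filter.atTop (nhds 0) := by
    have h4 := ((EuclideanSpace.proj (𝕜 := ℂ) i).continuous.tendsto (0 : EuclideanSpace ℂ (Fin r)))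
      |>.comp h2
    rw [map_zero] at h4
    refine h4.congr fun n => ?_
    have := congrFun (h1 n) i
    simpa using this
  have h5 := h3.mul_const (w i)⁻¹
  simp only [zero_mul, mul_inv_cancel_right₀ hi] at h5
  rwa [tendsto_pow_atTop_nhds_zero_iff_norm_lt_one] at h5

end MatrixChebyshev

/-! ### Factorization of the quadratic pencil, small roots and their vectors -/

namespace MatrixChebyshev

section DetDegree

variable {R n : Type*} [CommRing R] [Fintype n] [DecidableEq n]

theorem natDegree_det_le_of_entries (N : Matrix n n (Polynomial R)) (d : ℕ)
    (hN : ∀ i j, (N i j).natDegree ≤ d) : N.det.natDegree ≤ Fintype.card n * d := by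
  rw [det_apply]
  refine Polynomial.natDegree_sum_le_of_forall_le _ _ fun σ _ => ?_
  refine (Polynomial.natDegree_smul_le _ _).trans ?_
  refine (Polynomial.natDegree_prod_le _ _).trans ?_
  refine (Finset.sum_le_sum fun i _ => hN (σ i) i).trans ?_
  simp

theorem coeff_det_of_entries (N : Matrix n n (Polynomial R)) (d : ℕ)
    (hN : ∀ i j, (N i j).natDegree ≤ d) :
    N.det.coeff (Fintype.card n * d) = (N.map fun p => p.coeff d).det := by
  rw [det_apply, det_apply, Polynomial.finsetSum_coeff]
  refine Finset.sum_congr rfl fun σ _ => ?_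
  rw [Polynomial.coeff_smul]
  congr 1
  have := Polynomial.coeff_prod_of_natDegree_le (s := Finset.univ) (fun i => N (σ i) i) d
    (fun i _ => hN (σ i) i)
  simpa using this

end DetDegree

variable {r : ℕ} {A B F : Matrix (Fin r) (Fin r) ℂ} {x : ℂ}

theorem coeff_algPoly (A B : Matrix (Fin r) (Fin r) ℂ) (x : ℂ) :
    (algPoly A B x).natDegree ≤ 2 * r ∧ (algPoly A B x).coeff (2 * r) = Aᴴ.det := by
  have hdeg : ∀ i j, (((Polynomial.X : Polynomial ℂ) ^ 2 • Aᴴ.map Polynomial.C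
    + (Polynomial.X : Polynomial ℂ) • (B - x • (1 : Matrix (Fin r) (Fin r) ℂ)).map Polynomial.C
    + A.map Polynomial.C) i j).natDegree ≤ 2 := by
    intro i j
    simp only [Matrix.add_apply, Matrix.smul_apply, map_apply, smul_eq_mul]
    compute_degree
  have h1 := natDegree_det_le_of_entries _ 2 hdeg
  have h2 := coeff_det_of_entries _ 2 hdeg
  rw [Fintype.card_fin, mul_comm] at h1 h2
  refine ⟨h1, h2.trans ?_⟩
  congr 1
  ext i j
  simp

theorem isUnit_det_conjTranspose (hA : IsUnit A.det) : IsUnit Aᴴ.det := by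
  rw [det_conjTranspose]
  exact hA.star

theorem natDegree_algPoly (hA : IsUnit A.det) (B : Matrix (Fin r) (Fin r) ℂ) (x : ℂ) :
    (algPoly A B x).natDegree = 2 * r := by
  refine le_antisymm (coeff_algPoly A B x).1 (Polynomial.le_natDegree_of_ne_zero ?_)
  rw [(coeff_algPoly A B x).2]
  exact (isUnit_det_conjTranspose hA).ne_zero

theorem algPoly_ne_zero (hA : IsUnit A.det) (B : Matrix (Fin r) (Fin r) ℂ) (x : ℂ) :
    algPoly A B x ≠ 0 := by
  intro h
  have := (coeff_algPoly A B x).2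
  rw [h, Polynomial.coeff_zero] at this
  exact (isUnit_det_conjTranspose hA).ne_zero this.symm

theorem card_roots_algPoly (hA : IsUnit A.det) (B : Matrix (Fin r) (Fin r) ℂ) (x : ℂ) :
    (algPoly A B x).roots.card = 2 * r := by
  rw [IsAlgClosed.card_roots_eq_natDegree, natDegree_algPoly hA]

theorem eval_zero_algPoly (A B : Matrix (Fin r) (Fin r) ℂ) (x : ℂ) :
    (algPoly A B x).eval 0 = A.det := by
  rw [algPoly, ← Polynomial.coe_evalRingHom, RingHom.map_det]
  congr 1
  ext i j
  simp

theorem ne_zero_of_mem_roots (hA : IsUnit A.det) {z : ℂ} (hz : z ∈ (algPoly A B x).roots) :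
    z ≠ 0 := by
  rintro rfl
  have := (Polynomial.mem_roots (algPoly_ne_zero hA B x)).1 hz
  rw [Polynomial.IsRoot, eval_zero_algPoly] at this
  exact hA.ne_zero this

/-- Group a linear relation by eigenvalue: independence of the eigenspaces kills each group, and
independence within the fibre kills the coefficients. -/
theorem linearIndependent_of_eigenvector_fibers {K V ι : Type*} [Field K] [AddCommGroup V]
    [Module K V] [Fintype ι] (f : Module.End K V) (v : ι → V) (z : ι → K)
    (hv : ∀ i, f (v i) = z i • v i)
    (hfib : ∀ μ, LinearIndependent K fun i : {i // z i = μ} => v i) : LinearIndependent K v := by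
  classical
  rw [Fintype.linearIndependent_iff]
  intro g hg i
  have hind := f.eigenspaces_iSupIndep
  rw [iSupIndep_iff_finsetSum_eq_zero_imp_eq_zero] at hind
  set s : Finset K := Finset.univ.image z
  set w : K → V := fun μ => ∑ i with z i = μ, g i • v i
  have hw : ∀ μ, w μ ∈ f.eigenspace μ := by
    intro μ
    refine Submodule.sum_mem _ fun j hj => Submodule.smul_mem _ _ ?_
    rw [Module.End.mem_eigenspace_iff, hv, (Finset.mem_filter.1 hj).2]
  have hsum : ∑ μ ∈ s, w μ = 0 := by
    rw [← hg]
    exact Finset.sum_fiberwise_of_maps_to (fun j _ => Finset.mem_image_of_mem z (Finset.mem_univ j))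
      _
  have h0 : w (z i) = 0 := hind s w (fun μ _ => hw μ) hsum (z i)
    (Finset.mem_image_of_mem z (Finset.mem_univ i))
  have h1 := Fintype.linearIndependent_iff.1 (hfib (z i)) (fun j => g j) (by
    rw [← h0]
    exact (Finset.sum_subtype _ (by simp) (fun j => g j • v j)).symm) ⟨i, rfl⟩
  exact h1

/-- Determinant of `z² Aᴴ + z (B - x) + A = (z Aᴴ - K)(z - F A)`, which holds since `A = K F A` and
`B - x = -K - Aᴴ F A`. -/
theorem algPoly_eq_mul (hF : (x • (1 : Matrix (Fin r) (Fin r) ℂ) - B - Aᴴ * F * A) * F = 1) :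
    algPoly A B x = ((Polynomial.X : Polynomial ℂ) • Aᴴ.map Polynomial.C -
      (x • (1 : Matrix (Fin r) (Fin r) ℂ) - B - Aᴴ * F * A).map Polynomial.C).det *
      (F * A).charpoly := by
  set K := x • (1 : Matrix (Fin r) (Fin r) ℂ) - B - Aᴴ * F * A with hK
  rw [charpoly, charmatrix, ← det_mul, algPoly]
  congr 1
  have hm : ∀ N : Matrix (Fin r) (Fin r) ℂ,
      N.map Polynomial.C = (Polynomial.C : ℂ →+* Polynomial ℂ).mapMatrix N := fun _ => rfl
  have hs : scalar (Fin r) (Polynomial.X : Polynomial ℂ) = (Polynomial.X : Polynomial ℂ) • 1 := by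
    rw [scalar_apply, smul_one_eq_diagonal]
  have h1 : B - x • (1 : Matrix (Fin r) (Fin r) ℂ) = -K - Aᴴ * (F * A) := by
    rw [hK, mul_assoc]; abel
  have h2 : A = K * (F * A) := by rw [← mul_assoc, hF, one_mul]
  have h3 := congrArg (Polynomial.C : ℂ →+* Polynomial ℂ).mapMatrix h2
  rw [hs, hm, hm, hm, hm, h1]
  simp only [map_sub, map_neg, map_mul, sub_mul, mul_sub, mul_one, smul_mul_assoc,
    mul_smul_comm] at h3 ⊢
  rw [← sub_eq_zero] at h3 ⊢
  refine Eq.trans ?_ h3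
  module

/-- The small roots are the eigenvalues of `F * A`; the other factor has no small roots. -/
theorem det_ne_zero_of_norm_le_one
    (hF : (x • (1 : Matrix (Fin r) (Fin r) ℂ) - B - Aᴴ * F * A) * F = 1)
    (hin : ∀ (w : Fin r → ℂ) (z : ℂ), w ≠ 0 → (Fᴴ * A) *ᵥ w = z • w → ‖z‖ < 1)
    {z : ℂ} (hz : ‖z‖ ≤ 1) :
    (z • Aᴴ - (x • (1 : Matrix (Fin r) (Fin r) ℂ) - B - Aᴴ * F * A)).det ≠ 0 := by
  intro h0
  set K := x • (1 : Matrix (Fin r) (Fin r) ℂ) - B - Aᴴ * F * A with hK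
  -- Multiplying by `F` turns singularity of `z Aᴴ - K` into that of `z Aᴴ F - 1`; after conjugate
  -- transposition `1 / conj z`, of modulus at least one, would be an eigenvalue of `Fᴴ A`.
  have h1 : (z • (Aᴴ * F) - 1).det = 0 := by
    have : z • (Aᴴ * F) - 1 = (z • Aᴴ - K) * F := by rw [sub_mul, hF, smul_mul_assoc]
    rw [this, det_mul, h0, zero_mul]
  have h2 : ((z • (Aᴴ * F) - 1)ᴴ).det = 0 := by rw [det_conjTranspose, h1, star_zero]
  obtain ⟨w, hw, hw0⟩ := exists_mulVec_eq_zero_iff.2 h2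
  have h3 : star z • ((Fᴴ * A) *ᵥ w) = w := by
    rw [conjTranspose_sub, conjTranspose_smul, conjTranspose_mul, conjTranspose_conjTranspose,
      conjTranspose_one, sub_mulVec, one_mulVec, smul_mulVec, sub_eq_zero] at hw0
    exact hw0
  have hz0 : star z ≠ 0 := by
    intro h
    rw [h, zero_smul] at h3
    exact hw h3.symm
  have h4 : (Fᴴ * A) *ᵥ w = (star z)⁻¹ • w := by
    nth_rewrite 2 [← h3]
    rw [smul_smul, inv_mul_cancel₀ hz0, one_smul]
  have h5 := hin w _ hw h4
  rw [norm_inv, norm_star] at h5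
  have h6 : 0 < ‖z‖ := by rw [← norm_star]; exact norm_pos_iff.2 hz0
  exact absurd h5 (not_lt.2 ((one_le_inv₀ h6).2 hz))

/-- In the factorization the characteristic polynomial of `F A` contributes `r` roots, all in the
disc, and the other factor contributes none there. -/
theorem countP_roots_norm_lt_one (hA : IsUnit A.det)
    (hF : (x • (1 : Matrix (Fin r) (Fin r) ℂ) - B - Aᴴ * F * A) * F = 1)
    (hin : ∀ (w : Fin r → ℂ) (z : ℂ), w ≠ 0 → (F * A) *ᵥ w = z • w → ‖z‖ < 1)
    (hin' : ∀ (w : Fin r → ℂ) (z : ℂ), w ≠ 0 → (Fᴴ * A) *ᵥ w = z • w → ‖z‖ < 1) :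
    (algPoly A B x).roots.countP (fun z => ‖z‖ < 1) = r := by
  classical
  have hne := algPoly_ne_zero hA B x
  rw [algPoly_eq_mul hF] at hne ⊢
  set K := x • (1 : Matrix (Fin r) (Fin r) ℂ) - B - Aᴴ * F * A with hK
  rw [Polynomial.roots_mul hne, Multiset.countP_add]
  have h1 : Multiset.countP (fun z => ‖z‖ < 1) (F * A).charpoly.roots = r := by
    have hall : ∀ z ∈ (F * A).charpoly.roots, ‖z‖ < 1 := by
      intro z hz
      have hroot := (Polynomial.mem_roots (charpoly_monic _).ne_zero).1 hz
      rw [Polynomial.IsRoot, eval_charpoly] at hroot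
      obtain ⟨w, hw, hw0⟩ := exists_mulVec_eq_zero_iff.2 hroot
      refine hin w z hw ?_
      rw [sub_mulVec, sub_eq_zero] at hw0
      rw [← hw0, scalar_apply, ← smul_one_eq_diagonal, smul_mulVec, one_mulVec]
    rw [Multiset.countP_eq_card.2 hall, IsAlgClosed.card_roots_eq_natDegree,
      charpoly_natDegree_eq_dim, Fintype.card_fin]
  rw [h1, Nat.add_eq_right, Multiset.countP_eq_zero]
  intro z hz hlt
  have hroot := (Polynomial.mem_roots (left_ne_zero_of_mul hne)).1 hz
  rw [Polynomial.IsRoot, ← Polynomial.coe_evalRingHom, RingHom.map_det] at hroot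
  refine det_ne_zero_of_norm_le_one hF hin' hlt.le (Eq.trans ?_ hroot)
  congr 1
  ext i j
  simp only [Matrix.sub_apply, Matrix.smul_apply, RingHom.mapMatrix_apply, map_apply, map_sub,
    smul_eq_mul, Polynomial.coe_evalRingHom, Polynomial.eval_mul, Polynomial.eval_X,
    Polynomial.eval_C]
  simp only [hK, Matrix.sub_apply, Matrix.smul_apply, smul_eq_mul]

/-- If the `k`-th root were outside the disc, monotonicity would leave only the roots before it
inside, fewer than the `r` that are there. -/
theorem norm_root_lt_one_iff (hA : IsUnit A.det)
    (hF : (x • (1 : Matrix (Fin r) (Fin r) ℂ) - B - Aᴴ * F * A) * F = 1)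
    (hin : ∀ (w : Fin r → ℂ) (z : ℂ), w ≠ 0 → (F * A) *ᵥ w = z • w → ‖z‖ < 1)
    (hin' : ∀ (w : Fin r → ℂ) (z : ℂ), w ≠ 0 → (Fᴴ * A) *ᵥ w = z • w → ‖z‖ < 1)
    {z : Fin (2 * r) → ℂ} (hz : IsRootOrdering A B x z) (k : Fin (2 * r)) (hk : (k : ℕ) < r) :
    ‖z k‖ < 1 := by
  classical
  by_contra hge
  have hcard := countP_roots_norm_lt_one hA hF hin hin'
  rw [← hz.1, Multiset.countP_map] at hcard
  have h1 : (Finset.univ.filter fun l => ‖z l‖ < 1).card = r := hcard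
  have h2 : (Finset.univ.filter fun l => ‖z l‖ < 1) ⊆ Finset.Iio k := by
    intro l hl
    rw [Finset.mem_Iio]
    by_contra hlk
    exact hge ((hz.2 (not_lt.1 hlk)).trans_lt (Finset.mem_filter.1 hl).2)
  have h3 := Finset.card_le_card h2
  rw [h1, Fin.card_Iio] at h3
  omega

/-- The number of indices in a fibre is the algebraic multiplicity, which admissibility equates with
the dimension of the span. -/
theorem linearIndependent_root_fiber {z : Fin (2 * r) → ℂ}
    {v : Fin (2 * r) → EuclideanSpace ℂ (Fin r)} (h : IsRootVectorChoice A B x z v) (μ : ℂ) :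
    LinearIndependent ℂ fun l : {l // z l = μ} => v l := by
  classical
  rcases isEmpty_or_nonempty {l // z l = μ} with he | ⟨⟨k, hk⟩⟩
  · exact linearIndependent_empty_type
  rw [linearIndependent_iff_card_eq_finrank_span]
  have hset : Set.range (fun l : {l // z l = μ} => v l) = {w | ∃ l, z l = z k ∧ w = v l} := by
    ext w
    simp only [Set.mem_range, Subtype.exists, hk]
    constructor
    · rintro ⟨l, hl, rfl⟩
      exact ⟨l, hl, rfl⟩
    · rintro ⟨l, hl, rfl⟩
      exact ⟨l, hl, rfl⟩
  rw [hset, Set.finrank, h.span_eq_geom, h.geom_eq_alg, ← Polynomial.count_roots, ← h.ordering.1,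
    Multiset.count_map, Fintype.card_subtype]
  rw [hk]
  simp only [eq_comm (a := μ)]
  rfl

/-- At a small root the factor `z Aᴴ - K` is invertible, so a null vector of the pencil is an
eigenvector of `F A`. Independence then follows fibre by fibre. -/
theorem smallVectors_facts (hA : IsUnit A.det)
    (hF : (x • (1 : Matrix (Fin r) (Fin r) ℂ) - B - Aᴴ * F * A) * F = 1)
    (hin : ∀ (w : Fin r → ℂ) (z : ℂ), w ≠ 0 → (F * A) *ᵥ w = z • w → ‖z‖ < 1)
    (hin' : ∀ (w : Fin r → ℂ) (z : ℂ), w ≠ 0 → (Fᴴ * A) *ᵥ w = z • w → ‖z‖ < 1)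
    {z : Fin (2 * r) → ℂ} {v : Fin (2 * r) → EuclideanSpace ℂ (Fin r)}
    (h : IsRootVectorChoice A B x z v) :
    IsUnit (smallVectors v).det ∧ IsUnit (smallRoots z).det ∧
      F * A * smallVectors v = smallVectors v * smallRoots z := by
  classical
  have hroot : ∀ k, z k ∈ (algPoly A B x).roots := by
    intro k
    rw [← h.ordering.1]
    exact Multiset.mem_map_of_mem z (Finset.mem_univ k)
  have hcast : ∀ k : Fin r, ((Fin.castLE (by omega) k : Fin (2 * r)) : ℕ) < r := fun k => k.2
  set ι : Fin r → Fin (2 * r) := Fin.castLE (by omega) with hι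
  have hιinj : Function.Injective ι := Fin.castLE_injective _
  have heig : ∀ k : Fin r, (F * A) *ᵥ (v (ι k)).ofLp = z (ι k) • (v (ι k)).ofLp := by
    intro k
    set K := x • (1 : Matrix (Fin r) (Fin r) ℂ) - B - Aᴴ * F * A with hK
    have hz0 := ne_zero_of_mem_roots hA (hroot (ι k))
    have hlt := norm_root_lt_one_iff hA hF hin hin' h.ordering (ι k) (hcast k)
    have hdet := det_ne_zero_of_norm_le_one hF hin' hlt.le
    have hnull : pencil A B (z (ι k)) x *ᵥ (v (ι k)).ofLp = 0 := by
      have := congrArg WithLp.ofLp (h.null (ι k))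
      simpa using this
    have hfac : z (ι k) • pencil A B (z (ι k)) x = (z (ι k) • Aᴴ - K) * (z (ι k) • 1 - F * A) := by
      have h1 : B - x • (1 : Matrix (Fin r) (Fin r) ℂ) = -K - Aᴴ * (F * A) := by
        rw [hK, mul_assoc]; abel
      have h2 : A = K * (F * A) := by rw [← mul_assoc, hF, one_mul]
      have h3 : z (ι k) • pencil A B (z (ι k)) x =
          (z (ι k) * z (ι k)) • Aᴴ + z (ι k) • (B - x • (1 : Matrix (Fin r) (Fin r) ℂ)) + A := by
        rw [pencil]
        have h4 : z (ι k) • (z (ι k))⁻¹ • A = A := by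
          rw [smul_smul, mul_inv_cancel₀ hz0, one_smul]
        rw [← sub_eq_zero] at h4 ⊢
        refine Eq.trans ?_ h4
        module
      rw [h3, h1]
      simp only [sub_mul, mul_sub, mul_one, smul_mul_assoc, mul_smul_comm]
      have h5 := sub_eq_zero.2 h2
      rw [← sub_eq_zero]
      refine Eq.trans ?_ h5
      module
    have h5 : (z (ι k) • Aᴴ - K) *ᵥ ((z (ι k) • 1 - F * A) *ᵥ (v (ι k)).ofLp) = 0 := by
      rw [mulVec_mulVec, ← hfac, smul_mulVec, hnull, smul_zero]
    have h6 := eq_zero_of_mulVec_eq_zero hdet h5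
    rw [sub_mulVec, smul_mulVec, one_mulVec, sub_eq_zero] at h6
    exact h6.symm
  have hli : LinearIndependent ℂ fun k : Fin r => (v (ι k)).ofLp := by
    refine linearIndependent_of_eigenvector_fibers (Matrix.mulVecLin (F * A))
      (fun k => (v (ι k)).ofLp) (fun k => z (ι k)) (fun k => heig k) fun μ => ?_
    have h1 := (linearIndependent_root_fiber h μ).comp
      (fun k : {k : Fin r // z (ι k) = μ} => (⟨ι k, k.2⟩ : {l // z l = μ}))
      (fun k l hkl => Subtype.ext (hιinj (by simpa using hkl)))
    exact h1.map' (WithLp.linearEquiv 2 ℂ (Fin r → ℂ)).toLinearMap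
      (LinearEquiv.ker _)
  refine ⟨?_, ?_, ?_⟩
  · rw [← isUnit_iff_isUnit_det, ← linearIndependent_cols_iff_isUnit]
    exact hli
  · rw [smallRoots, det_diagonal, isUnit_iff_ne_zero, Finset.prod_ne_zero_iff]
    exact fun k _ => ne_zero_of_mem_roots hA (hroot _)
  · ext i k
    have h1 := congrFun (heig k) i
    rw [smallRoots, mul_diagonal, mul_apply]
    simpa [mulVec, dotProduct, smallVectors, mul_comm] using h1

/-- Both formulas for the Stieltjes transforms in terms of the small roots and their vectors. -/
theorem formulas_of_smallVectors {V D Fx : Matrix (Fin r) (Fin r) ℂ} (hA : IsUnit A.det)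
    (hF : (x • (1 : Matrix (Fin r) (Fin r) ℂ) - B - Aᴴ * F * A) * F = 1)
    (hFx : (x • (1 : Matrix (Fin r) (Fin r) ℂ) - B - (2 : ℂ) • (Aᴴ * F * A)) * Fx = 1)
    (hV : IsUnit V.det) (hD : IsUnit D.det) (hVD : F * A * V = V * D) :
    F = V * D * V⁻¹ * A⁻¹ ∧ IsUnit (A * V * D⁻¹ - Aᴴ * V * D).det ∧
      Fx = V * (A * V * D⁻¹ - Aᴴ * V * D)⁻¹ := by
  have h1 : F = V * D * V⁻¹ * A⁻¹ := by
    rw [← hVD, mul_nonsing_inv_cancel_right _ _ hV, mul_nonsing_inv_cancel_right _ _ hA]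
  set K := x • (1 : Matrix (Fin r) (Fin r) ℂ) - B - Aᴴ * F * A with hK
  set L := x • (1 : Matrix (Fin r) (Fin r) ℂ) - B - (2 : ℂ) • (Aᴴ * F * A) with hL
  -- `K V D = K F A V = A V`. The denominator for `X` differs from `K` only by another `Aᴴ F A`, and
  -- `Aᴴ F A V = Aᴴ V D`.
  have h2 : K * V = A * V * D⁻¹ := by
    have : K * V * D = A * V := by
      rw [mul_assoc, ← hVD, ← mul_assoc, ← mul_assoc, hF, one_mul]
    rw [← this, mul_nonsing_inv_cancel_right _ _ hD]
  have h3 : L * V = A * V * D⁻¹ - Aᴴ * V * D := by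
    have h4 : L = K - Aᴴ * F * A := by rw [hL, hK]; module
    rw [h4, sub_mul, h2]
    congr 1
    rw [mul_assoc, mul_assoc, ← mul_assoc F, hVD, mul_assoc]
  have hLu : IsUnit L.det := by
    have := congrArg det hFx
    rw [det_mul, det_one] at this
    exact IsUnit.of_mul_eq_one _ this
  refine ⟨h1, ?_, ?_⟩
  · rw [← h3, det_mul]
    exact hLu.mul hV
  · rw [← h3, Matrix.mul_inv_rev, ← mul_assoc, mul_nonsing_inv _ hV, one_mul]
    exact (inv_eq_right_inv hFx).symm

end MatrixChebyshev

/-! ### Fourier symbol and lower bounds off the bands -/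

namespace MatrixChebyshev

section DiscreteFourier

theorem sum_conj_pow_mul_pow {ζ : ℂ} {L : ℕ} (hζ : IsPrimitiveRoot ζ L) (hL : 0 < L) {n m : ℕ}
    (hn : n < L) (hm : m < L) :
    ∑ j ∈ Finset.range L, star ((ζ ^ j) ^ n) * (ζ ^ j) ^ m = if n = m then (L : ℂ) else 0 := by
  have hnorm : ‖ζ‖ = 1 := hζ.norm'_eq_one hL.ne'
  have hζ0 : ζ ≠ 0 := by
    intro h
    rw [h, norm_zero] at hnorm
    exact zero_ne_one hnorm
  have hstar : star ζ = ζ⁻¹ := (Complex.inv_eq_conj hnorm).symm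
  have h1 : ∀ j, star ((ζ ^ j) ^ n) * (ζ ^ j) ^ m = ((ζ ^ n)⁻¹ * ζ ^ m) ^ j := by
    intro j
    rw [star_pow, star_pow, hstar, mul_pow, inv_pow, inv_pow, inv_pow, ← pow_mul, ← pow_mul,
      ← pow_mul, ← pow_mul, mul_comm n, mul_comm m]
  simp only [h1]
  split_ifs with h
  · rw [h, inv_mul_cancel₀ (pow_ne_zero _ hζ0)]
    simp
  · have hq : (ζ ^ n)⁻¹ * ζ ^ m ≠ 1 := by
      intro hq
      have : ζ ^ n = ζ ^ m := by
        rw [inv_mul_eq_one₀ (pow_ne_zero _ hζ0)] at hq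
        exact hq
      exact h (hζ.pow_inj hn hm this)
    rw [geom_sum_eq hq]
    have : ((ζ ^ n)⁻¹ * ζ ^ m) ^ L = 1 := by
      rw [mul_pow, inv_pow, ← pow_mul, ← pow_mul, mul_comm n, mul_comm m, pow_mul, pow_mul,
        hζ.pow_eq_one]
      simp
    rw [this]
    simp

/-- Parseval's identity for the discrete Fourier transform of vectors. -/
theorem sum_norm_sq_discreteFourier {E : Type*} [NormedAddCommGroup E] [InnerProductSpace ℂ E]
    {ζ : ℂ} {L : ℕ} (hζ : IsPrimitiveRoot ζ L) (hL : 0 < L) (u : ℕ → E) :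
    ∑ j ∈ Finset.range L, ‖∑ n ∈ Finset.range L, (ζ ^ j) ^ n • u n‖ ^ 2 =
      L * ∑ n ∈ Finset.range L, ‖u n‖ ^ 2 := by
  have key : ∑ j ∈ Finset.range L, (inner ℂ (∑ n ∈ Finset.range L, (ζ ^ j) ^ n • u n)
      (∑ n ∈ Finset.range L, (ζ ^ j) ^ n • u n) : ℂ) =
      L * ∑ n ∈ Finset.range L, (inner ℂ (u n) (u n) : ℂ) := by
    simp only [sum_inner, inner_sum, inner_smul_left, inner_smul_right, Finset.mul_sum]
    rw [Finset.sum_comm]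
    refine Finset.sum_congr rfl fun n hn => ?_
    rw [Finset.sum_comm]
    have h1 : ∀ m, ∑ j ∈ Finset.range L, (ζ ^ j) ^ n *
        ((starRingEnd ℂ) ((ζ ^ j) ^ m) * inner ℂ (u m) (u n)) =
        (∑ j ∈ Finset.range L, star ((ζ ^ j) ^ m) * (ζ ^ j) ^ n) * inner ℂ (u m) (u n) := by
      intro m
      rw [Finset.sum_mul]
      refine Finset.sum_congr rfl fun j _ => ?_
      rw [← mul_assoc, mul_comm ((ζ ^ j) ^ n)]
      rfl
    simp only [h1]
    rw [Finset.sum_eq_single n]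
    · rw [sum_conj_pow_mul_pow hζ hL (Finset.mem_range.1 hn) (Finset.mem_range.1 hn), if_pos rfl]
    · intro m hm hmn
      rw [sum_conj_pow_mul_pow hζ hL (Finset.mem_range.1 hm) (Finset.mem_range.1 hn), if_neg hmn,
        zero_mul]
    · intro h
      exact absurd hn h
  have h2 : ∀ v : E, (inner ℂ v v : ℂ) = ((‖v‖ ^ 2 : ℝ) : ℂ) := by
    intro v
    rw [inner_self_eq_norm_sq_to_K]
    norm_cast
  simp only [h2] at key
  exact_mod_cast key

end DiscreteFourier

variable {r : ℕ}

/-- The set of real `t` that are eigenvalues of `z Aᴴ + B + z⁻¹ A` for some `z` of modulus one. -/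
def bandSet (A B : Matrix (Fin r) (Fin r) ℂ) : Set ℝ :=
  {t | ∃ z : Circle, (pencil A B z t).det = 0}

theorem continuous_pencil {X : Type*} [TopologicalSpace X] (A B : Matrix (Fin r) (Fin r) ℂ)
    {f : X → Circle} {g : X → ℂ} (hf : Continuous f) (hg : Continuous g) :
    Continuous fun p => pencil A B (f p : ℂ) (g p) := by
  have h' : Continuous fun p => (f p : ℂ) := continuous_subtype_val.comp hf
  have h : Continuous fun p => ((f p : ℂ))⁻¹ := h'.inv₀ fun p => (f p).coe_ne_zero
  unfold pencil
  exact (((h'.smul continuous_const).add continuous_const).add (h.smul continuous_const)).sub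
    (hg.smul continuous_const)

/-- The circle is compact, so projecting the closed zero set along it gives a closed set. -/
theorem isClosed_bandSet (A B : Matrix (Fin r) (Fin r) ℂ) : IsClosed (bandSet A B) := by
  have hc : Continuous fun p : Circle × ℝ => pencil A B (p.1 : ℂ) (p.2 : ℂ) :=
    continuous_pencil A B continuous_fst (Complex.continuous_ofReal.comp continuous_snd)
  have h1 : IsClosed {p : Circle × ℝ | (pencil A B p.1 (p.2 : ℂ)).det = 0} :=
    isClosed_eq hc.matrix_det continuous_const
  have h2 : bandSet A B = Prod.snd '' {p : Circle × ℝ | (pencil A B p.1 (p.2 : ℂ)).det = 0} := by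
    ext t
    constructor
    · rintro ⟨z, hz⟩
      exact ⟨(z, t), hz, rfl⟩
    · rintro ⟨p, hp, rfl⟩
      exact ⟨p.1, hp⟩
  rw [h2]
  exact isClosedMap_snd_of_compactSpace _ h1

theorem isHermitian_pencil {A B : Matrix (Fin r) (Fin r) ℂ} (hB : B.IsHermitian) (z : Circle)
    (t : ℝ) : (pencil A B z t).IsHermitian := by
  have hz : star (z : ℂ) = (z : ℂ)⁻¹ := (Complex.inv_eq_conj z.norm_coe).symm
  have hz' : star ((z : ℂ)⁻¹) = (z : ℂ) := by rw [← hz, star_star]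
  have ht : star (t : ℂ) = t := Complex.conj_ofReal t
  rw [IsHermitian, pencil, conjTranspose_sub, conjTranspose_add, conjTranspose_add,
    conjTranspose_smul, conjTranspose_smul, conjTranspose_smul, conjTranspose_conjTranspose,
    conjTranspose_one, hB.eq, hz, hz', ht]
  abel

theorem pencil_sub_smul (A B : Matrix (Fin r) (Fin r) ℂ) (z x y : ℂ) :
    pencil A B z x - y • (1 : Matrix (Fin r) (Fin r) ℂ) = pencil A B z (x + y) := by
  unfold pencil
  module

theorem inner_eigenvectorBasis_euclOp {N : Matrix (Fin r) (Fin r) ℂ} (hN : N.IsHermitian)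
    (i : Fin r) (v : EuclideanSpace ℂ (Fin r)) :
    inner ℂ (hN.eigenvectorBasis i) (euclOp N v) =
      (hN.eigenvalues i : ℂ) * inner ℂ (hN.eigenvectorBasis i) v := by
  have h1 : euclOp N (hN.eigenvectorBasis i) = (hN.eigenvalues i : ℂ) • hN.eigenvectorBasis i := by
    have := hN.mulVec_eigenvectorBasis i
    ext k
    have := congrFun this k
    simpa using this
  have h2 := inner_euclOp_left N (hN.eigenvectorBasis i) v
  rw [h1, inner_smul_left, Complex.conj_ofReal] at h2
  have h3 : euclOp Nᴴ v = euclOp N v := by rw [hN.eq]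
  rw [h2, h3]

theorem exists_eigenvalue_eq {N : Matrix (Fin r) (Fin r) ℂ} (hN : N.IsHermitian) {t : ℝ}
    (ht : (N - (t : ℂ) • (1 : Matrix (Fin r) (Fin r) ℂ)).det = 0) : ∃ i, hN.eigenvalues i = t := by
  obtain ⟨w, hw, hw0⟩ := exists_mulVec_eq_zero_iff.2 ht
  set v : EuclideanSpace ℂ (Fin r) := WithLp.toLp 2 w with hv
  have hv0 : v ≠ 0 := by
    intro h
    exact hw (by simpa [hv] using congrArg WithLp.ofLp h)
  have h1 : euclOp N v = (t : ℂ) • v := by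
    rw [sub_mulVec, smul_mulVec, one_mulVec, sub_eq_zero] at hw0
    ext k
    have := congrFun hw0 k
    simpa using this
  by_contra hcon
  push Not at hcon
  refine hv0 (hN.eigenvectorBasis.repr.injective (PiLp.ext fun i => ?_))
  rw [OrthonormalBasis.repr_apply_apply, map_zero, PiLp.zero_apply]
  have h2 := inner_eigenvectorBasis_euclOp hN i v
  rw [h1, inner_smul_right] at h2
  have h3 : ((hN.eigenvalues i : ℂ) - t) * inner ℂ (hN.eigenvectorBasis i) v = 0 := by
    rw [sub_mul, ← h2, sub_self]
  refine (mul_eq_zero.1 h3).resolve_left ?_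
  rw [sub_eq_zero]
  exact_mod_cast hcon i

theorem det_sub_eigenvalue {N : Matrix (Fin r) (Fin r) ℂ} (hN : N.IsHermitian) (i : Fin r) :
    (N - (hN.eigenvalues i : ℂ) • (1 : Matrix (Fin r) (Fin r) ℂ)).det = 0 := by
  refine exists_mulVec_eq_zero_iff.1 ⟨(hN.eigenvectorBasis i).ofLp, ?_, ?_⟩
  · intro h
    refine hN.eigenvectorBasis.orthonormal.ne_zero i ?_
    ext k
    simpa using congrFun h k
  · rw [sub_mulVec, smul_mulVec, one_mulVec, sub_eq_zero, hN.mulVec_eigenvectorBasis i]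
    rfl

/-- An eigenvalue of modulus below `h` of the symbol shifted by `c` would be a band point within `h`
of `c`. The bound follows in an orthonormal eigenbasis. -/
theorem le_norm_pencil {A B : Matrix (Fin r) (Fin r) ℂ} (hB : B.IsHermitian) {c h : ℝ} (hh : 0 ≤ h)
    (hc : ∀ t, |t - c| ≤ h → t ∉ bandSet A B) (z : Circle) (v : EuclideanSpace ℂ (Fin r)) :
    h * ‖v‖ ≤ ‖euclOp (pencil A B z c) v‖ := by
  have hN := isHermitian_pencil (A := A) hB z c
  have hev : ∀ i, h ≤ |hN.eigenvalues i| := by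
    intro i
    by_contra hlt
    have h1 := det_sub_eigenvalue hN i
    rw [pencil_sub_smul] at h1
    refine hc (c + hN.eigenvalues i) ?_ ⟨z, ?_⟩
    · rw [add_sub_cancel_left]
      exact (not_le.1 hlt).le
    · rw [Complex.ofReal_add]; exact h1
  rw [← sq_le_sq₀ (by positivity) (norm_nonneg _), mul_pow,
    ← hN.eigenvectorBasis.sum_sq_norm_inner_right v,
    ← hN.eigenvectorBasis.sum_sq_norm_inner_right (euclOp (pencil A B z c) v), Finset.mul_sum]
  refine Finset.sum_le_sum fun i _ => ?_
  rw [inner_eigenvectorBasis_euclOp, norm_mul, mul_pow, Complex.norm_real, Real.norm_eq_abs]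
  exact mul_le_mul_of_nonneg_right (pow_le_pow_left₀ hh (hev i) 2) (by positivity)

/-- The Fourier symbol of the block Jacobi operator. -/
theorem sum_smul_jacobiOp_sub {c₁ : ℂ} {A B : Matrix (Fin r) (Fin r) ℂ} {c : ℝ} {u : SeqSpace r}
    {N : ℕ} (hu0 : u 0 = 0) (hu1 : u 1 = 0) (huN : ∀ n, N < n → u n = 0) {w : ℂ} (hw : w ≠ 0) :
    ∑ n ∈ Finset.range (N + 2), w ^ n • (jacobiOp c₁ A B u - (c : ℂ) • u) n =
      euclOp (pencil A B w⁻¹ c) (∑ n ∈ Finset.range (N + 2), w ^ n • u n) := by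
  have hcoord : ∀ n, (jacobiOp c₁ A B u - (c : ℂ) • u) n =
      jacobiOp c₁ A B u n - (c : ℂ) • u n := fun n => rfl
  -- The block `c₁ Aᴴ` acts only on `u 1`, and its adjoint only on `u 0`. Both vanish, so every row
  -- may be written with the constant blocks.
  have h0 : (jacobiOp c₁ A B u - (c : ℂ) • u) 0 = euclOp Aᴴ (u 1) := by
    rw [hcoord, jacobiOp_zero, hu0, hu1]; simp
  have hs : ∀ n, (jacobiOp c₁ A B u - (c : ℂ) • u) (n + 1) =
      euclOp Aᴴ (u (n + 2)) + euclOp B (u (n + 1)) - (c : ℂ) • u (n + 1) + euclOp A (u n) := by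
    intro n
    rw [hcoord, jacobiOp_succ]
    rcases Nat.eq_zero_or_pos n with rfl | hn
    · simp [hu0, scaledCoeff]
      abel
    · simp only [scaledCoeff, hn.ne', if_false, Nat.add_eq_zero_iff, one_ne_zero, and_false,
        conjTranspose_conjTranspose]
      abel
  set S : EuclideanSpace ℂ (Fin r) := ∑ n ∈ Finset.range (N + 2), w ^ n • u n with hS
  have hS1 : S = ∑ n ∈ Finset.range (N + 1), w ^ (n + 1) • u (n + 1) := by
    rw [hS, Finset.sum_range_succ', hu0]; simp
  have hS2 : S = ∑ n ∈ Finset.range (N + 1), w ^ n • u n := by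
    rw [hS, Finset.sum_range_succ, huN (N + 1) (by omega)]; simp
  have hS3 : S = ∑ n ∈ Finset.range (N + 2), w ^ (n + 1) • u (n + 1) := by
    rw [Finset.sum_range_succ, huN (N + 2) (by omega), ← hS1]; simp
  have hup : euclOp Aᴴ (u 1) + ∑ n ∈ Finset.range (N + 1), w ^ (n + 1) • euclOp Aᴴ (u (n + 2)) =
      w⁻¹ • euclOp Aᴴ S := by
    nth_rewrite 1 [hS3]
    rw [map_sum, Finset.smul_sum, Finset.sum_range_succ' _ (N + 1), add_comm]
    refine congrArg₂ (· + ·) ?_ ?_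
    · refine Finset.sum_congr rfl fun n _ => ?_
      rw [map_smul, smul_smul]
      congr 1
      field_simp
      exact (pow_succ _ _).symm
    · rw [map_smul, smul_smul]; simp [hw]
  have hdn : ∑ n ∈ Finset.range (N + 1), w ^ (n + 1) • euclOp A (u n) = w • euclOp A S := by
    rw [hS2, map_sum, Finset.smul_sum]
    refine Finset.sum_congr rfl fun n _ => ?_
    rw [map_smul, smul_smul, pow_succ']
  have hmid : ∑ n ∈ Finset.range (N + 1), w ^ (n + 1) • (euclOp B (u (n + 1)) -
      (c : ℂ) • u (n + 1)) = euclOp B S - (c : ℂ) • S := by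
    rw [hS1, map_sum, Finset.smul_sum]
    refine Eq.trans (Finset.sum_congr rfl fun n _ => ?_) (Finset.sum_sub_distrib _ _)
    rw [map_smul]
    module
  rw [Finset.sum_range_succ', h0, pow_zero, one_smul]
  have hsplit : ∀ n, w ^ (n + 1) • (jacobiOp c₁ A B u - (c : ℂ) • u) (n + 1) =
      w ^ (n + 1) • euclOp Aᴴ (u (n + 2)) + w ^ (n + 1) • (euclOp B (u (n + 1)) -
      (c : ℂ) • u (n + 1)) + w ^ (n + 1) • euclOp A (u n) := by
    intro n
    rw [hs]
    module
  rw [Finset.sum_congr rfl fun n _ => hsplit n, Finset.sum_add_distrib, Finset.sum_add_distrib,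
    hdn, hmid]
  have hR : euclOp (pencil A B w⁻¹ c) S =
      w⁻¹ • euclOp Aᴴ S + euclOp B S + w • euclOp A S - (c : ℂ) • S := by
    unfold pencil
    simp only [euclOp, map_sub, map_add, map_smul, map_one, inv_inv]
    rfl
  rw [hR, ← hup]
  abel

theorem norm_sq_eq_sum_of_eq_zero {u : SeqSpace r} {L : ℕ} (hu : ∀ n, L ≤ n → u n = 0) :
    ‖u‖ ^ 2 = ∑ n ∈ Finset.range L, ‖u n‖ ^ 2 := by
  rw [norm_sq_eq_tsum]
  refine tsum_eq_sum fun n hn => ?_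
  rw [hu n (by simpa using hn)]
  simp

/-- The discrete Fourier transform turns the operator into multiplication by the symbol at roots of
unity; apply the pointwise bound and Parseval on both sides. -/
theorem le_norm_jacobiOp_sub_of_finite {c₁ : ℂ} {A B : Matrix (Fin r) (Fin r) ℂ}
    (hB : B.IsHermitian) {c h : ℝ} (hh : 0 ≤ h) (hc : ∀ t, |t - c| ≤ h → t ∉ bandSet A B)
    {u : SeqSpace r} {N : ℕ} (hu0 : u 0 = 0) (hu1 : u 1 = 0) (huN : ∀ n, N < n → u n = 0) :
    h * ‖u‖ ≤ ‖jacobiOp c₁ A B u - (c : ℂ) • u‖ := by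
  -- `J u` is supported in `0, …, N + 1`, so `N + 2` frequencies avoid wrap-around.
  set L := N + 2 with hL
  have hL0 : 0 < L := by omega
  set ζ := Complex.exp (2 * Real.pi * Complex.I / L)
  have hζ : IsPrimitiveRoot ζ L := Complex.isPrimitiveRoot_exp L hL0.ne'
  have hnorm : ‖ζ‖ = 1 := hζ.norm'_eq_one hL0.ne'
  set y := jacobiOp c₁ A B u - (c : ℂ) • u with hy
  have hyL : ∀ n, L ≤ n → y n = 0 := by
    intro n hn
    have : y n = jacobiOp c₁ A B u n - (c : ℂ) • u n := rfl
    rw [this, jacobiOp_eq_zero c₁ A B u N huN n (by omega), huN n (by omega)]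
    simp
  have hLR : (0 : ℝ) < L := by exact_mod_cast hL0
  rw [← sq_le_sq₀ (by positivity) (norm_nonneg _), mul_pow,
    norm_sq_eq_sum_of_eq_zero (L := L) (fun n hn => huN n (by omega)),
    norm_sq_eq_sum_of_eq_zero hyL]
  refine le_of_mul_le_mul_left ?_ hLR
  rw [← mul_assoc, mul_comm (L : ℝ), mul_assoc, ← sum_norm_sq_discreteFourier hζ hL0,
    ← sum_norm_sq_discreteFourier hζ hL0, Finset.mul_sum]
  refine Finset.sum_le_sum fun j _ => ?_
  have hw : ‖ζ ^ j‖ = 1 := by rw [norm_pow, hnorm, one_pow]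
  have hw0 : ζ ^ j ≠ 0 := by
    intro h0
    rw [h0, norm_zero] at hw
    exact zero_ne_one hw
  rw [← mul_pow, sum_smul_jacobiOp_sub hu0 hu1 huN hw0]
  refine pow_le_pow_left₀ (by positivity) ?_ 2
  exact le_norm_pencil hB hh hc ⟨(ζ ^ j)⁻¹, by simp [Submonoid.unitSphere, hw]⟩ _

/-- Truncations converge to `u` and keep the first two blocks zero, so the finite case passes to the
limit. -/
theorem le_norm_jacobiOp_sub {c₁ : ℂ} {A B : Matrix (Fin r) (Fin r) ℂ}
    (hB : B.IsHermitian) {c h : ℝ} (hh : 0 ≤ h) (hc : ∀ t, |t - c| ≤ h → t ∉ bandSet A B)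
    {u : SeqSpace r} (hu0 : u 0 = 0) (hu1 : u 1 = 0) :
    h * ‖u‖ ≤ ‖jacobiOp c₁ A B u - (c : ℂ) • u‖ := by
  set T : ℕ → SeqSpace r := fun N => ∑ n ∈ Finset.range N, seqSingle n (u n) with hT
  have hTn : ∀ N n, T N n = if n < N then u n else 0 := by
    intro N n
    rw [hT]
    simp only
    rw [lp.coeFn_sum, Finset.sum_apply]
    by_cases hn : n < N
    · rw [if_pos hn, Finset.sum_eq_single n]
      · simp [seqSingle]
      · intro m _ hm
        simp [seqSingle, lp.single_apply, hm.symm]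
      · simp [hn]
    · rw [if_neg hn]
      refine Finset.sum_eq_zero fun m hm => ?_
      have : n ≠ m := by
        have := Finset.mem_range.1 hm
        omega
      simp [seqSingle, lp.single_apply, this]
  have hlim : Filter.Tendsto T Filter.atTop (nhds u) :=
    (lp.hasSum_single (p := 2) (by norm_num) u).tendsto_sum_nat
  have h1 : ∀ N, h * ‖T N‖ ≤ ‖jacobiOp c₁ A B (T N) - (c : ℂ) • T N‖ := by
    intro N
    refine le_norm_jacobiOp_sub_of_finite (N := N) hB hh hc ?_ ?_ ?_
    · rw [hTn, hu0]; simp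
    · rw [hTn, hu1]; simp
    · intro n hn
      rw [hTn, if_neg (by omega)]
  refine le_of_tendsto_of_tendsto' (hlim.norm.const_mul h) ?_ h1
  exact ((((jacobiOp c₁ A B).continuous.tendsto u).comp hlim).sub (hlim.const_smul (c : ℂ))).norm

end MatrixChebyshev

/-! ### Finitely many spectral points off the bands -/

namespace MatrixChebyshev

section Bumps

/-- A tent function of width `ε` at `t`. -/
noncomputable def tent (ε t x : ℝ) : ℝ := max 0 (1 - |x - t| / ε)

theorem continuous_tent (ε t : ℝ) : Continuous (tent ε t) := by
  unfold tent; fun_prop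

theorem tent_self (ε t : ℝ) : tent ε t t = 1 := by simp [tent]

theorem abs_sub_lt_of_tent_ne_zero {ε t x : ℝ} (hε : 0 < ε) (h : tent ε t x ≠ 0) :
    |x - t| < ε := by
  by_contra hge
  refine h (max_eq_left ?_)
  have := (one_le_div hε).2 (not_lt.1 hge)
  linarith

end Bumps

/-- If a self-adjoint operator satisfies a spectral gap inequality on the kernel of a linear map to
a space of dimension `d`, there are at most `d` points of the spectrum in the gap. -/
theorem card_le_of_gap {H W : Type*} [NormedAddCommGroup H] [InnerProductSpace ℂ H]
    [CompleteSpace H] [AddCommGroup W] [Module ℂ W] [FiniteDimensional ℂ W] {J : H →L[ℂ] H}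
    (hJ : IsSelfAdjoint J) (Φ : H →ₗ[ℂ] W) {c h h' : ℝ} (hh' : h' < h)
    (hgap : ∀ u, Φ u = 0 → h * ‖u‖ ≤ ‖J u - (c : ℂ) • u‖) {T : Finset ℝ}
    (hT : ∀ t ∈ T, t ∈ spectrum ℝ J) (hTc : ∀ t ∈ T, |t - c| < h') :
    T.card ≤ Module.finrank ℂ W := by
  classical
  by_contra hcard
  -- `ε` is so small that the tents around the points of `T` are disjointly supported and stay
  -- within `h'` of `c`.
  obtain ⟨ε, hε, hεsep, hεc⟩ : ∃ ε > 0, (∀ t ∈ T, ∀ s ∈ T, t ≠ s → 2 * ε ≤ |t - s|) ∧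
      ∀ t ∈ T, |t - c| + ε ≤ h' := by
    have h1 : ∀ᶠ ε in nhdsWithin (0 : ℝ) (Set.Ioi 0), ∀ t ∈ T, ∀ s ∈ T, t ≠ s →
        2 * ε ≤ |t - s| := by
      rw [Filter.eventually_all_finset]
      intro t _
      rw [Filter.eventually_all_finset]
      intro s _
      by_cases hts : t = s
      · simp [hts]
      · have h0 : 0 < |t - s| / 2 := by
          have := abs_pos.2 (sub_ne_zero.2 hts); linarith
        filter_upwards [Ioo_mem_nhdsGT h0] with ε hε _
        linarith [hε.2]
    have h2 : ∀ᶠ ε in nhdsWithin (0 : ℝ) (Set.Ioi 0), ∀ t ∈ T, |t - c| + ε ≤ h' := by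
      rw [Filter.eventually_all_finset]
      intro t ht
      have h0 : 0 < h' - |t - c| := sub_pos.2 (hTc t ht)
      filter_upwards [Ioo_mem_nhdsGT h0] with ε hε
      linarith [hε.2]
    obtain ⟨ε, ⟨h3, h4⟩, h5⟩ := ((h1.and h2).and self_mem_nhdsWithin).exists
    exact ⟨ε, h5, h3, h4⟩
  -- The tent equals one at a spectral point, so its operator is nonzero. Disjoint supports will
  -- make the chosen vectors orthogonal.
  have hex : ∀ t : T, ∃ w : H, cfc (tent ε t) J w ≠ 0 := by
    intro t
    by_contra hcon
    push Not at hcon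
    have h0 : cfc (tent ε t) J = 0 := by ext w; exact hcon w
    have h1 := norm_apply_le_norm_cfc (tent ε t) J (hT t t.2) (continuous_tent ε t).continuousOn
    rw [h0, norm_zero, tent_self] at h1
    norm_num at h1
  choose w hw using hex
  set u : T → H := fun t => cfc (tent ε t) J (w t) with hu
  have horth : ∀ t s : T, t ≠ s → inner ℂ (u t) (u s) = 0 := by
    intro t s hts
    have hsa : IsSelfAdjoint (cfc (tent ε t) J) := cfc_predicate _ _
    have hsym := (ContinuousLinearMap.isSelfAdjoint_iff_isSymmetric.1 hsa) (w t) (u s)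
    simp only [ContinuousLinearMap.coe_coe] at hsym
    have h0 : cfc (tent ε t) J (u s) = 0 := by
      have h1 : cfc (tent ε t) J * cfc (tent ε s) J = 0 := by
        rw [← cfc_mul _ _ J (continuous_tent ε t).continuousOn (continuous_tent ε s).continuousOn]
        have : (fun x => tent ε t x * tent ε s x) = fun _ => 0 := by
          ext x
          by_contra hne
          have ha := abs_sub_lt_of_tent_ne_zero hε (left_ne_zero_of_mul hne)
          have hb := abs_sub_lt_of_tent_ne_zero hε (right_ne_zero_of_mul hne)
          have hc := hεsep t t.2 s s.2 (fun h => hts (Subtype.ext h))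
          have hd : |(t : ℝ) - s| ≤ |x - t| + |x - s| := by
            rw [abs_sub_comm x t]
            exact abs_sub_le _ _ _
          linarith
        rw [this, cfc_const_zero]
      exact congrArg (fun S : H →L[ℂ] H => S (w s)) h1
    rw [h0, inner_zero_right] at hsym
    exact hsym
  have hli : LinearIndependent ℂ u := linearIndependent_of_ne_zero_of_inner_eq_zero hw horth
  -- More than `finrank W` independent vectors have a nontrivial combination `y` in the kernel of
  -- `Φ`.
  set Ψ : (T → ℂ) →ₗ[ℂ] W := Φ ∘ₗ Fintype.linearCombination ℂ u with hΨ
  have hker : LinearMap.ker Ψ ≠ ⊥ := by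
    refine LinearMap.ker_ne_bot_of_finrank_lt ?_
    rw [Module.finrank_fintype_fun_eq_card, Fintype.card_coe]
    exact not_le.1 hcard
  obtain ⟨a, ha, ha0⟩ := Submodule.exists_mem_ne_zero_of_ne_bot hker
  set y : H := Fintype.linearCombination ℂ u a with hy
  have hy' : y = ∑ t, a t • u t := Fintype.linearCombination_apply ℂ u a
  have hy0 : y ≠ 0 := by
    intro h0
    rw [hy'] at h0
    exact ha0 (funext (Fintype.linearIndependent_iff.1 hli a h0))
  -- Clamping `x - c` to `[-h', h']` changes nothing on the tents, so `‖(J - c) y‖ ≤ h' ‖y‖`,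
  -- against the gap inequality with `h > h'`.
  set γ : ℝ → ℝ := fun x => max (-h') (min h' (x - c)) with hγ
  have hγc : Continuous γ := by fun_prop
  rcases T.eq_empty_or_nonempty with rfl | ⟨t₀, ht₀⟩
  · simp at hcard
  have hh'0 : 0 ≤ h' := (abs_nonneg _).trans (hTc t₀ ht₀).le
  have hγle : ∀ x, ‖γ x‖ ≤ h' := by
    intro x
    rw [Real.norm_eq_abs, abs_le]
    exact ⟨le_max_left _ _, max_le (by linarith) (min_le_left _ _)⟩
  have hγJ : ‖cfc γ J‖ ≤ h' := norm_cfc_le hh'0 fun x _ => hγle x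
  have hut : ∀ t, J (u t) - (c : ℂ) • u t = cfc γ J (u t) := by
    intro t
    have h1 : cfc (fun x : ℝ => x - c) J * cfc (tent ε t) J = cfc γ J * cfc (tent ε t) J := by
      rw [← cfc_mul _ _ J (by fun_prop) (continuous_tent ε t).continuousOn,
        ← cfc_mul _ _ J hγc.continuousOn (continuous_tent ε t).continuousOn]
      congr 1
      ext x
      by_cases hx : tent ε t x = 0
      · simp [hx]
      · have h2 := abs_sub_lt_of_tent_ne_zero hε hx
        have h3 := hεc t t.2
        have h4 : |x - c| ≤ h' := by
          have := abs_sub_le x t c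
          linarith
        rw [abs_le] at h4
        simp only [hγ]
        rw [min_eq_right h4.2, max_eq_right h4.1]
    have h5 : cfc (fun x : ℝ => x - c) J = J - (c : ℂ) • 1 := by
      rw [cfc_sub (fun x => x) (fun _ => c) J (by fun_prop) (by fun_prop), cfc_id' ℝ J,
        cfc_const c J, Algebra.algebraMap_eq_smul_one, Complex.coe_smul]
    rw [h5] at h1
    exact congrArg (fun S : H →L[ℂ] H => S (w t)) h1
  have hyJ : J y - (c : ℂ) • y = cfc γ J y := by
    rw [hy', map_sum, map_sum, Finset.smul_sum, ← Finset.sum_sub_distrib]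
    refine Finset.sum_congr rfl fun t _ => ?_
    rw [map_smul, map_smul, ← hut, smul_sub, smul_comm (c : ℂ)]
  have h1 := hgap y ha
  rw [hyJ] at h1
  have h2 := ((cfc γ J).le_opNorm y).trans (mul_le_mul_of_nonneg_right hγJ (norm_nonneg y))
  have h3 : 0 < ‖y‖ := norm_pos_iff.2 hy0
  have h4 := le_of_mul_le_mul_right (h1.trans h2) h3
  linarith

variable {r : ℕ}

/-- Compactness gives a margin `δ` around `[a, b]` still free of bands. The gap count is applied at
the midpoint, the constraint map recording the first two blocks, of total dimension `2r`. -/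
theorem card_le_of_disjoint_bandSet {c₁ : ℂ} {A B : Matrix (Fin r) (Fin r) ℂ}
    (hB : B.IsHermitian) {a b : ℝ} (hab : a ≤ b) (hgap : ∀ t ∈ Set.Icc a b, t ∉ bandSet A B)
    {T : Finset ℝ} (hT : ∀ t ∈ T, t ∈ spectrum ℝ (jacobiOp c₁ A B))
    (hTab : ∀ t ∈ T, t ∈ Set.Icc a b) : T.card ≤ r + r := by
  obtain ⟨δ, hδ, hδsub⟩ := (isCompact_Icc (a := a) (b := b)).exists_cthickening_subset_open
    (isClosed_bandSet A B).isOpen_compl hgap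
  set Φ : SeqSpace r →ₗ[ℂ] EuclideanSpace ℂ (Fin r) × EuclideanSpace ℂ (Fin r) :=
    { toFun := fun u => (u 0, u 1)
      map_add' := fun u v => rfl
      map_smul' := fun c u => rfl } with hΦ
  have h := card_le_of_gap (isSelfAdjoint_jacobiOp c₁ A hB) Φ (c := (a + b) / 2)
    (h := (b - a) / 2 + δ) (h' := (b - a) / 2 + δ / 2) (by linarith) ?_ hT ?_
  · simpa using h
  · intro u hu
    have hu' : (u 0, u 1) = 0 := hu
    rw [Prod.mk_eq_zero] at hu'
    refine le_norm_jacobiOp_sub hB (by linarith) ?_ hu'.1 hu'.2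
    intro t ht
    refine hδsub ?_
    rw [abs_le] at ht
    -- The witness is the point of `[a, b]` nearest to `t`.
    refine Metric.mem_cthickening_of_dist_le t (max a (min b t)) δ _
      ⟨le_max_left _ _, max_le hab (min_le_left _ _)⟩ ?_
    rw [Real.dist_eq, abs_le]
    rcases le_total t a with h1 | h1
    · rw [min_eq_right (h1.trans hab), max_eq_left h1]
      constructor <;> linarith
    · rcases le_total t b with h2 | h2
      · rw [min_eq_right h2, max_eq_right h1]
        constructor <;> linarith
      · rw [min_eq_left h2, max_eq_right hab]
        constructor <;> linarith
  · intro t ht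
    have := hTab t ht
    rw [abs_lt]
    constructor <;> linarith [this.1, this.2]

/-- The eigenvalues of the symbol. -/
noncomputable def symbolEigenvalue {A B : Matrix (Fin r) (Fin r) ℂ} (hB : B.IsHermitian)
    (z : Circle) : Fin r → ℝ := (isHermitian_pencil (A := A) hB z 0).eigenvalues

theorem mem_bandSet_iff {A B : Matrix (Fin r) (Fin r) ℂ} (hB : B.IsHermitian) (t : ℝ) :
    t ∈ bandSet A B ↔ ∃ z i, symbolEigenvalue (A := A) hB z i = t := by
  constructor
  · rintro ⟨z, hz⟩
    obtain ⟨i, hi⟩ := exists_eigenvalue_eq (isHermitian_pencil (A := A) hB z 0) (t := t) (by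
      rw [pencil_sub_smul]; simpa using hz)
    exact ⟨z, i, hi⟩
  · rintro ⟨z, i, rfl⟩
    have := det_sub_eigenvalue (isHermitian_pencil (A := A) hB z 0) i
    rw [pencil_sub_smul] at this
    exact ⟨z, by simpa [symbolEigenvalue] using this⟩

theorem trace_cfc {N : Matrix (Fin r) (Fin r) ℂ} (hN : N.IsHermitian) (f : ℝ → ℝ) :
    (cfc f N).trace = ((∑ i, f (hN.eigenvalues i) : ℝ) : ℂ) := by
  rw [hN.cfc_eq, IsHermitian.cfc, Unitary.conjStarAlgAut_apply, trace_mul_comm, ← mul_assoc]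
  simp

/-- The number of eigenvalues of the symbol below `g`. -/
noncomputable def countBelow {A B : Matrix (Fin r) (Fin r) ℂ} (hB : B.IsHermitian) (g : ℝ)
    (z : Circle) : ℕ := (Finset.univ.filter fun i => symbolEigenvalue (A := A) hB z i < g).card

-- The count is the trace of the spectral projection of the symbol onto `(-∞, g)`. The indicator is
-- continuous away from `g`, which is never an eigenvalue, so no continuous choice of eigenvalue
-- branches is needed.
open scoped Matrix.Norms.L2Operator in
theorem continuous_countBelow {A B : Matrix (Fin r) (Fin r) ℂ} (hB : B.IsHermitian) {g : ℝ}
    (hg : g ∉ bandSet A B) : Continuous (countBelow (A := A) hB g) := by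
  classical
  set f : ℝ → ℝ := (Set.Iio g).indicator 1 with hf
  have hfc : ContinuousOn f {g}ᶜ := by
    intro x hx
    refine ContinuousAt.continuousWithinAt ?_
    rcases lt_or_gt_of_ne (Set.mem_compl_singleton_iff.1 hx) with h | h
    · refine (continuousAt_const (y := (1 : ℝ))).congr ?_
      filter_upwards [Iio_mem_nhds h] with y hy
      simp only [hf, Set.indicator_of_mem hy, Pi.one_apply]
    · refine (continuousAt_const (y := (0 : ℝ))).congr ?_
      filter_upwards [Ioi_mem_nhds h] with y hy
      exact (Set.indicator_of_notMem (by simpa using (le_of_lt hy)) _).symm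
  have hN : Continuous fun z : Circle => pencil A B z ((0 : ℝ) : ℂ) :=
    continuous_pencil A B continuous_id continuous_const
  have hc : Continuous fun z : Circle => cfc f (pencil A B z ((0 : ℝ) : ℂ)) := by
    refine Continuous.cfc_of_mem_nhdsSet (s := {g}ᶜ) f ?_ hN
      (fun z => (isHermitian_pencil hB z 0).isSelfAdjoint) hfc
    refine isOpen_compl_singleton.mem_nhdsSet.2 ?_
    rw [Set.iUnion_subset_iff]
    intro z t ht
    rw [(isHermitian_pencil hB z 0).spectrum_real_eq_range_eigenvalues] at ht
    obtain ⟨i, rfl⟩ := ht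
    intro h
    exact hg (h ▸ (mem_bandSet_iff hB _).2 ⟨z, i, rfl⟩)
  have h1 : Continuous fun z => ((countBelow (A := A) hB g z : ℝ)) := by
    have h2 := Complex.continuous_re.comp hc.matrix_trace
    refine h2.congr fun z => ?_
    rw [Function.comp_apply, trace_cfc (isHermitian_pencil hB z 0), Complex.ofReal_re]
    simp only [hf, countBelow, symbolEigenvalue, Set.indicator_apply, Set.mem_Iio, Pi.one_apply,
      Finset.sum_boole]
    congr!
  exact Nat.isClosedEmbedding_coe_real.isEmbedding.continuous_iff.2 h1

/-- Off the bands the counts are continuous and integer valued on the connected circle, hence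
constant. An eigenvalue in `[a, b]` at some `z` would be counted below `b` but not below `a`. -/
theorem disjoint_bandSet_of_countBelow_eq {A B : Matrix (Fin r) (Fin r) ℂ} (hB : B.IsHermitian)
    {a b : ℝ} (hab : a ≤ b) (ha : a ∉ bandSet A B) (hb : b ∉ bandSet A B) {z₀ : Circle}
    (h : countBelow (A := A) hB a z₀ = countBelow (A := A) hB b z₀) :
    ∀ t ∈ Set.Icc a b, t ∉ bandSet A B := by
  intro t ht htband
  obtain ⟨z, i, hi⟩ := (mem_bandSet_iff hB t).1 htband
  have hconst : ∀ {g : ℝ}, g ∉ bandSet A B → countBelow (A := A) hB g z₀ =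
      countBelow (A := A) hB g z := fun hg =>
    PreconnectedSpace.constant inferInstance (continuous_countBelow hB hg)
  rw [hconst ha, hconst hb] at h
  have hsub : (Finset.univ.filter fun j => symbolEigenvalue (A := A) hB z j < a) ⊆
      Finset.univ.filter fun j => symbolEigenvalue (A := A) hB z j < b := by
    intro j hj
    rw [Finset.mem_filter] at hj ⊢
    exact ⟨hj.1, hj.2.trans_le hab⟩
  have heq := Finset.eq_of_subset_of_card_le hsub h.ge
  have htb : t ≠ b := fun h => hb (h ▸ htband)
  have hmem : i ∈ Finset.univ.filter fun j => symbolEigenvalue (A := A) hB z j < b := by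
    rw [Finset.mem_filter, hi]
    exact ⟨Finset.mem_univ _, lt_of_le_of_ne ht.2 htb⟩
  rw [← heq, Finset.mem_filter, hi] at hmem
  exact absurd hmem.2 (not_lt.2 ht.1)

/-- The count at `z = 1` takes at most `r + 1` values. Points with equal count have no band between
them, so each value accounts for at most `2r` spectral points. -/
theorem finite_spectrum_diff_bandSet (c₁ : ℂ) {A B : Matrix (Fin r) (Fin r) ℂ}
    (hB : B.IsHermitian) : (spectrum ℝ (jacobiOp c₁ A B) \ bandSet A B).Finite := by
  have hcover : spectrum ℝ (jacobiOp c₁ A B) \ bandSet A B ⊆ ⋃ m ∈ Finset.range (r + 1),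
      {t | t ∈ spectrum ℝ (jacobiOp c₁ A B) \ bandSet A B ∧ countBelow (A := A) hB t 1 = m} := by
    intro t ht
    rw [Set.mem_iUnion₂]
    refine ⟨countBelow (A := A) hB t 1, ?_, ht, rfl⟩
    rw [Finset.mem_range]
    have := Finset.card_filter_le Finset.univ fun i => symbolEigenvalue (A := A) hB 1 i < t
    rw [Finset.card_univ, Fintype.card_fin] at this
    exact Nat.lt_succ_of_le this
  refine Set.Finite.subset (Set.Finite.biUnion (Finset.finite_toSet _) fun m _ => ?_) hcover
  by_contra hinf
  obtain ⟨T, hT, hTcard⟩ := Set.Infinite.exists_subset_card_eq hinf (r + r + 1)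
  have hne : T.Nonempty := by
    rw [← Finset.card_pos]
    omega
  have hmin := hT (T.min'_mem hne)
  have hmax := hT (T.max'_mem hne)
  have hle := T.min'_le _ (T.max'_mem hne)
  have := card_le_of_disjoint_bandSet (c₁ := c₁) hB hle (disjoint_bandSet_of_countBelow_eq hB hle
    hmin.1.2 hmax.1.2 (hmin.2.trans hmax.2.symm)) (fun t ht => (hT ht).1.1)
    fun t ht => ⟨T.min'_le t ht, T.le_max' t ht⟩
  omega

end MatrixChebyshev

/-! ### Symmetry of the roots; bands lie in `gammaZero` -/

namespace MatrixChebyshev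

variable {r : ℕ} {A B : Matrix (Fin r) (Fin r) ℂ}

theorem exists_isRootOrdering (hA : IsUnit A.det) (B : Matrix (Fin r) (Fin r) ℂ) (x : ℂ) :
    ∃ z, IsRootOrdering A B x z := by
  have hlen : (algPoly A B x).roots.toList.length = 2 * r := by
    rw [Multiset.length_toList, card_roots_algPoly hA]
  set f : Fin (2 * r) → ℂ := fun k => (algPoly A B x).roots.toList.get (k.cast hlen.symm) with hf
  set σ := Tuple.sort fun k => ‖f k‖ with hσ
  refine ⟨f ∘ σ, ?_, Tuple.monotone_sort fun k => ‖f k‖⟩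
  have h1 : Multiset.map σ Finset.univ.val = Finset.univ.val := by
    simp
  rw [← Multiset.map_map, h1]
  have h2 : (Finset.univ.val.map f) = (List.ofFn f : Multiset ℂ) := by
    rw [Fin.univ_val_map]
  rw [h2]
  have h3 : List.ofFn f = (algPoly A B x).roots.toList := by
    refine List.ext_get (by simp [hlen]) fun n h₁ h₂ => ?_
    simp [hf]
  rw [h3, Multiset.coe_toList]

theorem conjTranspose_pencil (hB : B.IsHermitian) (z : ℂ) (t : ℝ) :
    (pencil A B z t)ᴴ = pencil A B (star z)⁻¹ t := by
  have ht : star (t : ℂ) = t := Complex.conj_ofReal t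
  rw [pencil, pencil, conjTranspose_sub, conjTranspose_add, conjTranspose_add,
    conjTranspose_smul, conjTranspose_smul, conjTranspose_smul, conjTranspose_conjTranspose,
    conjTranspose_one, hB.eq, ht, star_inv₀, inv_inv]
  abel

/-- For real `x`, the roots are symmetric with respect to the unit circle. -/
theorem map_roots_algPoly (hA : IsUnit A.det) (hB : B.IsHermitian) (t : ℝ) :
    (algPoly A B t).roots.map (fun z => (star z)⁻¹) = (algPoly A B t).roots := by
  set p := algPoly A B t with hp
  set R := p.roots with hR
  have hR0 : ∀ w ∈ R, w ≠ 0 := fun w hw => ne_zero_of_mem_roots hA hw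
  have hprod : p = Polynomial.C p.leadingCoeff *
      (R.map fun a => Polynomial.X - Polynomial.C a).prod :=
    (IsAlgClosed.splits p).eq_prod_roots
  have heval : ∀ z, p.eval z = p.leadingCoeff * (R.map fun a => z - a).prod := by
    intro z
    conv_lhs => rw [hprod]
    rw [Polynomial.eval_mul, Polynomial.eval_C, Polynomial.eval_multiset_prod, Multiset.map_map]
    simp
  -- Self-reciprocity: the conjugate transpose of the pencil at `z` is the pencil at `1 / conj z`.
  have hsymm : ∀ z : ℂ, z ≠ 0 → p.eval z = z ^ (2 * r) * star (p.eval (star z)⁻¹) := by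
    intro z hz
    have hz' : (star z)⁻¹ ≠ 0 := inv_ne_zero (star_ne_zero.2 hz)
    rw [hp, eval_algPoly A B hz, eval_algPoly A B hz', algFun, algFun, ← conjTranspose_pencil hB,
      det_conjTranspose, star_mul', star_star, star_pow, star_inv₀, star_star, two_mul, pow_add,
      inv_pow]
    field_simp
  -- The constant arises from `z (1/z - conj w) = -conj w (z - 1 / conj w)`, one factor for each of
  -- the `2r` roots `w`.
  set a' : ℂ := star p.leadingCoeff * (R.map fun w => -star w).prod with ha'
  have hq : p = Polynomial.C a' *
      ((R.map fun z => (star z)⁻¹).map fun a => Polynomial.X - Polynomial.C a).prod := by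
    refine Polynomial.eq_of_infinite_eval_eq _ _ ?_
    refine Set.Infinite.mono (s := {0}ᶜ) ?_ (Set.finite_singleton (0 : ℂ)).infinite_compl
    intro z hz
    have hz0 : z ≠ 0 := hz
    change p.eval z = _
    rw [hsymm z hz0, heval, Polynomial.eval_mul, Polynomial.eval_C, Polynomial.eval_multiset_prod,
      Multiset.map_map, Multiset.map_map, star_mul', ha', mul_assoc, mul_left_comm]
    congr 1
    have hstar : star (R.map fun a => (star z)⁻¹ - a).prod = (R.map fun a => z⁻¹ - star a).prod := by
      have := map_multiset_prod (starRingEnd ℂ) (R.map fun a => (star z)⁻¹ - a)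
      rw [Multiset.map_map] at this
      refine this.trans (congrArg Multiset.prod (Multiset.map_congr rfl fun w _ => ?_))
      simp
    have hpow : z ^ (2 * r) = (R.map fun _ => z).prod := by
      rw [Multiset.map_const', Multiset.prod_replicate, hR, hp, card_roots_algPoly hA]
    rw [hstar, hpow, ← Multiset.prod_map_mul, ← Multiset.prod_map_mul]
    refine congrArg Multiset.prod (Multiset.map_congr rfl fun w hw => ?_)
    have hw0 : star w ≠ 0 := star_ne_zero.2 (hR0 w hw)
    simp only [Function.comp_apply, Polynomial.eval_sub, Polynomial.eval_X, Polynomial.eval_C]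
    field_simp
    ring
  have ha0 : a' ≠ 0 := by
    intro h
    rw [h, Polynomial.C_0, zero_mul] at hq
    exact algPoly_ne_zero hA B t hq
  conv_rhs => rw [hR, hq]
  rw [Polynomial.roots_C_mul _ ha0, Polynomial.roots_multiset_prod_X_sub_C]

/-- By symmetry equally many roots lie inside and outside the circle. A root on it makes both
numbers less than `r`, which forces the two middle roots onto the circle. -/
theorem ofReal_mem_gammaZero (hr : 1 ≤ r) (hA : IsUnit A.det) (hB : B.IsHermitian) {t : ℝ}
    (ht : t ∈ bandSet A B) : (t : ℂ) ∈ gammaZero A B := by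
  classical
  obtain ⟨z, hz⟩ := exists_isRootOrdering hA B (t : ℂ)
  obtain ⟨w, hw⟩ := ht
  have hwR : (w : ℂ) ∈ (algPoly A B t).roots := by
    rw [Polynomial.mem_roots (algPoly_ne_zero hA B t), Polynomial.IsRoot,
      eval_algPoly A B w.coe_ne_zero, algFun, hw, mul_zero]
  rw [← hz.1, Multiset.mem_map] at hwR
  obtain ⟨k₀, -, hk₀⟩ := hwR
  have hk₀n : ‖z k₀‖ = 1 := by rw [hk₀]; exact w.norm_coe
  have hz0 : ∀ k, z k ≠ 0 := fun k => ne_zero_of_mem_roots hA (x := (t : ℂ)) (B := B) (by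
    rw [← hz.1]; exact Multiset.mem_map_of_mem z (Finset.mem_univ k))
  have hcount : (Finset.univ.filter fun k => ‖z k‖ < 1).card =
      (Finset.univ.filter fun k => 1 < ‖z k‖).card := by
    have h1 := congrArg (Multiset.countP fun a : ℂ => ‖a‖ < 1) (map_roots_algPoly hA hB t)
    rw [← hz.1, Multiset.map_map, Multiset.countP_map, Multiset.countP_map] at h1
    refine Eq.trans h1.symm ?_
    refine congrArg Finset.card (Finset.filter_congr (s := Finset.univ)
      (p := fun k => ‖((fun a => (star a)⁻¹) ∘ z) k‖ < 1) fun k _ => ?_)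
    have : 0 < ‖z k‖ := norm_pos_iff.2 (hz0 k)
    simp only [Function.comp_apply, norm_inv, norm_star]
    exact inv_lt_one₀ this
  have hsum : (Finset.univ.filter fun k => ‖z k‖ < 1).card +
      (Finset.univ.filter fun k => 1 < ‖z k‖).card < 2 * r := by
    rw [← Finset.card_union_of_disjoint]
    · conv_rhs => rw [← Fintype.card_fin (2 * r), ← Finset.card_univ]
      refine Finset.card_lt_card ((Finset.ssubset_univ_iff).2 fun h => ?_)
      have := h ▸ Finset.mem_univ k₀
      simp [hk₀n] at this
    · rw [Finset.disjoint_filter]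
      intro k _ h
      exact not_lt.2 h.le
  refine ⟨z, hz, ⟨r - 1, by omega⟩, ⟨r, by omega⟩, by simp; omega, rfl, ?_⟩
  have hge : 1 ≤ ‖z ⟨r - 1, by omega⟩‖ := by
    by_contra hlt
    have hsub : Finset.Iic (⟨r - 1, by omega⟩ : Fin (2 * r)) ⊆
        Finset.univ.filter fun k => ‖z k‖ < 1 := by
      intro k hk
      rw [Finset.mem_filter]
      exact ⟨Finset.mem_univ _, (hz.2 (Finset.mem_Iic.1 hk)).trans_lt (not_le.1 hlt)⟩
    have := Finset.card_le_card hsub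
    rw [Fin.card_Iic] at this
    simp only at this
    omega
  have hle : ‖z ⟨r, by omega⟩‖ ≤ 1 := by
    by_contra hlt
    have hsub : Finset.Ici (⟨r, by omega⟩ : Fin (2 * r)) ⊆
        Finset.univ.filter fun k => 1 < ‖z k‖ := by
      intro k hk
      rw [Finset.mem_filter]
      exact ⟨Finset.mem_univ _, (not_le.1 hlt).trans_le (hz.2 (Finset.mem_Ici.1 hk))⟩
    have := Finset.card_le_card hsub
    rw [Fin.card_Ici] at this
    simp only at this
    omega
  exact le_antisymm (hz.2 (by simp)) (hle.trans hge)

end MatrixChebyshev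

/-! ### Generic multiplicities of bivariate polynomials -/

namespace MatrixChebyshev

section Bivariate

open Polynomial

theorem rootMultiplicity_pow_mul {b w : ℂ[X]} {t : ℂ} (hb : b.eval t = 0)
    (hb' : b.derivative.eval t ≠ 0) (hw : w.eval t ≠ 0) (m : ℕ) :
    (b ^ m * w).rootMultiplicity t = m := by
  have hb0 : b ≠ 0 := by
    rintro rfl
    simp at hb'
  have hw0 : w ≠ 0 := by
    rintro rfl
    simp at hw
  have h1 : b.rootMultiplicity t = 1 := by
    have h2 : 0 < b.rootMultiplicity t := (rootMultiplicity_pos hb0).2 hb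
    have h3 : ¬ 1 < b.rootMultiplicity t := fun h =>
      hb' ((one_lt_rootMultiplicity_iff_isRoot hb0).1 h).2
    omega
  rw [rootMultiplicity_mul (mul_ne_zero (pow_ne_zero m hb0) hw0), rootMultiplicity_eq_zero hw,
    ← count_roots, roots_pow, Multiset.count_nsmul, count_roots, h1]
  simp

/-- After normalization the quotient by `q` is a domain finite over `ℂ[X]`, so the nonzero class of
`g` divides the class of some nonzero `c` in `ℂ[X]`. Every common zero `(x, z)` then has `c(x) = 0`.
-/
theorem finite_common_zeros {q g : ℂ[X][X]} (hq : Prime q) (hlead : IsUnit q.leadingCoeff)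
    (hg : ¬ q ∣ g) : {x : ℂ | ∃ z, q.evalEval x z = 0 ∧ g.evalEval x z = 0}.Finite := by
  obtain ⟨u, hu⟩ := hlead
  have hunit : IsUnit (C (↑u⁻¹ : ℂ[X])) := (u⁻¹).isUnit.map C
  set q' : ℂ[X][X] := C (↑u⁻¹ : ℂ[X]) * q with hq'
  have hassoc : Associated q q' := (associated_unit_mul_left q _ hunit).symm
  have hmonic : q'.Monic := by
    rw [Monic, hq', leadingCoeff_mul, leadingCoeff_C, ← hu, Units.inv_mul]
  have hprime : Prime q' := hassoc.prime hq
  have := AdjoinRoot.isDomain_of_prime hprime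
  have := hmonic.finite_adjoinRoot
  have hne : AdjoinRoot.mk q' g ≠ 0 := by
    rw [Ne, AdjoinRoot.mk_eq_zero]
    exact fun h => hg ((hassoc.dvd_iff_dvd_left).2 h)
  have hbot := Ideal.comap_ne_bot_of_integral_mem (R := ℂ[X])
    (I := Ideal.span {AdjoinRoot.mk q' g}) hne (Ideal.mem_span_singleton_self _)
    (Algebra.IsIntegral.isIntegral _)
  obtain ⟨c, hc, hc0⟩ := Submodule.exists_mem_ne_zero_of_ne_bot hbot
  rw [Ideal.mem_comap, Ideal.mem_span_singleton, AdjoinRoot.algebraMap_eq] at hc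
  obtain ⟨h', hh'⟩ := hc
  obtain ⟨h, rfl⟩ := AdjoinRoot.mk_surjective h'
  rw [← AdjoinRoot.mk_C, ← map_mul, AdjoinRoot.mk_eq_mk] at hh'
  obtain ⟨k, hk⟩ := (hassoc.dvd_iff_dvd_left).2 hh'
  refine (Polynomial.finite_setOfPred_isRoot hc0).subset ?_
  rintro x ⟨z, hqz, hgz⟩
  have h1 := congrArg (evalEvalRingHom x z) hk
  simp only [map_sub, map_mul, coe_evalEvalRingHom, hqz, hgz, zero_mul, sub_zero, evalEval_C] at h1
  exact h1

/-- The derivative with respect to the inner variable. -/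
noncomputable def innerDerivative (q : ℂ[X][X]) : ℂ[X][X] :=
  ∑ n ∈ Finset.range (q.natDegree + 1), monomial n (derivative (q.coeff n))

theorem coeff_innerDerivative (q : ℂ[X][X]) (n : ℕ) :
    (innerDerivative q).coeff n = derivative (q.coeff n) := by
  rw [innerDerivative, finsetSum_coeff]
  simp only [coeff_monomial, Finset.sum_ite_eq', Finset.mem_range]
  split_ifs with h
  · rfl
  · rw [coeff_eq_zero_of_natDegree_lt (by omega), derivative_zero]

theorem evalEval_innerDerivative (q : ℂ[X][X]) (x z : ℂ) :
    (innerDerivative q).evalEval x z = (derivative (q.eval (C z))).eval x := by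
  rw [eval_eq_sum_range (p := q), derivative_sum, eval_finsetSum, innerDerivative,
    evalEval_finsetSum]
  refine Finset.sum_congr rfl fun n _ => ?_
  rw [← C_pow, derivative_mul, derivative_C, mul_zero, add_zero, eval_mul, eval_C, evalEval,
    eval_monomial, ← C_pow, eval_mul, eval_C]

/-- The leading coefficient is a constant, so the inner derivative has smaller degree and
divisibility would make it zero. Then `q` depends on the outer variable alone and has a root `z`
there, so `q.eval (C z) = 0`. -/
theorem not_dvd_innerDerivative {q : ℂ[X][X]} (hdeg : 0 < q.natDegree)
    (hlead : IsUnit q.leadingCoeff) (hz : ∀ z, q.eval (C z) ≠ 0) : ¬ q ∣ innerDerivative q := by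
  intro hdvd
  have hdeg' : (innerDerivative q).natDegree < q.natDegree := by
    have hle : (innerDerivative q).natDegree ≤ q.natDegree - 1 := by
      refine natDegree_le_iff_coeff_eq_zero.2 fun n hn => ?_
      rw [coeff_innerDerivative]
      rcases (by omega : q.natDegree ≤ n).eq_or_lt with rfl | h
      · exact derivative_eq_zero.2 (natDegree_eq_zero_of_isUnit hlead)
      · rw [coeff_eq_zero_of_natDegree_lt h, derivative_zero]
    omega
  have h0 := eq_zero_of_dvd_of_natDegree_lt hdvd hdeg'
  have hcoeff : ∀ n, q.coeff n = C ((q.coeff n).coeff 0) := by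
    intro n
    have h1 := coeff_innerDerivative q n
    rw [h0, coeff_zero] at h1
    exact eq_C_of_natDegree_eq_zero (derivative_eq_zero.1 h1.symm)
  set q₀ : ℂ[X] := q.map (evalRingHom 0) with hq₀
  have hq : q = q₀.map C := by
    ext1 n
    rw [hcoeff, hq₀, coeff_map, coeff_map, coe_evalRingHom, ← coeff_zero_eq_eval_zero]
  have hq₀deg : 0 < q₀.degree := by
    rw [← natDegree_pos_iff_degree_pos]
    rwa [hq, natDegree_map_eq_of_injective C_injective] at hdeg
  obtain ⟨z, hz0⟩ := IsAlgClosed.exists_root q₀ hq₀deg.ne'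
  refine hz z ?_
  rw [hq, eval_map, eval₂_hom, hz0, C_0]

theorem not_dvd_derivative {q : ℂ[X][X]} (hdeg : 0 < q.natDegree) : ¬ q ∣ derivative q := by
  intro hdvd
  have h0 := eq_zero_of_dvd_of_natDegree_lt hdvd (natDegree_derivative_lt hdeg.ne')
  exact hdeg.ne' (derivative_eq_zero.1 h0)

/-- A bivariate polynomial that is monic up to a unit has a "radical" with simple zeros at generic
points, at which the multiplicities in the two variables agree. -/
theorem exists_generic_radical {p : ℂ[X][X]} (hlead : IsUnit p.leadingCoeff)
    (hz : ∀ z, p.eval (C z) ≠ 0) :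
    ∃ R : ℂ[X][X], (∀ x z, p.evalEval x z = 0 → R.evalEval x z = 0) ∧
      ∃ S : Set ℂ, S.Finite ∧ ∀ x ∉ S, ∀ z, p.evalEval x z = 0 →
        (p.map (evalRingHom x)).rootMultiplicity z = (p.eval (C z)).rootMultiplicity x ∧
          (R.eval (C z)).rootMultiplicity x = 1 := by
  classical
  have hp0 : p ≠ 0 := by
    rintro rfl
    simp at hlead
  set s := UniqueFactorizationMonoid.normalizedFactors p with hs
  set T := s.toFinset with hT
  obtain ⟨u, hu⟩ := UniqueFactorizationMonoid.prod_normalizedFactors hp0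
  rw [← hs, Finset.prod_multiset_count, ← hT] at hu
  have hmem : ∀ {q}, q ∈ T → q ∈ s := fun h => Multiset.mem_toFinset.1 h
  have hprime : ∀ q ∈ T, Prime q := fun q h =>
    UniqueFactorizationMonoid.prime_of_normalized_factor q (hmem h)
  have hdvdp : ∀ q ∈ T, q ∣ p := fun q h =>
    UniqueFactorizationMonoid.dvd_of_mem_normalizedFactors (hmem h)
  have hqlead : ∀ q ∈ T, IsUnit q.leadingCoeff := by
    intro q h
    obtain ⟨k, rfl⟩ := hdvdp q h
    rw [leadingCoeff_mul] at hlead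
    exact isUnit_of_mul_isUnit_left hlead
  have hqdeg : ∀ q ∈ T, 0 < q.natDegree := by
    intro q h
    rw [Nat.pos_iff_ne_zero]
    intro h0
    have h1 := hqlead q h
    rw [eq_C_of_natDegree_eq_zero h0, leadingCoeff_C] at h1
    refine (hprime q h).not_isUnit ?_
    rw [eq_C_of_natDegree_eq_zero h0]
    exact h1.map C
  have hqz : ∀ q ∈ T, ∀ z, q.eval (C z) ≠ 0 := by
    intro q h z h0
    obtain ⟨k, hk⟩ := hdvdp q h
    refine hz z ?_
    rw [hk, eval_mul, h0, zero_mul]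
  have hndvd : ∀ q ∈ T, ∀ q' ∈ T, q ≠ q' → ¬ q ∣ q' := by
    intro q h q' h' hne hdvd
    refine hne (dvd_antisymm_of_normalize_eq
      (UniqueFactorizationMonoid.normalize_normalized_factor q (hmem h))
      (UniqueFactorizationMonoid.normalize_normalized_factor q' (hmem h')) hdvd ?_)
    exact ((hprime q h).dvd_prime_iff_associated (hprime q' h')).1 hdvd |>.symm.dvd
  -- The exceptional `x` are those over which a prime factor meets another one or one of its own
  -- partial derivatives.
  set Z : ℂ[X][X] → ℂ[X][X] → Set ℂ := fun q g =>
    {x : ℂ | ∃ z, q.evalEval x z = 0 ∧ g.evalEval x z = 0} with hZ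
  refine ⟨∏ q ∈ T, q, ?_, ⋃ q ∈ T, ((⋃ q' ∈ T.erase q, Z q q') ∪ (Z q (derivative q) ∪
    Z q (innerDerivative q))), ?_, ?_⟩
  · intro x z h
    have h1 := congrArg (evalEvalRingHom x z) hu
    rw [map_mul, map_prod] at h1
    simp only [map_pow, coe_evalEvalRingHom, h] at h1
    have h2 : evalEval x z (u : ℂ[X][X]) ≠ 0 := (u.isUnit.map (evalEvalRingHom x z)).ne_zero
    have h3 := (mul_eq_zero.1 h1).resolve_right h2
    obtain ⟨q, hq, hq0⟩ := Finset.prod_eq_zero_iff.1 h3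
    rw [← coe_evalEvalRingHom, map_prod]
    exact Finset.prod_eq_zero hq (eq_zero_of_pow_eq_zero hq0)
  · refine Set.Finite.biUnion (Finset.finite_toSet _) fun q hq => ?_
    refine Set.Finite.union (Set.Finite.biUnion (Finset.finite_toSet _) fun q' hq' => ?_)
      (Set.Finite.union ?_ ?_)
    · obtain ⟨h1, h2⟩ := Finset.mem_erase.1 hq'
      exact finite_common_zeros (hprime q hq) (hqlead q hq) (hndvd q hq q' h2 h1.symm)
    · exact finite_common_zeros (hprime q hq) (hqlead q hq) (not_dvd_derivative (hqdeg q hq))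
    · exact finite_common_zeros (hprime q hq) (hqlead q hq)
        (not_dvd_innerDerivative (hqdeg q hq) (hqlead q hq) (hqz q hq))
  · intro x hx z h
    simp only [Set.mem_iUnion, Set.mem_union, not_exists, not_or, exists_prop, not_and] at hx
    have h1 := congrArg (evalEvalRingHom x z) hu
    rw [map_mul, map_prod] at h1
    simp only [map_pow, coe_evalEvalRingHom, h] at h1
    have hu0 : evalEval x z (u : ℂ[X][X]) ≠ 0 := (u.isUnit.map (evalEvalRingHom x z)).ne_zero
    obtain ⟨q, hq, hq0⟩ := Finset.prod_eq_zero_iff.1 ((mul_eq_zero.1 h1).resolve_right hu0)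
    replace hq0 : evalEval x z q = 0 := eq_zero_of_pow_eq_zero hq0
    obtain ⟨hx1, hx2, hx3⟩ := hx q hq
    have hother : ∀ q' ∈ T.erase q, evalEval x z q' ≠ 0 := fun q' h' h0 => hx1 q' h' ⟨z, hq0, h0⟩
    have hd : evalEval x z (derivative q) ≠ 0 := fun h0 => hx2 ⟨z, hq0, h0⟩
    have hd' : evalEval x z (innerDerivative q) ≠ 0 := fun h0 => hx3 ⟨z, hq0, h0⟩
    rw [evalEval_innerDerivative] at hd'
    set w : ℂ[X][X] := (∏ q' ∈ T.erase q, q' ^ s.count q') * u with hw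
    have hw0 : evalEval x z w ≠ 0 := by
      rw [hw, evalEval_mul]
      refine mul_ne_zero ?_ hu0
      rw [← coe_evalEvalRingHom, map_prod, Finset.prod_ne_zero_iff]
      intro q' h'
      rw [map_pow]
      exact pow_ne_zero _ (hother q' h')
    -- With `w` nonzero at `(x, z)` and both partial derivatives of `q` nonzero there, the
    -- multiplicity in either variable is the exponent of `q`.
    have hpw : p = q ^ s.count q * w := by
      rw [← hu, hw, ← mul_assoc, Finset.mul_prod_erase T (fun q => q ^ s.count q) hq]
    have hRw : ∏ q' ∈ T, q' = q ^ 1 * ∏ q' ∈ T.erase q, q' := by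
      rw [pow_one, Finset.mul_prod_erase T (fun q => q) hq]
    refine ⟨?_, ?_⟩
    · rw [hpw, Polynomial.map_mul, Polynomial.map_pow, eval_mul, eval_pow,
        rootMultiplicity_pow_mul, rootMultiplicity_pow_mul]
      · exact hq0
      · exact hd'
      · exact hw0
      · rw [map_evalRingHom_eval, hq0]
      · rw [derivative_map, map_evalRingHom_eval]
        exact hd
      · rw [map_evalRingHom_eval]
        exact hw0
    · rw [hRw, eval_mul, eval_pow, rootMultiplicity_pow_mul]
      · exact hq0
      · exact hd'
      · change evalEval x z _ ≠ 0
        rw [← coe_evalEvalRingHom, map_prod, Finset.prod_ne_zero_iff]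
        exact hother

end Bivariate

end MatrixChebyshev

/-! ### Generic diagonalizability and existence of root vectors -/

namespace MatrixChebyshev

section Semisimple

open Polynomial

/-- Write `g = (X - x) h` with `h` prime to `X - x`. By Bézout `X - x` is a combination of `(X -
x)^k` and `g`, up to multiples, so generalized eigenvectors at `x` are eigenvectors. -/
theorem finrank_eigenspace_of_rootMultiplicity_eq_one {K V : Type*} [Field K] [AddCommGroup V]
    [Module K V] [Module.Finite K V] {f : Module.End K V} {g : K[X]} (hg : aeval f g = 0) {x : K}
    (hx : g.rootMultiplicity x = 1) :
    Module.finrank K (f.eigenspace x) = f.charpoly.rootMultiplicity x := by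
  rw [← LinearMap.finrank_maxGenEigenspace_eq]
  suffices h : f.maxGenEigenspace x ≤ f.eigenspace x by
    rw [le_antisymm h ((f.genEigenspace x).mono le_top)]
  have hg0 : g ≠ 0 := by
    rintro rfl
    simp at hx
  obtain ⟨h, hgh, hh⟩ := exists_eq_pow_rootMultiplicity_mul_and_not_dvd g hg0 x
  rw [hx, pow_one] at hgh
  intro v hv
  rw [Module.End.mem_maxGenEigenspace] at hv
  obtain ⟨k, hk⟩ := hv
  have hcop : IsCoprime ((X - C x) ^ k) h :=
    (((irreducible_X_sub_C x).coprime_iff_not_dvd).2 hh).pow_left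
  obtain ⟨a, b, hab⟩ := hcop
  have hsub : aeval f (X - C x) = f - x • 1 := by
    rw [map_sub, aeval_X, aeval_C, Algebra.algebraMap_eq_smul_one]
  have h1 : X - C x = (X - C x) * a * (X - C x) ^ k + b * g := by
    calc X - C x = (X - C x) * (a * (X - C x) ^ k + b * h) := by rw [hab, mul_one]
      _ = _ := by rw [hgh]; ring
  have h2 := congrArg (fun p => aeval f p v) h1
  simp only [map_add, map_mul, map_pow, hg, hsub, mul_zero, add_zero] at h2
  rw [Module.End.mul_apply, hk, map_zero] at h2
  rw [Module.End.mem_eigenspace_iff, ← sub_eq_zero]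
  exact h2

end Semisimple

variable {r : ℕ} {A B : Matrix (Fin r) (Fin r) ℂ}

section BivariatePolynomial

open Polynomial

/-- The polynomial `Z ^ r * f(Z, X)`, with `X` the inner and `Z` the outer variable. -/
noncomputable def bivariatePoly (A B : Matrix (Fin r) (Fin r) ℂ) : ℂ[X][X] :=
  (Matrix.of fun i j => (X : ℂ[X][X]) ^ 2 * C (C (Aᴴ i j)) +
    X * (C (C (B i j)) - C (X * C ((1 : Matrix (Fin r) (Fin r) ℂ) i j))) + C (C (A i j))).det

theorem map_bivariatePoly (A B : Matrix (Fin r) (Fin r) ℂ) (x : ℂ) :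
    (bivariatePoly A B).map (evalRingHom x) = algPoly A B x := by
  rw [bivariatePoly, ← coe_mapRingHom, RingHom.map_det, algPoly]
  congr 1
  ext1 i j
  simp [mul_comm (C x)]

/-- This links the two readings of the polynomial: in `x` its multiplicities are those of
eigenvalues of the symbol at `z`, in `z` those of the roots of `algPoly`. -/
theorem eval_bivariatePoly (A B : Matrix (Fin r) (Fin r) ℂ) {z : ℂ} (hz : z ≠ 0) :
    (bivariatePoly A B).eval (C z) = C ((-z) ^ r) * (pencil A B z 0).charpoly := by
  rw [bivariatePoly, ← coe_evalRingHom, RingHom.map_det, charpoly, C_pow]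
  have h := Matrix.det_smul (charmatrix (pencil A B z 0)) (C (-z))
  rw [Fintype.card_fin] at h
  rw [← h]
  congr 1
  ext1 i j
  simp only [RingHom.mapMatrix_apply, map_apply, of_apply, coe_evalRingHom, eval_add, eval_mul,
    eval_pow, eval_X, eval_C, eval_sub, Matrix.smul_apply, smul_eq_mul, charmatrix_apply, pencil,
    Matrix.sub_apply, Matrix.add_apply, zero_mul, sub_zero, diagonal_apply, one_apply, map_add,
    map_mul, map_neg]
  have h2 : C z * C z⁻¹ = 1 := by rw [← C_mul, mul_inv_cancel₀ hz, C_1]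
  split_ifs
  · rw [C_1]
    linear_combination (-C (A i j)) * h2
  · rw [C_0]
    linear_combination (-C (A i j)) * h2

theorem eval_bivariatePoly_ne_zero (hA : IsUnit A.det) (B : Matrix (Fin r) (Fin r) ℂ) (z : ℂ) :
    (bivariatePoly A B).eval (C z) ≠ 0 := by
  rcases eq_or_ne z 0 with rfl | hz
  · have : (bivariatePoly A B).eval (C 0) = C A.det := by
      rw [bivariatePoly, ← coe_evalRingHom, RingHom.map_det, RingHom.map_det]
      congr 1
      ext1 i j
      simp
    rw [this, Ne, C_eq_zero]
    exact hA.ne_zero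
  · rw [eval_bivariatePoly A B hz]
    exact mul_ne_zero (C_ne_zero.2 (pow_ne_zero _ (neg_ne_zero.2 hz))) (charpoly_monic _).ne_zero

theorem isUnit_leadingCoeff_bivariatePoly (hA : IsUnit A.det) (B : Matrix (Fin r) (Fin r) ℂ) :
    IsUnit (bivariatePoly A B).leadingCoeff := by
  set N : Matrix (Fin r) (Fin r) ℂ[X][X] := Matrix.of fun i j =>
    (X : ℂ[X][X]) ^ 2 * C (C (Aᴴ i j)) +
    X * (C (C (B i j)) - C (X * C ((1 : Matrix (Fin r) (Fin r) ℂ) i j))) + C (C (A i j)) with hN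
  have hdeg : ∀ i j, (N i j).natDegree ≤ 2 := by
    intro i j
    rw [hN, of_apply, ← C_sub]
    compute_degree
  have h1 := natDegree_det_le_of_entries N 2 hdeg
  have h2 := coeff_det_of_entries N 2 hdeg
  have h3 : (N.map fun p => p.coeff 2).det = C Aᴴ.det := by
    rw [RingHom.map_det]
    congr 1
    ext1 i j
    simp only [hN, map_apply, of_apply, ← C_sub, RingHom.mapMatrix_apply]
    simp
  have hu : IsUnit (C Aᴴ.det : ℂ[X]) := (isUnit_det_conjTranspose hA).map C
  have h4 : N.det.natDegree = Fintype.card (Fin r) * 2 := by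
    refine le_antisymm h1 (le_natDegree_of_ne_zero ?_)
    rw [h2, h3]
    exact hu.ne_zero
  change IsUnit N.det.leadingCoeff
  rw [leadingCoeff, h4, h2, h3]
  exact hu

end BivariatePolynomial

section Diagonalization

open Polynomial

theorem aeval_eq_zero_of_isHermitian {N : Matrix (Fin r) (Fin r) ℂ} (hN : N.IsHermitian)
    {g : ℂ[X]} (hg : ∀ i, g.eval (hN.eigenvalues i : ℂ) = 0) : aeval N g = 0 := by
  have h1 : ∀ i, aeval N g *ᵥ (hN.eigenvectorBasis i).ofLp = 0 := by
    intro i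
    have hpow : ∀ n, N ^ n *ᵥ (hN.eigenvectorBasis i).ofLp =
        (hN.eigenvalues i : ℂ) ^ n • (hN.eigenvectorBasis i).ofLp := by
      intro n
      induction n with
      | zero => simp
      | succ n ih =>
        have h := hN.mulVec_eigenvectorBasis i
        rw [pow_succ', ← mulVec_mulVec, ih, mulVec_smul, h, pow_succ, mul_smul]
        rfl
    rw [aeval_eq_sum_range, sum_mulVec]
    simp only [smul_mulVec, hpow, smul_smul]
    rw [← Finset.sum_smul, ← eval_eq_sum_range, hg, zero_smul]
  have h2 : aeval N g * (hN.eigenvectorUnitary : Matrix (Fin r) (Fin r) ℂ) = 0 := by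
    ext k i
    have := congrFun (h1 i) k
    rw [mul_apply, Matrix.zero_apply]
    simpa [mulVec, dotProduct] using this
  calc aeval N g = aeval N g * (hN.eigenvectorUnitary : Matrix (Fin r) (Fin r) ℂ) *
      star (hN.eigenvectorUnitary : Matrix (Fin r) (Fin r) ℂ) := by
        rw [mul_assoc, mem_unitaryGroup_iff.1 hN.eigenvectorUnitary.2, mul_one]
    _ = 0 := by rw [h2, zero_mul]

theorem differentiableOn_aeval_pencil (A B : Matrix (Fin r) (Fin r) ℂ) (R : ℂ[X][X])
    (i j : Fin r) :
    DifferentiableOn ℂ (fun z => aeval (pencil A B z 0) (R.eval (C z)) i j) {0}ᶜ := by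
  have hpow : ∀ n i j, DifferentiableOn ℂ (fun z => (pencil A B z 0 ^ n) i j) {0}ᶜ := by
    intro n
    induction n with
    | zero => intro i j; simp
    | succ n ih =>
      intro i j
      simp only [pow_succ, mul_apply]
      refine DifferentiableOn.fun_sum fun k _ => (ih i k).mul ?_
      simp only [pencil, Matrix.sub_apply, Matrix.add_apply, Matrix.smul_apply, smul_eq_mul,
        zero_mul, sub_zero]
      exact ((differentiableOn_id.mul_const _).add_const _).add
        ((differentiableOn_inv).mul_const _)
  have haeval : ∀ c : ℂ[X], DifferentiableOn ℂ (fun z => aeval (pencil A B z 0) c i j) {0}ᶜ := by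
    intro c
    simp only [aeval_eq_sum_range, Matrix.sum_apply, Matrix.smul_apply, smul_eq_mul]
    exact DifferentiableOn.fun_sum fun k _ => (hpow k i j).const_mul _
  have heq : (fun z => aeval (pencil A B z 0) (R.eval (C z)) i j) = fun z =>
      ∑ n ∈ Finset.range (R.natDegree + 1), aeval (pencil A B z 0) (R.coeff n) i j * z ^ n := by
    ext z
    rw [eval_eq_sum_range, map_sum, Matrix.sum_apply]
    refine Finset.sum_congr rfl fun n _ => ?_
    rw [← C_pow, mul_comm, ← smul_eq_C_mul, map_smul, Matrix.smul_apply, smul_eq_mul, mul_comm]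
  rw [heq]
  exact DifferentiableOn.fun_sum fun n _ => (haeval _).mul (differentiableOn_pow n)

/-- On the circle the symbol is Hermitian, so it is annihilated by any polynomial vanishing at its
eigenvalues, whatever their multiplicities. The entries are holomorphic on the connected punctured
plane, and the identity theorem does the rest. -/
theorem aeval_pencil_eq_zero (hB : B.IsHermitian) {R : ℂ[X][X]}
    (hR : ∀ x z, (bivariatePoly A B).evalEval x z = 0 → R.evalEval x z = 0) {z : ℂ} (hz : z ≠ 0) :
    aeval (pencil A B z 0) (R.eval (C z)) = 0 := by
  have hcircle : ∀ w : Circle, aeval (pencil A B w 0) (R.eval (C (w : ℂ))) = 0 := by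
    intro w
    have hN : (pencil A B w 0).IsHermitian := by
      simpa using isHermitian_pencil (A := A) hB w 0
    refine aeval_eq_zero_of_isHermitian hN fun i => hR _ _ ?_
    have h1 := det_sub_eigenvalue hN i
    rw [pencil_sub_smul, zero_add] at h1
    rw [← map_evalRingHom_eval, map_bivariatePoly, eval_algPoly A B w.coe_ne_zero, algFun, h1,
      mul_zero]
  ext i j
  have han := (differentiableOn_aeval_pencil A B R i j).analyticOnNhd isOpen_compl_singleton
  have hconn : IsPreconnected ({0}ᶜ : Set ℂ) :=
    (isConnected_compl_singleton_of_one_lt_rank (by simp) 0).isPreconnected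
  refine han.eqOn_zero_of_preconnected_of_frequently_eq_zero hconn (z₀ := 1) (by simp) ?_ hz
  -- The points `exp(iθ)` with `θ ↓ 0` accumulate at `1` without equalling it.
  have htend : Filter.Tendsto (fun θ : ℝ => Complex.exp (θ * Complex.I))
      (nhdsWithin 0 (Set.Ioo 0 1)) (nhdsWithin 1 {1}ᶜ) := by
    refine tendsto_nhdsWithin_iff.2 ⟨?_, ?_⟩
    · have : Continuous fun θ : ℝ => Complex.exp (θ * Complex.I) := by fun_prop
      have h := this.tendsto 0
      simp only [Complex.ofReal_zero, zero_mul, Complex.exp_zero] at h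
      exact h.mono_left nhdsWithin_le_nhds
    · filter_upwards [self_mem_nhdsWithin] with θ hθ h
      have h1 : Complex.exp (θ * Complex.I) = 1 := h
      have h2 := congrArg Complex.im h1
      rw [Complex.exp_ofReal_mul_I_im, Complex.one_im] at h2
      have := Real.sin_pos_of_pos_of_lt_pi hθ.1 (hθ.2.trans (by linarith [Real.pi_gt_three]))
      exact this.ne' h2
  have hne : (nhdsWithin (0 : ℝ) (Set.Ioo 0 1)).NeBot := by
    rw [nhdsWithin_Ioo_eq_nhdsGT one_pos]
    infer_instance
  refine htend.frequently (Filter.Eventually.frequently (Filter.Eventually.of_forall fun θ => ?_))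
  have := hcircle (Circle.exp θ)
  rw [Circle.coe_exp] at this
  rw [this, Matrix.zero_apply]

/-- For all but finitely many `x`, geometric and algebraic multiplicities of all roots agree. -/
theorem exists_finite_geomMult_eq (hA : IsUnit A.det) (hB : B.IsHermitian) :
    ∃ S : Set ℂ, S.Finite ∧ ∀ x ∉ S, ∀ z ∈ (algPoly A B x).roots,
      geomMult A B z x = (algPoly A B x).rootMultiplicity z := by
  obtain ⟨R, hR, S, hS, hgen⟩ := exists_generic_radical (isUnit_leadingCoeff_bivariatePoly hA B)
    (eval_bivariatePoly_ne_zero hA B)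
  refine ⟨S, hS, fun x hx z hz => ?_⟩
  have hz0 := ne_zero_of_mem_roots hA hz
  have hroot : (bivariatePoly A B).evalEval x z = 0 := by
    rw [← map_evalRingHom_eval, map_bivariatePoly]
    exact (Polynomial.mem_roots (algPoly_ne_zero hA B x)).1 hz
  -- `h1` exchanges the multiplicity in `z` for that in `x`; `h2` is the simple zero that makes the
  -- eigenvalue `x` of the symbol semisimple.
  obtain ⟨h1, h2⟩ := hgen x hx z hroot
  rw [map_bivariatePoly, eval_bivariatePoly A B hz0] at h1
  set b := PiLp.basisFun 2 ℂ (Fin r)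
  have h3 := finrank_eigenspace_of_rootMultiplicity_eq_one
    (f := Matrix.toLinAlgEquiv b (pencil A B z 0)) (x := x) (g := R.eval (C z)) (by
      have := aeval_pencil_eq_zero (A := A) hB hR hz0
      have h4 := Polynomial.aeval_algHom_apply (Matrix.toLinAlgEquiv b).toAlgHom (pencil A B z 0)
        (R.eval (C z))
      rw [this, map_zero] at h4
      exact h4) h2
  have h5 : (Matrix.toLinAlgEquiv b (pencil A B z 0)).charpoly = (pencil A B z 0).charpoly :=
    Matrix.charpoly_toLin _ b
  have hc : C ((-z) ^ r) ≠ 0 := C_ne_zero.2 (pow_ne_zero _ (neg_ne_zero.2 hz0))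
  rw [h5] at h3
  rw [h1, rootMultiplicity_mul (mul_ne_zero hc (charpoly_monic _).ne_zero), rootMultiplicity_C,
    zero_add, ← h3, geomMult]
  have h6 : Matrix.toEuclideanLin (pencil A B z x) =
      Matrix.toLinAlgEquiv b (pencil A B z 0) - x • 1 := by
    have h7 : pencil A B z x = pencil A B z 0 - x • 1 := by rw [pencil_sub_smul, zero_add]
    have h8 : ∀ M : Matrix (Fin r) (Fin r) ℂ,
        Matrix.toEuclideanLin M = Matrix.toLinAlgEquiv b M := by
      intro M
      exact LinearMap.congr_fun
        (congrArg LinearEquiv.toLinearMap (Matrix.toLpLin_eq_toLin (R := ℂ) 2 2)) M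
    rw [h8, h7, map_sub, map_smul, map_one]
  rw [h6, Module.End.eigenspace_def]

end Diagonalization

/-- If geometric and algebraic multiplicities agree, root vectors exist. -/
theorem exists_isRootVectorChoice (hA : IsUnit A.det) {x : ℂ}
    (h : ∀ z ∈ (algPoly A B x).roots, geomMult A B z x = (algPoly A B x).rootMultiplicity z) :
    ∃ z v, IsRootVectorChoice A B x z v := by
  classical
  obtain ⟨z, hz⟩ := exists_isRootOrdering hA B x
  have hroot : ∀ k, z k ∈ (algPoly A B x).roots := by
    intro k
    rw [← hz.1]
    exact Multiset.mem_map_of_mem z (Finset.mem_univ k)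
  set E : ℂ → Submodule ℂ (EuclideanSpace ℂ (Fin r)) := fun w =>
    LinearMap.ker (Matrix.toEuclideanLin (pencil A B w x)) with hE
  have hcard : ∀ k, Fintype.card (Fin (Module.finrank ℂ (E (z k)))) =
      Fintype.card {l // z l = z k} := by
    intro k
    rw [Fintype.card_fin]
    refine (h _ (hroot k)).trans ?_
    rw [← Polynomial.count_roots, ← hz.1, Multiset.count_map, Fintype.card_subtype]
    simp only [eq_comm (a := z k)]
    rfl
  -- An orthonormal basis of each null space is indexed by the fibre of the root; the sizes agree
  -- because the two multiplicities do.
  set e : ∀ w : ℂ, (∃ k, z k = w) → OrthonormalBasis {l // z l = w} ℂ (E w) := fun w hw =>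
    (stdOrthonormalBasis ℂ (E w)).reindex (Fintype.equivOfCardEq (by
      obtain ⟨k, rfl⟩ := hw; exact hcard k)) with he
  set v : Fin (2 * r) → EuclideanSpace ℂ (Fin r) := fun k => (e (z k) ⟨k, rfl⟩ ⟨k, rfl⟩ : E (z k))
    with hv
  have hvl : ∀ w (hw : ∃ k, z k = w) l (hl : z l = w), v l = (e w hw ⟨l, hl⟩ : E w) := by
    rintro w hw l rfl
    rfl
  refine ⟨z, v, hz, ?_, ?_, ?_, fun k => h _ (hroot k)⟩
  · intro k
    exact (e (z k) ⟨k, rfl⟩).orthonormal.1 _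
  · intro k
    exact (e (z k) ⟨k, rfl⟩ ⟨k, rfl⟩).2
  · intro k
    have hspan : Submodule.span ℂ {w | ∃ l, z l = z k ∧ w = v l} = E (z k) := by
      have h1 : {w | ∃ l, z l = z k ∧ w = v l} =
          (E (z k)).subtype '' Set.range (e (z k) ⟨k, rfl⟩) := by
        ext w
        constructor
        · rintro ⟨l, hl, rfl⟩
          exact ⟨_, ⟨⟨l, hl⟩, rfl⟩, (hvl _ ⟨k, rfl⟩ l hl).symm⟩
        · rintro ⟨_, ⟨⟨l, hl⟩, rfl⟩, rfl⟩
          exact ⟨l, hl, (hvl _ ⟨k, rfl⟩ l hl).symm⟩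
      rw [h1, ← Submodule.map_span]
      have h2 := (e (z k) ⟨k, rfl⟩).toBasis.span_eq
      rw [OrthonormalBasis.coe_toBasis] at h2
      rw [h2, Submodule.map_subtype_top]
    rw [hspan]
    rfl

end MatrixChebyshev

/-! ### Supports, Stieltjes transforms and the final statement -/

namespace MatrixChebyshev

variable {r : ℕ} {A B : Matrix (Fin r) (Fin r) ℂ}

/-- A set avoiding `Γ` and the mass points meets the spectrum in finitely many points, none of them
charged. Only charged spectral points enter the exceptional set, as genuine mass points are
required. -/
theorem MatrixMeasure.HasMoments.supportedOnWithMassPoints {M : MatrixMeasure r} {H : Type*}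
    [NormedAddCommGroup H] [InnerProductSpace ℂ H] [CompleteSpace H] {J : H →L[ℂ] H}
    {e : Fin r → H} (hM : M.HasMoments J e) (hJ : IsSelfAdjoint J) {Γ : Set ℂ} {b : Set ℝ}
    (hfin : (spectrum ℝ J \ b).Finite) (hb : ∀ t ∈ b, (t : ℂ) ∈ Γ) :
    M.SupportedOnWithMassPoints Γ := by
  refine ⟨{t | t ∈ spectrum ℝ J \ b ∧ ∃ i j, M.entry i j {t} ≠ 0}, hfin.subset fun t ht => ht.1,
    fun t ht => ht.2, fun s _ hs => M.entry_eq_zero fun i => ?_⟩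
  have hsub : s ⊆ (spectrum ℝ J)ᶜ ∪ ⋃ t ∈ s ∩ spectrum ℝ J, {t} := by
    intro t ht
    by_cases htJ : t ∈ spectrum ℝ J
    · exact Or.inr (Set.mem_biUnion ⟨ht, htJ⟩ rfl)
    · exact Or.inl htJ
  have hdiff : s ∩ spectrum ℝ J ⊆ spectrum ℝ J \ b := fun t ht =>
    ⟨ht.2, fun h => (hs t ht.1).1 (hb t h)⟩
  refine measure_mono_null hsub (measure_union_null (hM.diagMeasure_compl_spectrum hJ i) ?_)
  rw [measure_biUnion_null_iff (hfin.subset hdiff).countable]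
  intro t ht
  have h0 : M.entry i i {t} = 0 := by
    by_contra hne
    exact (hs t ht.1).2 ⟨hdiff ht, i, i, hne⟩
  rw [M.entry_self_apply i (measurableSet_singleton t), Complex.ofReal_eq_zero,
    measureReal_eq_zero_iff] at h0
  exact h0

/-- The Stieltjes transforms of both measures away from the spectra of the Jacobi operators. -/
theorem stieltjes_facts {c x : ℂ} {W X : MatrixMeasure r} (hB : B.IsHermitian)
    (hW : W.HasMoments (jacobiOp 1 A B) fun i => seqSingle 0 (EuclideanSpace.single i 1))
    (hX : X.HasMoments (jacobiOp c A B) fun i => seqSingle 0 (EuclideanSpace.single i 1))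
    (hxW : ∀ t ∈ spectrum ℝ (jacobiOp 1 A B), x ≠ (t : ℂ))
    (hxX : ∀ t ∈ spectrum ℝ (jacobiOp c A B), x ≠ (t : ℂ)) :
    W.StieltjesConverges x ∧ X.StieltjesConverges x ∧
      (x • (1 : Matrix (Fin r) (Fin r) ℂ) - B - Aᴴ * W.stieltjes x * A) * W.stieltjes x = 1 ∧
      (x • (1 : Matrix (Fin r) (Fin r) ℂ) - B - (c * star c) • (Aᴴ * W.stieltjes x * A)) *
        X.stieltjes x = 1 ∧
      (∀ (w : Fin r → ℂ) (z : ℂ), w ≠ 0 → (W.stieltjes x * A) *ᵥ w = z • w → ‖z‖ < 1) ∧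
      ∀ (w : Fin r → ℂ) (z : ℂ), w ≠ 0 → ((W.stieltjes x)ᴴ * A) *ᵥ w = z • w → ‖z‖ < 1 := by
  have hJ := isSelfAdjoint_jacobiOp 1 A hB
  obtain ⟨G, hG, hG', hWc, hWs⟩ := hW.exists_resolvent hJ hxW
  obtain ⟨Gc, hGc, -, hXc, hXs⟩ := hX.exists_resolvent (isSelfAdjoint_jacobiOp c A hB) hxX
  have hWG : W.stieltjes x = cornerBlock G := by
    ext i j
    exact hWs i j
  have hXG : X.stieltjes x = cornerBlock Gc := by
    ext i j
    exact hXs i j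
  -- The adjoint of the resolvent at `x` is the resolvent at `conj x`, with corner block `Fᴴ`; this
  -- yields the eigenvalue bound for `Fᴴ A`.
  have hstar : star (x • 1 - jacobiOp 1 A B) = star x • 1 - jacobiOp 1 A B := by
    rw [star_sub, star_smul, star_one, hJ.star_eq]
  have hs : star G * (star x • 1 - jacobiOp 1 A B) = 1 := by
    rw [← hstar, ← star_mul, hG, star_one]
  have hs' : (star x • 1 - jacobiOp 1 A B) * star G = 1 := by
    rw [← hstar, ← star_mul, hG', star_one]
  rw [hWG, hXG]
  refine ⟨hWc, hXc, ?_, cornerBlock_resolvent hG' hGc, fun w z hw hz =>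
    norm_lt_one_of_mulVec_eq hG' hG hw hz, fun w z hw hz => ?_⟩
  · have := cornerBlock_resolvent (c := 1) hG' hG
    rwa [star_one, mul_one, one_smul] at this
  · rw [← cornerBlock_star] at hz
    exact norm_lt_one_of_mulVec_eq hs hs' hw hz

theorem ne_ofReal_of_notMem_gammaZero (hr : 1 ≤ r) (hA : IsUnit A.det) (hB : B.IsHermitian)
    {c x : ℂ} (hx : x ∉ gammaZero A B)
    (hx' : x ∉ Complex.ofReal '' (spectrum ℝ (jacobiOp c A B) \ bandSet A B)) :
    ∀ t ∈ spectrum ℝ (jacobiOp c A B), x ≠ (t : ℂ) := by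
  rintro t ht rfl
  exact hx' ⟨t, ⟨ht, fun h => hx (ofReal_mem_gammaZero hr hA hB h)⟩, rfl⟩

end MatrixChebyshev

open MatrixChebyshev in
theorem proposition4p1 {r : ℕ} (hr : 1 ≤ r) (A B : Matrix (Fin r) (Fin r) ℂ)
    (hA : IsUnit A.det) (hB : B.IsHermitian) (W X : MatrixMeasure r)
    (hW : W.IsSpectralMeasure (secondKindCoeff Aᴴ) (fun _ => B))
    (hX : X.IsSpectralMeasure (firstKindCoeff Aᴴ) (fun _ => B)) :
    (∃ S : Set ℂ, S.Finite ∧ ∀ x : ℂ, x ∉ gammaZero A B → x ∉ S →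
      W.StieltjesConverges x ∧ X.StieltjesConverges x ∧
      IsUnit (x • (1 : Matrix (Fin r) (Fin r) ℂ) - B
        - (2 : ℂ) • (Aᴴ * W.stieltjes x * A)).det ∧
      X.stieltjes x = (x • (1 : Matrix (Fin r) (Fin r) ℂ) - B
        - (2 : ℂ) • (Aᴴ * W.stieltjes x * A))⁻¹ ∧
      (∃ z v, IsRootVectorChoice A B x z v) ∧
      ∀ z v, IsRootVectorChoice A B x z v →
        IsUnit (smallVectors v).det ∧ IsUnit (smallRoots z).det ∧
        W.stieltjes x = smallVectors v * smallRoots z * (smallVectors v)⁻¹ * A⁻¹ ∧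
        IsUnit (A * smallVectors v * (smallRoots z)⁻¹
          - Aᴴ * smallVectors v * smallRoots z).det ∧
        X.stieltjes x = smallVectors v * (A * smallVectors v * (smallRoots z)⁻¹
          - Aᴴ * smallVectors v * smallRoots z)⁻¹) ∧
    W.SupportedOnWithMassPoints (gammaZero A B) ∧
    X.SupportedOnWithMassPoints (gammaZero A B) := by
  have hAu := isUnit_det_conjTranspose hA
  set c : ℂ := ((Real.sqrt 2 : ℝ) : ℂ) with hc
  -- `|√2|²` is the factor 2 in the formula for `X`.
  have hcc : c * star c = 2 := by
    have : star c = c := Complex.conj_ofReal _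
    rw [this, hc, ← Complex.ofReal_mul, Real.mul_self_sqrt (by norm_num)]
    norm_num
  have hc0 : c ≠ 0 := by
    intro h
    rw [h, zero_mul] at hcc
    norm_num at hcc
  have hWm : W.HasMoments (jacobiOp 1 A B) fun i => seqSingle 0 (EuclideanSpace.single i 1) := by
    refine hW.hasMoments hB (fun _ => hAu) fun n => ?_
    simp [scaledCoeff]
  have hXm : X.HasMoments (jacobiOp c A B) fun i => seqSingle 0 (EuclideanSpace.single i 1) := by
    refine hX.hasMoments hB (fun n => ?_) fun n => ?_
    · rw [firstKindCoeff]
      split_ifs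
      · rw [det_smul]
        exact (IsUnit.mk0 _ (pow_ne_zero _ hc0)).mul hAu
      · exact hAu
    · simp [firstKindCoeff, scaledCoeff, hc]
  have hband : ∀ t ∈ bandSet A B, (t : ℂ) ∈ gammaZero A B := fun t ht =>
    ofReal_mem_gammaZero hr hA hB ht
  have hfinW := finite_spectrum_diff_bandSet 1 (A := A) hB
  have hfinX := finite_spectrum_diff_bandSet c (A := A) hB
  obtain ⟨S, hS, hmult⟩ := exists_finite_geomMult_eq hA hB
  -- The excluded `x` are the spectral points of either operator off the bands and the points where
  -- multiplicities may differ.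
  refine ⟨⟨Complex.ofReal '' (spectrum ℝ (jacobiOp 1 A B) \ bandSet A B) ∪
    Complex.ofReal '' (spectrum ℝ (jacobiOp c A B) \ bandSet A B) ∪ S,
    ((hfinW.image _).union (hfinX.image _)).union hS, fun x hx hxS => ?_⟩,
    hWm.supportedOnWithMassPoints (isSelfAdjoint_jacobiOp 1 A hB) hfinW hband,
    hXm.supportedOnWithMassPoints (isSelfAdjoint_jacobiOp c A hB) hfinX hband⟩
  rw [Set.mem_union, Set.mem_union, not_or, not_or] at hxS
  obtain ⟨hWc, hXc, hF, hFx, hin, hin'⟩ := stieltjes_facts hB hWm hXm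
    (ne_ofReal_of_notMem_gammaZero hr hA hB hx hxS.1.1)
    (ne_ofReal_of_notMem_gammaZero hr hA hB hx hxS.1.2)
  rw [hcc] at hFx
  refine ⟨hWc, hXc, isUnit_det_of_right_inverse hFx, (inv_eq_right_inv hFx).symm,
    exists_isRootVectorChoice hA (hmult x hxS.2), fun z v h => ?_⟩
  obtain ⟨hV, hD, hVD⟩ := smallVectors_facts hA hF hin hin' h
  obtain ⟨h1, h2, h3⟩ := formulas_of_smallVectors hA hF hFx hV hD hVD
  exact ⟨hV, hD, h1, h2, h3⟩
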